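/- **Setting.** Let $\Gamma$ be a simplicial graph (undirected, without loops and multiple edges, possibly infinite) with vertex set $V$; put $\mathrm{Star}(v)=\{v\}\cup\{w: w\text{ adjacent to }v\}$. A *word* is a finite sequence of vertices, the empty word included. *Equivalence* of words is generated by the moves (I) $(\dots,v,v,\dots)\simeq(\dots,v,\dots)$ and (II) $(\dots,v,w,\dots)\simeq(\dots,w,v,\dots)$ for adjacent $v,w$. A word $(v_1,\dots,v_n)$ is *reduced* if, whenever $v_k=v_l=v$ with $k<l$, not all of $v_{k+1},\dots,v_{l-1}$ lie in $\mathrm{Star}(v)$. Let $\mathcal W$ be a complete set of representatives (*minimal words*) of the reduced words under equivalence; it contains the empty word. For each $v\in V$ let $\mathcal H_v$ be a Hilbert space with a unit vector $\xi_v$, and let $\mathcal H_v^\circ=\mathcal H_v\ominus\mathbb C\xi_v$. For a word $w=(v_1,\dots,v_n)$ let $\mathcal H_w=\mathcal H_{v_1}^\circ\otimes\dots\otimes\mathcal H_{v_n}^\circ$ (Hilbert space tensor product), where for the empty word $\mathcal H_\emptyset=\mathbb C\Omega$ with a unit vector $\Omega$. The *graph product Hilbert space* is $\mathcal H=\bigoplus_{w\in\mathcal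 W}\mathcal H_w$. If $w\in\mathcal W$ is such that $vw$ is reduced, and $w'\in\mathcal W$ is the minimal word equivalent to $vw$, then $w'$ is obtained from $vw$ by a unique permutation of letters that keeps the order of equal letters; permuting tensor factors accordingly gives a unitary $\mathcal Q_{vw}:\mathcal H_v^\circ\otimes\mathcal H_w\to\mathcal H_{w'}$. Let $\mathcal H(v)=\bigoplus\{\mathcal H_w: w\in\mathcal W,\ vw\text{ reduced}\}$ and let $U_v:\mathcal H_v\otimes\mathcal H(v)\to\mathcal H$ be the unitary with $U_v(\xi_v\otimes\eta)=\eta$ and $U_v(\zeta\otimes\eta)=\mathcal Q_{vw}(\zeta\otimes\eta)$ for $\zeta\in\mathcal H_v^\circ$, $\eta\in\mathcal H_w\subset\mathcal H(v)$. Put $\lambda_v(x)=U_v(x\otimes1)U_v^*$ for $x\in\mathcal B(\mathcal H_v)$. Let $(M_v,\omega_v)_{v\in V}$ be von Neumann algebras with faithful normal states, in their GNS representations: $M_v\subset\mathcal B(\mathcal H_v)$ and $\omega_v(x)=\langle x\xi_v,\xi_v\rangle$, with $\xi_v$ a unit vector that is cyclic and separating for $M_v$. The *graph product von Neumann algebra*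 is $M_\Gamma=\bigl(\bigcup_v\lambda_v(M_v)\bigr)''\subset\mathcal B(\mathcal H)$, and $M_v$ is identified with $\lambda_v(M_v)\subset M_\Gamma$. The *graph product state* is $\omega_\Gamma(x)=\langle x\Omega,\Omega\rangle$. Put $M_v^\circ=\{x\in M_v:\omega_v(x)=0\}$; a *reduced operator* is a product $a_1\cdots a_n\in M_\Gamma$ with $a_k\in M_{v_k}^\circ$ and $(v_1,\dots,v_n)$ a reduced word. Let $(N_v,\mu_v)_{v\in V}$ be a second such family, $N_v\subset\mathcal B(\mathcal K_v)$ with GNS vectors $\eta_v$; form $\mathcal K_w$, $N_\Gamma$, $\mu_\Gamma$ and the vacuum vector $\Omega$ from it with the same $\mathcal W$. The *$L^2$-extension* of a linear map $\psi$ between two of these algebras with vector states given by $\xi,\eta$ is the bounded operator $T_\psi$ with $T_\psi(x\xi)=\psi(x)\eta$ for all $x$, if it exists. **Proposition 2.30.** For every $v\in V$ let $\varphi_v:M_v\to N_v$ be a normal unital completely positive (ucp) map with $\mu_v\circ\varphi_v=\omega_v$. Then there is a unique normal ucp map $\varphi:M_\Gamma\to N_\Gamma$ such that $$\varphi(a_1\cdots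 a_n)=\varphi_{v_1}(a_1)\cdots\varphi_{v_n}(a_n)$$ for every reduced operator $a_1\cdots a_n$ with $a_k\in M_{v_k}^\circ$. Moreover $\mu_\Gamma\circ\varphi=\omega_\Gamma$; the $L^2$-extensions $T_{\varphi_v}:\mathcal H_v\to\mathcal K_v$ and $T_\varphi:\mathcal H\to\mathcal K$ exist; $T_{\varphi_v}$ restricts to $T_{\varphi_v}^\circ:\mathcal H_v^\circ\to\mathcal K_v^\circ$; and $$T_\varphi=\mathrm{id}_{\mathbb C\Omega}\oplus\bigoplus_{\emptyset\ne w=(v_1,\dots,v_n)\in\mathcal W}T_{\varphi_{v_1}}^\circ\otimes\dots\otimes T_{\varphi_{v_n}}^\circ .$$ -/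

import Mathlib

open scoped TensorProduct InnerProductSpace ComplexOrder

set_option linter.unusedSectionVars false

noncomputable section

namespace GraphProd

section Words

variable {V : Type*} (G : SimpleGraph V)

/-- The move of type I on words: two equal neighbouring letters are merged. -/
inductive StepI : List V → List V → Prop
  | mk (p q : List V) (v : V) : StepI (p ++ v :: v :: q) (p ++ v :: q)

/-- The move of type II on words: two neighbouring letters joined by an edge are interchanged. -/
inductive StepII : List V → List V → Prop
  | mk (p q : List V) (v w : V) (h : G.Adj v w) : StepII (p ++ v :: w :: q) (p ++ w :: v :: q)

/-- Equivalence of words: the equivalence relation generated by the moves of type I and II. -/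
def WordEquiv (l l' : List V) : Prop :=
  Relation.EqvGen (fun a b => StepI a b ∨ StepII G a b) l l'

/-- Type II equivalence: the equivalence relation generated by the moves of type II. -/
def TypeII (l l' : List V) : Prop := Relation.EqvGen (StepII G) l l'

/-- A word is reduced if, whenever a letter `v` occurs at two places, not all the letters strictly
between them lie in `Star(v)`. -/
def IsReduced (l : List V) : Prop :=
  ∀ (p m q : List V) (v : V), l = p ++ v :: (m ++ v :: q) → ∃ x ∈ m, ¬ (x = v ∨ G.Adj v x)

/-- `Reach G v l`: the letter `v` occurs in `l`, preceded only by letters of `Star(v)`. -/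
def Reach (v : V) : List V → Prop
  | [] => False
  | x :: l => x = v ∨ (G.Adj v x ∧ Reach v l)

theorem reach_iff (v : V) (l : List V) :
    Reach G v l ↔ ∃ m q, l = m ++ v :: q ∧ ∀ x ∈ m, (x = v ∨ G.Adj v x) := by
  induction l with
  | nil => simp [Reach]
  | cons a l ih =>
    simp only [Reach, ih]
    constructor
    · rintro (rfl | ⟨h, m, q, rfl, hm⟩)
      · exact ⟨[], l, rfl, by simp⟩
      · exact ⟨a :: m, q, rfl, by simpa using ⟨Or.inr h, hm⟩⟩
    · rintro ⟨m, q, h, hm⟩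
      cases m with
      | nil => left; simpa using (List.cons.inj h).1
      | cons b m =>
        obtain ⟨rfl, h2⟩ := List.cons.inj h
        rcases hm a (by simp) with h3 | h3
        · exact Or.inl h3
        · exact Or.inr ⟨h3, m, q, h2, fun x hx => hm x (by simp [hx])⟩

theorem isReduced_nil : IsReduced G ([] : List V) := by
  intro p m q v h; simp at h

theorem isReduced_cons (a : V) (l : List V) :
    IsReduced G (a :: l) ↔ ¬ Reach G a l ∧ IsReduced G l := by
  constructor
  · intro h
    refine ⟨?_, ?_⟩
    · rw [reach_iff]
      rintro ⟨m, q, rfl, hm⟩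
      obtain ⟨x, hx, hx'⟩ := h [] m q a rfl
      exact hx' (hm x hx)
    · rintro p m q v rfl
      exact h (a :: p) m q v rfl
  · rintro ⟨h1, h2⟩ p m q v h
    cases p with
    | nil =>
      obtain ⟨rfl, h⟩ := List.cons.inj h
      by_contra hc
      push Not at hc
      exact h1 ((reach_iff G a l).2 ⟨m, q, h, hc⟩)
    | cons b p =>
      obtain ⟨rfl, h⟩ := List.cons.inj h
      exact h2 p m q v (by simpa using ‹_›)

theorem reach_stepII {l l' : List V} (h : StepII G l l') (x : V) :
    Reach G x l ↔ Reach G x l' := by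
  obtain ⟨p, q, v, w, h⟩ := h
  induction p with
  | nil =>
    simp only [List.nil_append, Reach]
    have := h.symm
    constructor
    · rintro (rfl | ⟨h1, rfl | h2⟩) <;> tauto
    · rintro (rfl | ⟨h1, rfl | h2⟩) <;> tauto
  | cons a p ih => simp only [List.cons_append, Reach, ih]

theorem isReduced_stepII {l l' : List V} (h : StepII G l l') :
    IsReduced G l ↔ IsReduced G l' := by
  obtain ⟨p, q, v, w, h⟩ := h
  induction p with
  | nil =>
    simp only [List.nil_append, isReduced_cons, Reach]
    have h1 := h.symm
    have h2 := h.ne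
    have h3 := h.ne'
    tauto
  | cons a p ih =>
    simp only [List.cons_append, isReduced_cons, ih]
    rw [reach_stepII G (StepII.mk p q v w h)]

theorem reach_typeII {l l' : List V} (h : TypeII G l l') (x : V) :
    Reach G x l ↔ Reach G x l' := by
  induction h with
  | rel _ _ h => exact reach_stepII G h x
  | refl => exact Iff.rfl
  | symm _ _ _ ih => exact ih.symm
  | trans _ _ _ _ _ ih1 ih2 => exact ih1.trans ih2

theorem isReduced_typeII {l l' : List V} (h : TypeII G l l') :
    IsReduced G l ↔ IsReduced G l' := by
  induction h with
  | rel _ _ h => exact isReduced_stepII G h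
  | refl => exact Iff.rfl
  | symm _ _ _ ih => exact ih.symm
  | trans _ _ _ _ _ ih1 ih2 => exact ih1.trans ih2

theorem TypeII.cons {l l' : List V} (h : TypeII G l l') (a : V) : TypeII G (a :: l) (a :: l') := by
  induction h with
  | rel _ _ h =>
    obtain ⟨p, q, v, w, h⟩ := h
    exact .rel _ _ (StepII.mk (a :: p) q v w h)
  | refl => exact .refl _
  | symm _ _ _ ih => exact ih.symm
  | trans _ _ _ _ _ ih1 ih2 => exact ih1.trans _ _ _ ih2

theorem TypeII.wordEquiv {l l' : List V} (h : TypeII G l l') : WordEquiv G l l' :=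
  Relation.EqvGen.mono (r := StepII G) (fun _ _ h => Or.inr h) _ _ h

theorem TypeII.length_eq {l l' : List V} (h : TypeII G l l') : l.length = l'.length := by
  induction h with
  | rel _ _ h => obtain ⟨p, q, v, w, h⟩ := h; simp
  | refl => rfl
  | symm _ _ _ ih => exact ih.symm
  | trans _ _ _ _ _ ih1 ih2 => exact ih1.trans ih2

open Classical in
theorem TypeII.erase {l l' : List V} (h : TypeII G l l') (a : V) :
    TypeII G (l.erase a) (l'.erase a) := by
  induction h with
  | rel _ _ h =>
    obtain ⟨p, q, v, w, h⟩ := h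
    by_cases hp : a ∈ p
    · rw [List.erase_append_left _ hp, List.erase_append_left _ hp]
      exact .rel _ _ (StepII.mk _ q v w h)
    · rw [List.erase_append_right _ hp, List.erase_append_right _ hp]
      have := h.ne
      by_cases h1 : v = a
      · subst h1
        have h2 : w ≠ v := h.ne'
        simp only [List.erase_cons_head, List.erase_cons, beq_iff_eq, h2, if_false]
        exact .refl _
      · by_cases h2 : w = a
        · subst h2
          simp only [List.erase_cons_head, List.erase_cons, beq_iff_eq, h1, if_false]
          exact .refl _
        · simp only [List.erase_cons, beq_iff_eq, h1, h2, if_false]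
          exact .rel _ _ (StepII.mk _ _ v w h)
  | refl => exact .refl _
  | symm _ _ _ ih => exact ih.symm
  | trans _ _ _ _ _ ih1 ih2 => exact ih1.trans _ _ _ ih2

theorem TypeII.of_cons {l l' : List V} {a : V} (h : TypeII G (a :: l) (a :: l')) :
    TypeII G l l' := by
  classical
  simpa using h.erase G a

open Classical in
/-- Adding a letter on the left of a word, unless it can be absorbed. -/
def absorb (x : V) (l : List V) : List V := if Reach G x l then l else x :: l

theorem absorb_typeII {l l' : List V} (h : TypeII G l l') (x : V) :
    TypeII G (absorb G x l) (absorb G x l') := by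
  unfold absorb
  by_cases h1 : Reach G x l
  · rw [if_pos h1, if_pos ((reach_typeII G h x).1 h1)]; exact h
  · rw [if_neg h1, if_neg (fun h2 => h1 ((reach_typeII G h x).2 h2))]; exact h.cons G x

theorem foldr_absorb_wordEquiv {l l' : List V} (h : WordEquiv G l l') :
    TypeII G (l.foldr (absorb G) []) (l'.foldr (absorb G) []) := by
  induction h with
  | rel a b h =>
    have key : ∀ (p r r' : List V), TypeII G (r.foldr (absorb G) []) (r'.foldr (absorb G) []) →
        TypeII G ((p ++ r).foldr (absorb G) []) ((p ++ r').foldr (absorb G) []) := by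
      intro p r r' h
      induction p with
      | nil => exact h
      | cons a p ih => exact absorb_typeII G ih a
    rcases h with ⟨p, q, v⟩ | ⟨p, q, v, w, hvw⟩
    · apply key
      simp only [List.foldr_cons]
      generalize q.foldr (absorb G) [] = s
      have : absorb G v (absorb G v s) = absorb G v s := by
        by_cases h1 : Reach G v s
        · simp [absorb, h1]
        · simp [absorb, h1, Reach]
      rw [this]; exact .refl _
    · apply key
      simp only [List.foldr_cons]
      generalize q.foldr (absorb G) [] = s
      have e1 : Reach G v (w :: s) ↔ Reach G v s := by
        have := hvw.ne'; simp only [Reach]; tauto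
      have e2 : Reach G w (v :: s) ↔ Reach G w s := by
        have := hvw.ne; have := hvw.symm; simp only [Reach]; tauto
      by_cases h1 : Reach G v s <;> by_cases h2 : Reach G w s
      · simp only [absorb, h1, h2, if_true]; exact .refl _
      · simp only [absorb, h1, h2, e1, if_true, if_false]; exact .refl _
      · simp only [absorb, h1, h2, e2, if_true, if_false]; exact .refl _
      · simp only [absorb, h1, h2, e1, e2, if_false]
        exact .rel _ _ (StepII.mk [] s v w hvw)
  | refl => exact .refl _
  | symm _ _ _ ih => exact ih.symm
  | trans _ _ _ _ _ ih1 ih2 => exact ih1.trans _ _ _ ih2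

theorem foldr_absorb_of_isReduced {l : List V} (h : IsReduced G l) :
    l.foldr (absorb G) [] = l := by
  induction l with
  | nil => rfl
  | cons a l ih =>
    rw [isReduced_cons] at h
    rw [List.foldr_cons, ih h.2, absorb, if_neg h.1]

/-- Equivalent reduced words are type II equivalent. -/
theorem WordEquiv.typeII {l l' : List V} (h : WordEquiv G l l') (hl : IsReduced G l)
    (hl' : IsReduced G l') : TypeII G l l' := by
  have := foldr_absorb_wordEquiv G h
  rwa [foldr_absorb_of_isReduced G hl, foldr_absorb_of_isReduced G hl'] at this

/-- `σ` matches the letters of `l'` with those of `l`, keeping the order of equal letters: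
`l' = (l_{σ(1)}, …, l_{σ(n)})`, and `σ(i) < σ(j)` if `i < j` and `l'_i = l'_j`. -/
def IsMatching (l l' : List V) (σ : Fin l'.length ≃ Fin l.length) : Prop :=
  (∀ i, l.get (σ i) = l'.get i) ∧ ∀ i j, i < j → l'.get i = l'.get j → σ i < σ j

theorem exists_matching {l l' : List V} (h : TypeII G l l') :
    ∃ σ, IsMatching l l' σ := by
  induction h with
  | rel _ _ h =>
    obtain ⟨p, q, v, w, h⟩ := h
    have hlen : (p ++ w :: v :: q).length = (p ++ v :: w :: q).length := by simp
    have hne := h.ne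
    let a : Fin (p ++ v :: w :: q).length := ⟨p.length, by simp⟩
    let b : Fin (p ++ v :: w :: q).length := ⟨p.length + 1, by simp⟩
    refine ⟨(finCongr hlen).trans (Equiv.swap a b), ?_⟩
    have hσ : ∀ i : Fin (p ++ w :: v :: q).length,
        (((finCongr hlen).trans (Equiv.swap a b)) i : ℕ) =
          if (i : ℕ) = p.length then p.length + 1 else
            if (i : ℕ) = p.length + 1 then p.length else i := by
      intro i
      simp only [Equiv.trans_apply, Equiv.swap_apply_def, Fin.ext_iff, finCongr_apply,
        Fin.val_cast, a, b]
      split_ifs <;> simp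
    constructor
    · intro i
      simp only [List.get_eq_getElem]
      have := hσ i
      generalize ((finCongr hlen).trans (Equiv.swap a b)) i = k at this ⊢
      obtain ⟨k, hk⟩ := k
      obtain ⟨i, hi⟩ := i
      simp only at this ⊢
      grind
    · intro i j hij he
      rw [Fin.lt_def, hσ, hσ]
      obtain ⟨i, hi⟩ := i
      obtain ⟨j, hj⟩ := j
      simp only [List.get_eq_getElem, Fin.lt_def] at he hij ⊢
      grind
  | refl l => exact ⟨Equiv.refl _, fun _ => rfl, fun _ _ h _ => h⟩
  | symm l l' _ ih =>
    obtain ⟨σ, h1, h2⟩ := ih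
    refine ⟨σ.symm, fun i => by rw [← h1, Equiv.apply_symm_apply], fun i j hij he => ?_⟩
    by_contra hc
    rcases (not_lt.1 hc).lt_or_eq with hc | hc
    · have := h2 _ _ hc (by rw [← h1, ← h1, Equiv.apply_symm_apply, Equiv.apply_symm_apply, he])
      simp only [Equiv.apply_symm_apply] at this
      exact absurd this (not_lt.2 hij.le)
    · exact hij.ne (σ.symm.injective hc.symm)
  | trans l l' l'' _ _ ih1 ih2 =>
    obtain ⟨σ, h1, h2⟩ := ih1
    obtain ⟨τ, k1, k2⟩ := ih2
    refine ⟨τ.trans σ, fun i => ?_, fun i j hij he => ?_⟩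
    · rw [Equiv.trans_apply, h1, k1]
    · exact h2 _ _ (k2 i j hij he) (by rw [k1, k1, he])

/-- A choice of minimal words: a complete set of representatives of the reduced words (here
together with the empty word) under equivalence of words. -/
structure MinimalWords where
  /-- the set of minimal words -/
  carrier : Set (List V)
  isReduced : ∀ w ∈ carrier, IsReduced G w
  existsUnique_equiv : ∀ w, IsReduced G w → ∃! u, u ∈ carrier ∧ WordEquiv G w u

variable {G}

namespace MinimalWords

variable (W : MinimalWords G)

/-- The minimal word equivalent to a given reduced word. -/
def rep (w : List V) (hw : IsReduced G w) : W.carrier :=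
  ⟨(W.existsUnique_equiv w hw).choose, (W.existsUnique_equiv w hw).choose_spec.1.1⟩

theorem rep_typeII (w : List V) (hw : IsReduced G w) : TypeII G w (W.rep w hw).1 :=
  (W.existsUnique_equiv w hw).choose_spec.1.2.typeII G hw (W.isReduced _ (W.rep w hw).2)

theorem nil_mem : [] ∈ W.carrier := by
  have h := (W.rep_typeII [] (isReduced_nil G)).length_eq
  have h2 := (W.rep [] (isReduced_nil G)).2
  rwa [List.length_eq_zero_iff.1 h.symm] at h2

theorem eq_of_typeII {u u' : W.carrier} (h : TypeII G u.1 u'.1) : u = u' := by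
  have := (W.existsUnique_equiv u.1 (W.isReduced _ u.2)).unique ⟨u.2, .refl _⟩
    ⟨u'.2, h.wordEquiv G⟩
  exact Subtype.ext this

/-- The minimal words `w` such that the concatenation `v w` is still reduced. -/
abbrev Left (v : V) : Type _ := {w : W.carrier // IsReduced G (v :: w.1)}

theorem rep_cons_injective (v : V) :
    Function.Injective (fun w : W.Left v => W.rep (v :: w.1.1) w.2) := by
  intro w w' h
  have h1 := W.rep_typeII _ w.2
  have h2 := W.rep_typeII _ w'.2
  simp only at h
  rw [← h] at h2
  exact Subtype.ext (W.eq_of_typeII (TypeII.of_cons G (h1.trans _ _ _ h2.symm)))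

theorem rep_cons_ne {v : V} (w w' : W.Left v) : W.rep (v :: w.1.1) w.2 ≠ w'.1 := by
  intro h
  have h1 := W.rep_typeII _ w.2
  rw [h] at h1
  have h2 := (isReduced_typeII G (TypeII.cons G h1 v)).2 w'.2
  rw [isReduced_cons] at h2
  exact h2.1 (Or.inl rfl)

end MinimalWords

end Words

section HilbertTensor

variable {ι : Type*} [Fintype ι] {E : ι → Type*} [∀ i, NormedAddCommGroup (E i)]
  [∀ i, InnerProductSpace ℂ (E i)]

variable (E) in
/-- The kernel `(a, b) ↦ ∏ i, ⟪a i, b i⟫` on `∏ i, E i`. -/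
def tensorKernel : Matrix (∀ i, E i) (∀ i, E i) ℂ :=
  Matrix.of fun a b => ∏ i, ⟪a i, b i⟫_ℂ

theorem posSemidef_gramKernel {X F : Type*} [NormedAddCommGroup F] [InnerProductSpace ℂ F]
    (v : X → F) : (Matrix.of fun a b : X => ⟪v a, v b⟫_ℂ).PosSemidef := by
  refine ⟨?_, fun x => ?_⟩
  · ext a b
    simp [Matrix.conjTranspose_apply]
  · have : (Finsupp.sum x fun i xi => Finsupp.sum x fun j xj =>
        star xi * (Matrix.of fun a b : X => ⟪v a, v b⟫_ℂ) i j * xj) =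
        ⟪∑ i ∈ x.support, x i • v i, ∑ i ∈ x.support, x i • v i⟫_ℂ := by
      simp only [Finsupp.sum, sum_inner, inner_sum, inner_smul_left, inner_smul_right,
        Matrix.of_apply, Finset.mul_sum]
      rw [Finset.sum_comm]
      refine Finset.sum_congr rfl fun a _ => Finset.sum_congr rfl fun b _ => ?_
      simp only [RCLike.star_def]
      ring
    rw [this, inner_self_eq_norm_sq_to_K]
    positivity

theorem posSemidef_tensorKernel : (tensorKernel E).PosSemidef := by
  classical
  have key : ∀ s : Finset ι,
      (Matrix.of fun a b : ∀ i, E i => ∏ i ∈ s, ⟪a i, b i⟫_ℂ).PosSemidef := by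
    intro s
    induction s using Finset.induction_on with
    | empty =>
      have := posSemidef_gramKernel (fun _ : (∀ i, E i) => (1 : ℂ))
      convert this using 3
      simp
    | insert i s hi ih =>
      have := (posSemidef_gramKernel (fun a : (∀ i, E i) => a i)).hadamard ih
      have e : (Matrix.of fun a b : ∀ i, E i => ∏ j ∈ insert i s, ⟪a j, b j⟫_ℂ) =
          Matrix.hadamard (Matrix.of fun a b : ∀ i, E i => ⟪a i, b i⟫_ℂ)
            (Matrix.of fun a b : ∀ i, E i => ∏ j ∈ s, ⟪a j, b j⟫_ℂ) := by
        ext a b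
        simp [Finset.prod_insert hi]
      rw [e]
      exact this
  exact key Finset.univ

variable (E) in
/-- The free vector space on `∏ i, E i`; the basis vector attached to `(a i)` stands for the
formal simple tensor `⊗ a i`. -/
def PreTensor : Type _ := (∀ i, E i) →₀ ℂ

instance : AddCommGroup (PreTensor E) := inferInstanceAs (AddCommGroup ((∀ i, E i) →₀ ℂ))
instance : Module ℂ (PreTensor E) := inferInstanceAs (Module ℂ ((∀ i, E i) →₀ ℂ))

/-- The sesquilinear form with `⟪⊗ a i, ⊗ b i⟫ = ∏ i, ⟪a i, b i⟫`. -/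
def preForm (x y : PreTensor E) : ℂ :=
  Finsupp.sum x fun a c => Finsupp.sum y fun b d => star c * tensorKernel E a b * d

variable (E) in
/-- The positive semidefinite sesquilinear form on the free vector space. -/
@[reducible] def preCore : PreInnerProductSpace.Core ℂ (PreTensor E) where
  inner := preForm
  conj_inner_symm x y := by
    simp only [preForm, Finsupp.sum, map_sum]
    rw [Finset.sum_comm]
    refine Finset.sum_congr rfl fun a _ => Finset.sum_congr rfl fun b _ => ?_
    have := congrFun (congrFun (posSemidef_tensorKernel (E := E)).isHermitian a) b
    rw [Matrix.conjTranspose_apply] at this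
    simp only [map_mul, ← this]
    simp
    ring
  re_inner_nonneg x := (Complex.nonneg_iff.1 ((posSemidef_tensorKernel (E := E)).2 x)).1
  add_left x y z := by
    refine Finsupp.sum_add_index' (fun a => by simp [Finsupp.sum]) fun a c d => ?_
    simp [add_mul, Finsupp.sum, Finset.sum_add_distrib]
  smul_left x y r := by
    refine (Finsupp.sum_smul_index' (fun a => by simp [Finsupp.sum])).trans ?_
    simp [preForm, Finsupp.sum, Finset.mul_sum, mul_assoc]

instance : SeminormedAddCommGroup (PreTensor E) :=
  @InnerProductSpace.Core.toSeminormedAddCommGroup ℂ _ _ _ _ (preCore E)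
instance : InnerProductSpace ℂ (PreTensor E) := InnerProductSpace.ofCore (preCore E)

variable (E) in
/-- The Hilbert space tensor product of a finite family of Hilbert spaces: the separated completion
of the free vector space on `∏ i, E i` for the form `⟪⊗ a i, ⊗ b i⟫ = ∏ i, ⟪a i, b i⟫`. (The vectors
of length zero that are divided out are those expressing that `⊗` is multilinear.) -/
def HilbertTensor : Type _ := UniformSpace.Completion (PreTensor E)

instance : NormedAddCommGroup (HilbertTensor E) :=
  inferInstanceAs (NormedAddCommGroup (UniformSpace.Completion (PreTensor E)))
instance : InnerProductSpace ℂ (HilbertTensor E) :=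
  inferInstanceAs (InnerProductSpace ℂ (UniformSpace.Completion (PreTensor E)))
instance : CompleteSpace (HilbertTensor E) :=
  inferInstanceAs (CompleteSpace (UniformSpace.Completion (PreTensor E)))

/-- The canonical map from the free vector space to the Hilbert space tensor product. -/
def HilbertTensor.of : PreTensor E →ₗᵢ[ℂ] HilbertTensor E :=
  (UniformSpace.Completion.toComplₗᵢ : PreTensor E →ₗᵢ[ℂ] UniformSpace.Completion (PreTensor E))

theorem HilbertTensor.denseRange_of : DenseRange (HilbertTensor.of (E := E)) :=
  UniformSpace.Completion.denseRange_coe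

/-- Continuous extension of a bounded operator from the free vector space to the Hilbert space
tensor product. -/
def HilbertTensor.extend {K : Type*} [NormedAddCommGroup K] [NormedSpace ℂ K] [CompleteSpace K]
    (f : PreTensor E →L[ℂ] K) : HilbertTensor E →L[ℂ] K :=
  (f.fromCompletion : UniformSpace.Completion (PreTensor E) →L[ℂ] K)

theorem HilbertTensor.extend_of {K : Type*} [NormedAddCommGroup K] [NormedSpace ℂ K]
    [CompleteSpace K] (f : PreTensor E →L[ℂ] K) (x : PreTensor E) :
    HilbertTensor.extend f (HilbertTensor.of x) = f x :=
  ContinuousLinearMap.fromCompletion_apply_coe f x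

/-- The simple tensor `⊗ a i`, in the free vector space. -/
def preTprod (a : ∀ i, E i) : PreTensor E := Finsupp.single a 1

/-- The simple tensor `⊗ a i`. -/
def tprod (a : ∀ i, E i) : HilbertTensor E := HilbertTensor.of (preTprod a)

theorem inner_preTprod (a b : ∀ i, E i) :
    ⟪preTprod a, preTprod b⟫_ℂ = ∏ i, ⟪a i, b i⟫_ℂ := by
  change preForm _ _ = _
  simp [preForm, preTprod, tensorKernel]

theorem inner_tprod (a b : ∀ i, E i) : ⟪tprod a, tprod b⟫_ℂ = ∏ i, ⟪a i, b i⟫_ℂ := by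
  rw [tprod, tprod, LinearIsometry.inner_map_map, inner_preTprod]

theorem norm_tprod (a : ∀ i, E i) : ‖tprod a‖ = ∏ i, ‖a i‖ := by
  have h := inner_tprod a a
  simp only [inner_self_eq_norm_sq_to_K, Finset.prod_pow] at h
  norm_cast at h
  exact (sq_eq_sq₀ (norm_nonneg _) (Finset.prod_nonneg fun _ _ => norm_nonneg _)).1
    (by exact_mod_cast h)

theorem preTensor_induction {p : PreTensor E → Prop} (x : PreTensor E) (h0 : p 0)
    (ha : ∀ x y, p x → p y → p (x + y)) (hs : ∀ (c : ℂ) a, p (c • preTprod a)) : p x := by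
  refine Finsupp.induction_linear (motive := p) x h0 (fun f g => ha f g) fun a c => ?_
  have := hs c a
  rw [preTprod] at this
  have e : (c • (Finsupp.single a 1 : (∀ i, E i) →₀ ℂ)) = Finsupp.single a c := by simp
  rw [← e]
  exact this

/-- Two bounded operators that agree on simple tensors are equal. -/
theorem HilbertTensor.clm_ext {K : Type*} [NormedAddCommGroup K] [NormedSpace ℂ K]
    {S T : HilbertTensor E →L[ℂ] K} (h : ∀ a, S (tprod a) = T (tprod a)) : S = T := by
  ext x
  refine HilbertTensor.denseRange_of.induction_on x (isClosed_eq S.continuous T.continuous) ?_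
  intro x
  induction x using preTensor_induction with
  | h0 => simp only [map_zero]
  | ha x y hx hy => simp only [map_add, hx, hy]
  | hs c a =>
    rw [map_smul, map_smul, map_smul]
    exact congrArg _ (h a)

theorem tprod_eq_zero_of_inner {x : HilbertTensor E} (h : ∀ a, ⟪tprod a, x⟫_ℂ = 0) : x = 0 := by
  have : innerSL ℂ x = 0 := HilbertTensor.clm_ext fun a => by
    simpa using inner_eq_zero_symm.1 (h a)
  simpa using congrArg (fun f => f x) this

theorem tprod_update_add [DecidableEq ι] (a : ∀ i, E i) (i : ι) (x y : E i) :
    tprod (Function.update a i (x + y)) =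
      tprod (Function.update a i x) + tprod (Function.update a i y) := by
  rw [← sub_eq_zero]
  refine tprod_eq_zero_of_inner fun b => ?_
  simp only [inner_sub_right, inner_add_right, inner_tprod]
  rw [← Finset.mul_prod_erase _ _ (Finset.mem_univ i), ← Finset.mul_prod_erase _ _ (Finset.mem_univ i),
    ← Finset.mul_prod_erase _ _ (Finset.mem_univ i)]
  have : ∀ z, ∏ j ∈ Finset.univ.erase i, ⟪b j, Function.update a i z j⟫_ℂ =
      ∏ j ∈ Finset.univ.erase i, ⟪b j, a j⟫_ℂ := fun z =>
    Finset.prod_congr rfl fun j hj => by rw [Function.update_of_ne (Finset.ne_of_mem_erase hj)]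
  simp only [this, Function.update_self, inner_add_right]
  ring

theorem tprod_update_smul [DecidableEq ι] (a : ∀ i, E i) (i : ι) (c : ℂ) (x : E i) :
    tprod (Function.update a i (c • x)) = c • tprod (Function.update a i x) := by
  rw [← sub_eq_zero]
  refine tprod_eq_zero_of_inner fun b => ?_
  simp only [inner_sub_right, inner_smul_right, inner_tprod]
  rw [← Finset.mul_prod_erase _ _ (Finset.mem_univ i), ← Finset.mul_prod_erase _ _ (Finset.mem_univ i)]
  have : ∀ z, ∏ j ∈ Finset.univ.erase i, ⟪b j, Function.update a i z j⟫_ℂ =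
      ∏ j ∈ Finset.univ.erase i, ⟪b j, a j⟫_ℂ := fun z =>
    Finset.prod_congr rfl fun j hj => by rw [Function.update_of_ne (Finset.ne_of_mem_erase hj)]
  simp only [this, Function.update_self, inner_smul_right]
  ring

/-- The linear extension to the free vector space of a map defined on families of vectors. -/
def preLift {K : Type*} [AddCommGroup K] [Module ℂ K] (f : (∀ i, E i) → K) :
    PreTensor E →ₗ[ℂ] K := Finsupp.lift K ℂ (∀ i, E i) f

theorem preLift_preTprod {K : Type*} [AddCommGroup K] [Module ℂ K] (f : (∀ i, E i) → K)
    (a : ∀ i, E i) : preLift f (preTprod a) = f a := by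
  refine (Finsupp.lift_apply _ _ _ f (Finsupp.single a 1)).trans ?_
  simp

theorem inner_preLift {K : Type*} [NormedAddCommGroup K] [InnerProductSpace ℂ K]
    (f g : (∀ i, E i) → K) (c : ℂ) (h : ∀ a b, ⟪f a, g b⟫_ℂ = c * ∏ i, ⟪a i, b i⟫_ℂ)
    (x y : PreTensor E) : ⟪preLift f x, preLift g y⟫_ℂ = c * ⟪x, y⟫_ℂ := by
  induction x using preTensor_induction with
  | h0 => simp
  | ha x x' hx hx' => simp only [map_add, inner_add_left, hx, hx', mul_add]
  | hs r a =>
    induction y using preTensor_induction with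
    | h0 => simp
    | ha y y' hy hy' => simp only [map_add, inner_add_right, hy, hy', mul_add]
    | hs s b =>
      simp only [map_smul, inner_smul_left, inner_smul_right, preLift_preTprod, h, inner_preTprod]
      ring

/-- A map `f` on families of vectors with `⟪f a, f b⟫ = ∏ i, ⟪a i, b i⟫` extends to an isometry
from the Hilbert space tensor product, sending `⊗ a i` to `f a`. -/
def HilbertTensor.liftIsometry {K : Type*} [NormedAddCommGroup K] [InnerProductSpace ℂ K]
    [CompleteSpace K] (f : (∀ i, E i) → K) (h : ∀ a b, ⟪f a, f b⟫_ℂ = ∏ i, ⟪a i, b i⟫_ℂ) :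
    HilbertTensor E →ₗᵢ[ℂ] K :=
  have hn : ∀ x, ‖preLift f x‖ = ‖x‖ := fun x => by
    have := inner_preLift f f 1 (by simpa using h) x x
    rw [one_mul, inner_self_eq_norm_sq_to_K, inner_self_eq_norm_sq_to_K] at this
    exact (sq_eq_sq₀ (norm_nonneg _) (norm_nonneg _)).1 (by exact_mod_cast this)
  let F : PreTensor E →L[ℂ] K := (preLift f).mkContinuous 1 (fun x => by rw [hn, one_mul])
  { toLinearMap := (HilbertTensor.extend F).toLinearMap
    norm_map' := fun x => by
      refine HilbertTensor.denseRange_of.induction_on x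
        (isClosed_eq (HilbertTensor.extend F).continuous.norm continuous_norm) fun x => ?_
      rw [LinearIsometry.norm_map, ← hn x]
      exact congrArg _ (HilbertTensor.extend_of F x) }

theorem HilbertTensor.liftIsometry_tprod {K : Type*} [NormedAddCommGroup K]
    [InnerProductSpace ℂ K] [CompleteSpace K] (f : (∀ i, E i) → K)
    (h : ∀ a b, ⟪f a, f b⟫_ℂ = ∏ i, ⟪a i, b i⟫_ℂ) (a : ∀ i, E i) :
    HilbertTensor.liftIsometry f h (tprod a) = f a := by
  refine (HilbertTensor.extend_of _ _).trans ?_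
  exact preLift_preTprod f a

variable {F : ι → Type*} [∀ i, NormedAddCommGroup (F i)] [∀ i, InnerProductSpace ℂ (F i)]

theorem posSemidef_tensorKernel_sub (T : ∀ i, E i →L[ℂ] F i) :
    (Matrix.of fun a b : ∀ i, E i => (∏ i, (‖T i‖ : ℂ) ^ 2) * ∏ i, ⟪a i, b i⟫_ℂ -
      ∏ i, ⟪T i (a i), T i (b i)⟫_ℂ).PosSemidef := by
  classical
  have key : ∀ s : Finset ι,
      (Matrix.of fun a b : ∀ i, E i => ∏ i ∈ s, ⟪a i, b i⟫_ℂ).PosSemidef ∧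
      (Matrix.of fun a b : ∀ i, E i => (∏ i ∈ s, (‖T i‖ : ℂ) ^ 2) * ∏ i ∈ s, ⟪a i, b i⟫_ℂ -
        ∏ i ∈ s, ⟪T i (a i), T i (b i)⟫_ℂ).PosSemidef := by
    intro s
    induction s using Finset.induction_on with
    | empty =>
      refine ⟨?_, ?_⟩
      · have := posSemidef_gramKernel (fun _ : (∀ i, E i) => (1 : ℂ))
        convert this using 3
        simp
      · have := Matrix.PosSemidef.zero (n := ∀ i, E i) (R := ℂ)
        convert this using 1
        ext a b
        simp
    | insert i s hi ih =>
      obtain ⟨ih1, ih2⟩ := ih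
      have g1 := posSemidef_gramKernel (fun a : (∀ i, E i) => a i)
      have g2 := posSemidef_gramKernel (fun a : (∀ i, E i) => T i (a i))
      have g3 := Matrix.posSemidef_opNorm_smul_gram_sub_gram (𝕜 := ℂ)
        (fun a : (∀ i, E i) => a i) (T i)
      have hc : (0 : ℂ) ≤ ∏ i ∈ s, (‖T i‖ : ℂ) ^ 2 := by
        have : (0 : ℝ) ≤ ∏ i ∈ s, ‖T i‖ ^ 2 := by positivity
        exact_mod_cast this
      refine ⟨?_, ?_⟩
      · have := g1.hadamard ih1
        have e : (Matrix.of fun a b : ∀ i, E i => ∏ j ∈ insert i s, ⟪a j, b j⟫_ℂ) =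
            Matrix.hadamard (Matrix.of fun a b : ∀ i, E i => ⟪a i, b i⟫_ℂ)
              (Matrix.of fun a b : ∀ i, E i => ∏ j ∈ s, ⟪a j, b j⟫_ℂ) := by
          ext a b
          simp [Finset.prod_insert hi]
        rw [e]
        exact this
      · have := (g3.hadamard (ih1.smul hc)).add (g2.hadamard ih2)
        refine (congrArg Matrix.PosSemidef ?_).mp this
        ext a b
        simp only [Finset.prod_insert hi, Matrix.add_apply, Matrix.hadamard_apply,
          Matrix.sub_apply, Matrix.smul_apply, Matrix.gram_apply, Matrix.of_apply, smul_eq_mul,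
          Function.comp_apply, Complex.real_smul]
        push_cast
        ring
  exact (key Finset.univ).2

theorem norm_preLift_map_le (T : ∀ i, E i →L[ℂ] F i) (x : PreTensor E) :
    ‖preLift (fun a => tprod fun i => T i (a i)) x‖ ≤ (∏ i, ‖T i‖) * ‖x‖ := by
  have hp : 0 ≤ ∏ i, ‖T i‖ := Finset.prod_nonneg fun _ _ => norm_nonneg _
  refine (sq_le_sq₀ (norm_nonneg _) (mul_nonneg hp (norm_nonneg _))).1 ?_
  have h := (Complex.nonneg_iff.1 ((posSemidef_tensorKernel_sub T).2 x)).1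
  have e : (Finsupp.sum x fun i xi => Finsupp.sum x fun j xj => star xi *
      (Matrix.of fun a b : ∀ i, E i => (∏ i, (‖T i‖ : ℂ) ^ 2) * ∏ i, ⟪a i, b i⟫_ℂ -
      ∏ i, ⟪T i (a i), T i (b i)⟫_ℂ) i j * xj) = (∏ i, (‖T i‖ : ℂ) ^ 2) * ⟪x, x⟫_ℂ -
      ⟪preLift (fun a => tprod fun i => T i (a i)) x,
        preLift (fun a => tprod fun i => T i (a i)) x⟫_ℂ := by
    have e1 : preLift (fun a => tprod fun i => T i (a i)) x =
        Finsupp.sum x fun a c => c • tprod fun i => T i (a i) := Finsupp.lift_apply _ _ _ _ x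
    have e2 : ⟪x, x⟫_ℂ = preForm x x := rfl
    rw [e1, e2]
    simp only [preForm, Finsupp.sum, sum_inner, inner_sum, inner_smul_left, inner_smul_right,
        Matrix.of_apply, Finset.mul_sum, inner_tprod, tensorKernel]
    conv_rhs => rw [sub_eq_add_neg]; right; rw [Finset.sum_comm]
    rw [← sub_eq_add_neg, ← Finset.sum_sub_distrib]
    refine Finset.sum_congr rfl fun a _ => ?_
    rw [← Finset.sum_sub_distrib]
    refine Finset.sum_congr rfl fun b _ => ?_
    simp only [RCLike.star_def]
    ring
  rw [e, inner_self_eq_norm_sq_to_K, inner_self_eq_norm_sq_to_K] at h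
  have h2 : ((∏ i, (‖T i‖ : ℂ) ^ 2) * (‖x‖ : ℂ) ^ 2 -
      (‖preLift (fun a => tprod fun i => T i (a i)) x‖ : ℂ) ^ 2) =
      ((((∏ i, ‖T i‖) * ‖x‖) ^ 2 - ‖preLift (fun a => tprod fun i => T i (a i)) x‖ ^ 2 : ℝ) : ℂ) := by
    push_cast [Finset.prod_pow]
    ring
  erw [h2] at h
  rw [Complex.ofReal_re] at h
  linarith

/-- The tensor product `⊗ T i` of a finite family of bounded operators. -/
def HilbertTensor.map (T : ∀ i, E i →L[ℂ] F i) : HilbertTensor E →L[ℂ] HilbertTensor F :=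
  HilbertTensor.extend ((preLift fun a => tprod fun i => T i (a i)).mkContinuous _
    (norm_preLift_map_le T))

theorem HilbertTensor.map_tprod (T : ∀ i, E i →L[ℂ] F i) (a : ∀ i, E i) :
    HilbertTensor.map T (tprod a) = tprod fun i => T i (a i) := by
  refine (HilbertTensor.extend_of _ _).trans ?_
  exact preLift_preTprod _ a

end HilbertTensor
section HilbertTensor₂

variable {E F K : Type*} [NormedAddCommGroup E] [InnerProductSpace ℂ E] [NormedAddCommGroup F]
  [InnerProductSpace ℂ F] [NormedAddCommGroup K] [InnerProductSpace ℂ K] [CompleteSpace K]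

variable (E F) in
/-- The Hilbert space tensor product of two Hilbert spaces. -/
def HilbertTensor₂ : Type _ := UniformSpace.Completion (E ⊗[ℂ] F)

instance : NormedAddCommGroup (HilbertTensor₂ E F) :=
  inferInstanceAs (NormedAddCommGroup (UniformSpace.Completion (E ⊗[ℂ] F)))
instance : InnerProductSpace ℂ (HilbertTensor₂ E F) :=
  inferInstanceAs (InnerProductSpace ℂ (UniformSpace.Completion (E ⊗[ℂ] F)))
instance : CompleteSpace (HilbertTensor₂ E F) :=
  inferInstanceAs (CompleteSpace (UniformSpace.Completion (E ⊗[ℂ] F)))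

/-- The canonical map from the algebraic to the Hilbert space tensor product. -/
def HilbertTensor₂.of : E ⊗[ℂ] F →ₗᵢ[ℂ] HilbertTensor₂ E F :=
  (UniformSpace.Completion.toComplₗᵢ : E ⊗[ℂ] F →ₗᵢ[ℂ] UniformSpace.Completion (E ⊗[ℂ] F))

theorem HilbertTensor₂.denseRange_of : DenseRange (HilbertTensor₂.of (E := E) (F := F)) :=
  UniformSpace.Completion.denseRange_coe

/-- Continuous extension of a bounded operator from the algebraic to the Hilbert space tensor
product. -/
def HilbertTensor₂.extend (f : E ⊗[ℂ] F →L[ℂ] K) : HilbertTensor₂ E F →L[ℂ] K :=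
  (f.fromCompletion : UniformSpace.Completion (E ⊗[ℂ] F) →L[ℂ] K)

theorem HilbertTensor₂.extend_of (f : E ⊗[ℂ] F →L[ℂ] K) (x : E ⊗[ℂ] F) :
    HilbertTensor₂.extend f (HilbertTensor₂.of x) = f x :=
  ContinuousLinearMap.fromCompletion_apply_coe f x

/-- A bilinear map `B` with `⟪B x y, B x' y'⟫ = ⟪x, x'⟫ ⟪y, y'⟫` extends to an isometry from the
Hilbert space tensor product, sending `x ⊗ y` to `B x y`. -/
def HilbertTensor₂.liftIsometry (B : E →ₗ[ℂ] F →ₗ[ℂ] K)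
    (h : ∀ x x' y y', ⟪B x y, B x' y'⟫_ℂ = ⟪x, x'⟫_ℂ * ⟪y, y'⟫_ℂ) :
    HilbertTensor₂ E F →ₗᵢ[ℂ] K :=
  have hi : ∀ z z' : E ⊗[ℂ] F, ⟪TensorProduct.lift B z, TensorProduct.lift B z'⟫_ℂ = ⟪z, z'⟫_ℂ := by
    intro z z'
    induction z using TensorProduct.induction_on with
    | zero => simp
    | add z₁ z₂ h₁ h₂ => simp only [map_add, inner_add_left, h₁, h₂]
    | tmul x y =>
      induction z' using TensorProduct.induction_on with
      | zero => simp
      | add z₁ z₂ h₁ h₂ => simp only [map_add, inner_add_right, h₁, h₂]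
      | tmul x' y' => simp [h]
  let f : E ⊗[ℂ] F →ₗᵢ[ℂ] K := (TensorProduct.lift B).isometryOfInner hi
  { toLinearMap := (HilbertTensor₂.extend f.toContinuousLinearMap).toLinearMap
    norm_map' := fun x => by
      refine HilbertTensor₂.denseRange_of.induction_on x
        (isClosed_eq (HilbertTensor₂.extend _).continuous.norm continuous_norm) fun x => ?_
      rw [LinearIsometry.norm_map, ← f.norm_map x]
      exact congrArg _ (HilbertTensor₂.extend_of _ x) }

theorem HilbertTensor₂.liftIsometry_tmul (B : E →ₗ[ℂ] F →ₗ[ℂ] K)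
    (h : ∀ x x' y y', ⟪B x y, B x' y'⟫_ℂ = ⟪x, x'⟫_ℂ * ⟪y, y'⟫_ℂ) (x : E) (y : F) :
    HilbertTensor₂.liftIsometry B h (HilbertTensor₂.of (x ⊗ₜ[ℂ] y)) = B x y := by
  refine (HilbertTensor₂.extend_of _ _).trans ?_
  exact TensorProduct.lift.tmul x y

/-- The operator `T ⊗ 1`. -/
def HilbertTensor₂.ampl (F : Type*) [NormedAddCommGroup F] [InnerProductSpace ℂ F]
    (T : E →L[ℂ] E) : HilbertTensor₂ E F →L[ℂ] HilbertTensor₂ E F :=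
  HilbertTensor₂.extend (HilbertTensor₂.of.toContinuousLinearMap ∘L
    TensorProduct.mapL T (ContinuousLinearMap.id ℂ F))

theorem HilbertTensor₂.ampl_tmul (T : E →L[ℂ] E) (x : E) (y : F) :
    HilbertTensor₂.ampl F T (HilbertTensor₂.of (x ⊗ₜ[ℂ] y)) =
      HilbertTensor₂.of (T x ⊗ₜ[ℂ] y) :=
  HilbertTensor₂.extend_of _ _

end HilbertTensor₂

section GraphSpace

variable {V : Type*} {H : V → Type*} [∀ v, NormedAddCommGroup (H v)]
  [∀ v, InnerProductSpace ℂ (H v)]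

/-- The orthogonal complement of the line spanned by `ξ`. -/
abbrev circ {H : Type*} [NormedAddCommGroup H] [InnerProductSpace ℂ H] (ξ : H) : Submodule ℂ H :=
  (ℂ ∙ ξ)ᗮ

/-- The orthogonal projection onto the complement of the line spanned by `ξ`. -/
def circProj {H : Type*} [NormedAddCommGroup H] [InnerProductSpace ℂ H] (ξ : H) :
    H →L[ℂ] circ ξ := (circ ξ).orthogonalProjectionOnto

theorem inner_eq_add_circProj {H : Type*} [NormedAddCommGroup H] [InnerProductSpace ℂ H] {ξ : H}
    (hξ : ‖ξ‖ = 1) (x y : H) :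
    ⟪x, y⟫_ℂ = ⟪x, ξ⟫_ℂ * ⟪ξ, y⟫_ℂ + ⟪circProj ξ x, circProj ξ y⟫_ℂ := by
  have h : ∀ x : H, (circProj ξ x : H) = x - ⟪ξ, x⟫_ℂ • ξ := by
    intro x
    rw [circProj]
    have h1 := Submodule.starProjection_orthogonal_val (K := (ℂ ∙ ξ)) (u := x)
    rw [Submodule.starProjection_unit_singleton ℂ hξ] at h1
    exact h1
  rw [Submodule.coe_inner, h, h]
  have : ⟪ξ, ξ⟫_ℂ = 1 := by rw [inner_self_eq_norm_sq_to_K, hξ]; simp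
  simp only [inner_sub_left, inner_sub_right, inner_smul_left, inner_smul_right, this,
    inner_conj_symm]
  ring

variable (ξ : ∀ v, H v)

/-- The Hilbert space `H_w = H°_{w_1} ⊗ ⋯ ⊗ H°_{w_n}` of a word `w`; for the empty word it is the
one-dimensional empty tensor product. -/
abbrev WordSpace (w : List V) : Type _ :=
  HilbertTensor fun i : Fin w.length => circ (ξ (w.get i))

/-- The identity map `H°_a → H°_b` for equal letters `a = b`. -/
def castCirc {a b : V} (h : a = b) : circ (ξ a) →ₗᵢ[ℂ] circ (ξ b) :=
  h ▸ LinearIsometry.id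

theorem prod_inner_matching {l l' : List V} {σ : Fin l'.length ≃ Fin l.length}
    (hσ : IsMatching l l' σ) (x y : ∀ i, circ (ξ (l.get i))) :
    ∏ i, ⟪castCirc ξ (hσ.1 i) (x (σ i)), castCirc ξ (hσ.1 i) (y (σ i))⟫_ℂ =
      ∏ i, ⟪x i, y i⟫_ℂ := by
  simp only [LinearIsometry.inner_map_map]
  exact σ.prod_comp fun i => ⟪x i, y i⟫_ℂ

/-- For type II equivalent words `l` and `l'`, the map `H_l → H_{l'}` given by
`x_1 ⊗ ⋯ ⊗ x_n ↦ x_{σ(1)} ⊗ ⋯ ⊗ x_{σ(n)}`, where `σ` is the bijection with `l'_i = l_{σ(i)}` that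
keeps the order of equal letters. -/
def permute {G : SimpleGraph V} {l l' : List V} (h : TypeII G l l') :
    WordSpace ξ l →ₗᵢ[ℂ] WordSpace ξ l' :=
  let σ := (exists_matching G h).choose
  have hσ : IsMatching l l' σ := (exists_matching G h).choose_spec
  HilbertTensor.liftIsometry (fun x => tprod fun i => castCirc ξ (hσ.1 i) (x (σ i)))
    (fun x y => by rw [inner_tprod, prod_inner_matching ξ hσ])

/-- The family `(ζ, x_1, …, x_n)`. -/
def consFamily {v : V} {l : List V} (ζ : circ (ξ v)) (x : ∀ i : Fin l.length, circ (ξ (l.get i))) :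
    ∀ i : Fin (v :: l).length, circ (ξ ((v :: l).get i)) :=
  Fin.cases ζ x

theorem inner_tprod_consFamily {v : V} {l : List V} (ζ ζ' : circ (ξ v))
    (x y : ∀ i : Fin l.length, circ (ξ (l.get i))) :
    ⟪tprod (consFamily ξ ζ x), tprod (consFamily ξ ζ' y)⟫_ℂ =
      ⟪ζ, ζ'⟫_ℂ * ∏ i, ⟪x i, y i⟫_ℂ := by
  rw [inner_tprod]
  exact Fin.prod_univ_succ (n := l.length) _

theorem inner_tprod_consFamily_right {v : V} {l : List V}
    (b : ∀ i : Fin (v :: l).length, circ (ξ ((v :: l).get i)))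
    (x : ∀ i : Fin l.length, circ (ξ (l.get i))) :
    ∃ (b₀ : circ (ξ v)) (c : ℂ), ∀ ζ, ⟪tprod b, tprod (consFamily ξ ζ x)⟫_ℂ = ⟪b₀, ζ⟫_ℂ * c := by
  refine ⟨b 0, ∏ i : Fin l.length, ⟪(b i.succ : circ (ξ (l.get i))), x i⟫_ℂ, fun ζ => ?_⟩
  rw [inner_tprod]
  exact Fin.prod_univ_succ (n := l.length) _

/-- The map `ζ ↦ ζ ⊗ x_1 ⊗ ⋯ ⊗ x_n`. -/
def consTprod (v : V) {l : List V} (x : ∀ i : Fin l.length, circ (ξ (l.get i))) :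
    circ (ξ v) →L[ℂ] WordSpace ξ (v :: l) :=
  LinearMap.mkContinuous
    { toFun := fun ζ => tprod (consFamily ξ ζ x)
      map_add' := fun ζ ζ' => by
        rw [← sub_eq_zero]
        refine tprod_eq_zero_of_inner fun b => ?_
        rw [inner_sub_right, inner_add_right]
        obtain ⟨b₀, r, h⟩ := inner_tprod_consFamily_right ξ b x
        rw [h, h, h, inner_add_right]
        ring
      map_smul' := fun c ζ => by
        rw [← sub_eq_zero]
        refine tprod_eq_zero_of_inner fun b => ?_
        rw [inner_sub_right, RingHom.id_apply, inner_smul_right]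
        obtain ⟨b₀, r, h⟩ := inner_tprod_consFamily_right ξ b x
        rw [h, h, inner_smul_right]
        ring }
    (∏ i, ‖x i‖) (fun ζ => by
      refine le_of_eq ?_
      change ‖tprod (consFamily ξ ζ x)‖ = _
      rw [norm_tprod, mul_comm]
      exact Fin.prod_univ_succ (n := l.length) _)

theorem inner_preLift_consTprod (v : V) {l : List V} (ζ ζ' : circ (ξ v))
    (x y : PreTensor fun i : Fin l.length => circ (ξ (l.get i))) :
    ⟪preLift (consTprod ξ v) x ζ, preLift (consTprod ξ v) y ζ'⟫_ℂ = ⟪ζ, ζ'⟫_ℂ * ⟪x, y⟫_ℂ := by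
  have e : ∀ (ζ : circ (ξ v)) (x : PreTensor fun i : Fin l.length => circ (ξ (l.get i))),
      preLift (consTprod ξ v) x ζ = preLift (fun a => tprod (consFamily ξ ζ a)) x := by
    intro ζ x
    induction x using preTensor_induction with
    | h0 => simp
    | ha x y hx hy => simp [hx, hy]
    | hs c a => simp only [map_smul, preLift_preTprod]; rfl
  rw [e, e]
  exact inner_preLift _ _ _ (fun a b => inner_tprod_consFamily ξ ζ ζ' a b) x y

theorem norm_preLift_consTprod_le (v : V) {l : List V}
    (x : PreTensor fun i : Fin l.length => circ (ξ (l.get i))) :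
    ‖preLift (consTprod ξ v) x‖ ≤ 1 * ‖x‖ := by
  rw [one_mul]
  refine ContinuousLinearMap.opNorm_le_bound (preLift (consTprod ξ v) x) (norm_nonneg x) fun ζ => ?_
  refine (sq_le_sq₀ (norm_nonneg _) (mul_nonneg (norm_nonneg _) (norm_nonneg _))).1 ?_
  have h := inner_preLift_consTprod ξ v ζ ζ x x
  simp only [inner_self_eq_norm_sq_to_K] at h
  refine le_of_eq ?_
  rw [mul_pow, mul_comm]
  exact_mod_cast h

/-- The map `η ↦ (ζ ↦ ζ ⊗ η)` on the free vector space. -/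
def consPre (v : V) (l : List V) : PreTensor (fun i : Fin l.length => circ (ξ (l.get i))) →L[ℂ]
    circ (ξ v) →L[ℂ] WordSpace ξ (v :: l) :=
  LinearMap.mkContinuous (E := PreTensor fun i : Fin l.length => circ (ξ (l.get i)))
    (F := circ (ξ v) →L[ℂ] WordSpace ξ (v :: l)) (σ := RingHom.id ℂ)
    (preLift (consTprod ξ v)) 1 (norm_preLift_consTprod_le ξ v)

/-- The map `H_l → (H°_v → H_{vl})`, `η ↦ (ζ ↦ ζ ⊗ η)`. -/
def cons (v : V) (l : List V) : WordSpace ξ l →L[ℂ] circ (ξ v) →L[ℂ] WordSpace ξ (v :: l) :=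
  HilbertTensor.extend (E := fun i : Fin l.length => circ (ξ (l.get i)))
    (K := circ (ξ v) →L[ℂ] WordSpace ξ (v :: l)) (consPre ξ v l)

theorem cons_tprod (v : V) (l : List V) (x : ∀ i : Fin l.length, circ (ξ (l.get i)))
    (ζ : circ (ξ v)) : cons ξ v l (tprod x) ζ = tprod (consFamily ξ ζ x) := by
  rw [cons, tprod, HilbertTensor.extend_of]
  have h : consPre ξ v l (preTprod x) = consTprod ξ v x := preLift_preTprod (consTprod ξ v) x
  rw [h]
  rfl

theorem inner_cons (v : V) (l : List V) (η η' : WordSpace ξ l) (ζ ζ' : circ (ξ v)) :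
    ⟪cons ξ v l η ζ, cons ξ v l η' ζ'⟫_ℂ = ⟪ζ, ζ'⟫_ℂ * ⟪η, η'⟫_ℂ := by
  refine HilbertTensor.denseRange_of.induction_on₂
    (p := fun η η' => ⟪cons ξ v l η ζ, cons ξ v l η' ζ'⟫_ℂ = ⟪ζ, ζ'⟫_ℂ * ⟪η, η'⟫_ℂ)
    (isClosed_eq (by fun_prop) (by fun_prop)) (fun x y => ?_) η η'
  rw [LinearIsometry.inner_map_map, ← inner_preLift_consTprod ξ v ζ ζ' x y, cons,
    HilbertTensor.extend_of, HilbertTensor.extend_of]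
  rfl

variable {G : SimpleGraph V} (W : MinimalWords G)

/-- The graph product Hilbert space: the Hilbert direct sum of the spaces `H_w` over all minimal
words `w`, the empty word (whose summand is the line of the vacuum vector) included. -/
abbrev GraphSpace : Type _ := lp (fun w : W.carrier => WordSpace ξ w.1) 2

open Classical in
/-- The inclusion of the summand `H_w`. -/
def inclWord (w : W.carrier) : WordSpace ξ w.1 →ₗᵢ[ℂ] GraphSpace ξ W where
  toLinearMap := lp.lsingle (𝕜 := ℂ) (E := fun w : W.carrier => WordSpace ξ w.1) 2 w
  norm_map' x := lp.norm_single (E := fun w : W.carrier => WordSpace ξ w.1) (p := 2)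
    (by norm_num) w x

theorem inner_inclWord_of_ne {w w' : W.carrier} (h : w ≠ w') (x : WordSpace ξ w.1)
    (y : WordSpace ξ w'.1) : ⟪inclWord ξ W w x, inclWord ξ W w' y⟫_ℂ = 0 := by
  classical
  have : inclWord ξ W w x = lp.single 2 w x := by
    simp only [inclWord, lp.lsingle]; congr!
  rw [this, lp.inner_single_left]
  have : inclWord ξ W w' y w = 0 := lp.single_apply_ne _ _ _ h
  rw [this, inner_zero_right]

/-- The vacuum vector. -/
def vacuum : GraphSpace ξ W := inclWord ξ W ⟨[], W.nil_mem⟩ (tprod fun i => i.elim0)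

/-- For a minimal word `w` with `v w` reduced, the bilinear map `H_v × H_w → H` that is the
inclusion `ξ_v ⊗ H_w ≅ H_w` on `ξ_v`, and `H°_v ⊗ H_w ≅ H_{vw} ≅ H_{w'}` on `H°_v`, where `w'` is
the minimal word equivalent to `v w`. -/
def leftBilin (v : V) (w : W.Left v) : H v →ₗ[ℂ] WordSpace ξ w.1.1 →ₗ[ℂ] GraphSpace ξ W :=
  LinearMap.mk₂ ℂ (fun x η => ⟪ξ v, x⟫_ℂ • inclWord ξ W w.1 η +
      inclWord ξ W (W.rep (v :: w.1.1) w.2)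
        (permute ξ (W.rep_typeII _ w.2) (cons ξ v w.1.1 η (circProj (ξ v) x))))
    (fun x y η => by simp only [inner_add_right, add_smul, map_add]; abel)
    (fun c x η => by simp only [inner_smul_right, map_smul, smul_add, mul_smul])
    (fun x η η' => by simp only [map_add, smul_add, add_apply]; abel)
    (fun c x η => by
      simp only [map_smul, smul_add, smul_apply, smul_comm c])

theorem inner_leftBilin (hξ : ∀ v, ‖ξ v‖ = 1) (v : V) (w : W.Left v) (x x' : H v) (η η' : WordSpace ξ w.1.1) :
    ⟪leftBilin ξ W v w x η, leftBilin ξ W v w x' η'⟫_ℂ = ⟪x, x'⟫_ℂ * ⟪η, η'⟫_ℂ := by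
  simp only [leftBilin, LinearMap.mk₂_apply, inner_add_left, inner_add_right, inner_smul_left,
    inner_smul_right, LinearIsometry.inner_map_map, inner_cons,
    inner_inclWord_of_ne ξ W (W.rep_cons_ne w w), inner_inclWord_of_ne ξ W (W.rep_cons_ne w w).symm]
  rw [inner_eq_add_circProj (hξ v) x x', inner_conj_symm]
  ring

theorem inner_leftBilin_of_ne (v : V) {w w' : W.Left v} (h : w ≠ w') (x x' : H v)
    (η : WordSpace ξ w.1.1) (η' : WordSpace ξ w'.1.1) :
    ⟪leftBilin ξ W v w x η, leftBilin ξ W v w' x' η'⟫_ℂ = 0 := by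
  simp only [leftBilin, LinearMap.mk₂_apply, inner_add_left, inner_add_right, inner_smul_left,
    inner_smul_right]
  rw [inner_inclWord_of_ne ξ W (fun e => h (Subtype.ext e)),
    inner_inclWord_of_ne ξ W (W.rep_cons_ne w w'),
    inner_inclWord_of_ne ξ W (W.rep_cons_ne w' w).symm,
    inner_inclWord_of_ne ξ W (fun e => h (W.rep_cons_injective v e))]
  simp

/-- The isometry `H_v ⊗ H_w → H` extending `leftBilin`. -/
def leftIsometry (hξ : ∀ v, ‖ξ v‖ = 1) (v : V) (w : W.Left v) :
    HilbertTensor₂ (H v) (WordSpace ξ w.1.1) →ₗᵢ[ℂ] GraphSpace ξ W :=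
  HilbertTensor₂.liftIsometry (leftBilin ξ W v w) (inner_leftBilin ξ W hξ v w)

theorem orthogonalFamily_leftIsometry (hξ : ∀ v, ‖ξ v‖ = 1) (v : V) :
    OrthogonalFamily ℂ (fun w : W.Left v => HilbertTensor₂ (H v) (WordSpace ξ w.1.1))
      (leftIsometry ξ W hξ v) := by
  intro w w' h x y
  refine HilbertTensor₂.denseRange_of.induction_on
    (p := fun x => ⟪leftIsometry ξ W hξ v w x, leftIsometry ξ W hξ v w' y⟫_ℂ = 0) x
    (isClosed_eq (by fun_prop) (by fun_prop)) (fun x => ?_)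
  refine HilbertTensor₂.denseRange_of.induction_on
    (p := fun y => ⟪leftIsometry ξ W hξ v w (HilbertTensor₂.of x),
      leftIsometry ξ W hξ v w' y⟫_ℂ = 0) y
    (isClosed_eq (by fun_prop) (by fun_prop)) (fun y => ?_)
  induction x using TensorProduct.induction_on with
  | zero => simp only [map_zero, inner_zero_left]
  | add x x' hx hx' => rw [map_add, map_add, inner_add_left, hx, hx', add_zero]
  | tmul x η =>
    induction y using TensorProduct.induction_on with
    | zero => simp only [map_zero, inner_zero_right]
    | add y y' hy hy' => rw [map_add, map_add, inner_add_right, hy, hy', add_zero]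
    | tmul x' η' =>
      rw [leftIsometry, leftIsometry, HilbertTensor₂.liftIsometry_tmul,
        HilbertTensor₂.liftIsometry_tmul]
      exact inner_leftBilin_of_ne ξ W v h x x' η η'

/-- The Hilbert space `H(v)`: the direct sum of the `H_w` over the minimal words `w`, the empty
word included, for which `v w` is reduced. -/
abbrev LeftSpace (v : V) : Type _ := lp (fun w : W.Left v => WordSpace ξ w.1.1) 2

/-- `x ⊗ (η_w)_w ↦ (x ⊗ η_w)_w`, as a bilinear map. -/
def distribBilin (v : V) : H v →ₗ[ℂ] LeftSpace ξ W v →ₗ[ℂ]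
    lp (fun w : W.Left v => HilbertTensor₂ (H v) (WordSpace ξ w.1.1)) 2 :=
  LinearMap.mk₂ ℂ (fun x η => ⟨fun w => HilbertTensor₂.of (x ⊗ₜ[ℂ] η w), by
        refine memℓp_gen ?_
        have := (lp.memℓp η).summable (by norm_num)
        refine (this.mul_left (‖x‖ ^ (2 : ENNReal).toReal)).congr fun w => ?_
        rw [LinearIsometry.norm_map, TensorProduct.norm_tmul,
          Real.mul_rpow (norm_nonneg _) (norm_nonneg _)]⟩)
    (fun x y η => by
      ext1; funext w
      exact (congrArg _ (TensorProduct.add_tmul x y (η w))).trans (map_add _ _ _))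
    (fun c x η => by
      ext1; funext w
      exact (congrArg _ (TensorProduct.smul_tmul' c x (η w)).symm).trans (map_smul _ _ _))
    (fun x η η' => by
      ext1; funext w
      exact (congrArg _ (TensorProduct.tmul_add x (η w) (η' w))).trans (map_add _ _ _))
    (fun c x η => by
      ext1; funext w
      exact (congrArg _ (TensorProduct.tmul_smul c x (η w))).trans (map_smul _ _ _))

theorem inner_distribBilin (v : V) (x x' : H v) (η η' : LeftSpace ξ W v) :
    ⟪distribBilin ξ W v x η, distribBilin ξ W v x' η'⟫_ℂ = ⟪x, x'⟫_ℂ * ⟪η, η'⟫_ℂ := by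
  rw [lp.inner_eq_tsum, lp.inner_eq_tsum, ← tsum_mul_left]
  refine tsum_congr fun w => ?_
  exact (LinearIsometry.inner_map_map HilbertTensor₂.of _ _).trans (TensorProduct.inner_tmul ..)

/-- The isometry `U_v : H_v ⊗ H(v) → H`, which on `x ⊗ η` with `η ∈ H_w` is given by
`leftBilin`. -/
def leftU (hξ : ∀ v, ‖ξ v‖ = 1) (v : V) : HilbertTensor₂ (H v) (LeftSpace ξ W v) →ₗᵢ[ℂ] GraphSpace ξ W :=
  (orthogonalFamily_leftIsometry ξ W hξ v).linearIsometry.comp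
    (HilbertTensor₂.liftIsometry (distribBilin ξ W v) (inner_distribBilin ξ W v))

/-- `λ_v(x) = U_v (x ⊗ 1) U_v^*`. -/
def leftRep (hξ : ∀ v, ‖ξ v‖ = 1) (v : V) (x : H v →L[ℂ] H v) : GraphSpace ξ W →L[ℂ] GraphSpace ξ W :=
  (leftU ξ W hξ v).toContinuousLinearMap ∘L HilbertTensor₂.ampl (LeftSpace ξ W v) x ∘L
    ContinuousLinearMap.adjoint (leftU ξ W hξ v).toContinuousLinearMap

end GraphSpace

section VonNeumann

/-- A von Neumann algebra `M ⊆ B(H)` with a faithful normal state, in its GNS representation: the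
state is the vector state of a unit vector `ξ ∈ H` that is cyclic (so that `(H, id, ξ)` is a GNS
construction of the state) and separating (so that the state is faithful) for `M`. -/
structure StateAlgebra (H : Type*) [NormedAddCommGroup H] [InnerProductSpace ℂ H]
    [CompleteSpace H] where
  /-- the von Neumann algebra `M` -/
  alg : VonNeumannAlgebra H
  /-- the GNS vector `ξ` -/
  vec : H
  norm_vec : ‖vec‖ = 1
  cyclic : Dense {ζ : H | ∃ x ∈ alg, x vec = ζ}
  separating : ∀ x ∈ alg, x vec = 0 → x = 0

/-- The von Neumann algebra `M`, as an algebra. -/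
abbrev VN {H : Type*} [NormedAddCommGroup H] [InnerProductSpace ℂ H] [CompleteSpace H]
    (M : VonNeumannAlgebra H) : Type _ := M.toStarSubalgebra

section Maps

variable {H K : Type*} [NormedAddCommGroup H] [InnerProductSpace ℂ H] [CompleteSpace H]
  [NormedAddCommGroup K] [InnerProductSpace ℂ K] [CompleteSpace K]

/-- The vector functional `x ↦ ⟨x ζ, ζ⟩` (with the inner product linear in the first variable). -/
def vecState {M : VonNeumannAlgebra H} (ζ : H) (x : VN M) : ℂ := ⟪ζ, (x : H →L[ℂ] H) ζ⟫_ℂ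

/-- A matrix `a ∈ M_n(M) ⊆ B(H^n)` is positive if `⟨a x, x⟩ ≥ 0` for all `x ∈ H^n`. -/
def MatrixNonneg {M : VonNeumannAlgebra H} {n : ℕ} (a : Fin n → Fin n → VN M) : Prop :=
  ∀ x : Fin n → H, 0 ≤ ∑ i, ∑ j, ⟪x i, (a i j : H →L[ℂ] H) (x j)⟫_ℂ

/-- Unital completely positive maps between von Neumann algebras. -/
def IsUCP {M : VonNeumannAlgebra H} {N : VonNeumannAlgebra K} (φ : VN M →ₗ[ℂ] VN N) : Prop :=
  φ 1 = 1 ∧ ∀ (n : ℕ) (a : Fin n → Fin n → VN M),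
    MatrixNonneg a → MatrixNonneg fun i j => φ (a i j)

/-- Normal (`σ`-weakly continuous) functionals: those of the form `x ↦ ∑ n, ⟨x ξ_n, η_n⟩` with
`∑ n, ‖ξ_n‖² < ∞` and `∑ n, ‖η_n‖² < ∞`. -/
def IsNormalFunctional {M : VonNeumannAlgebra H} (f : VN M →ₗ[ℂ] ℂ) : Prop :=
  ∃ ξ η : ℕ → H, Summable (fun n => ‖ξ n‖ ^ 2) ∧ Summable (fun n => ‖η n‖ ^ 2) ∧
    ∀ x : VN M, f x = ∑' n, ⟪η n, (x : H →L[ℂ] H) (ξ n)⟫_ℂ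

/-- Normal (`σ`-weakly continuous) maps: those that pull back normal functionals to normal
functionals. -/
def IsNormal {M : VonNeumannAlgebra H} {N : VonNeumannAlgebra K} (φ : VN M →ₗ[ℂ] VN N) : Prop :=
  ∀ f : VN N →ₗ[ℂ] ℂ, IsNormalFunctional f → IsNormalFunctional (f ∘ₗ φ)

/-- The bounded operator `T : H → K` extends the map `x ξ ↦ φ(x) η`; for `ξ` and `η` the GNS
vectors of states, `T` is the `L²`-extension of `φ`. -/
def IsL2Extension {M : VonNeumannAlgebra H} {N : VonNeumannAlgebra K} (φ : VN M →ₗ[ℂ] VN N)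
    (ξ : H) (η : K) (T : H →L[ℂ] K) : Prop :=
  ∀ x : VN M, T ((x : H →L[ℂ] H) ξ) = (φ x : K →L[ℂ] K) η

/-- The von Neumann algebra generated by `S`: the double commutant of `S ∪ S^*`. -/
def vnGen (S : Set (H →L[ℂ] H)) : VonNeumannAlgebra H where
  toStarSubalgebra := StarSubalgebra.centralizer ℂ (StarSubalgebra.centralizer ℂ S : Set (H →L[ℂ] H))
  centralizer_centralizer' := by
    change Set.centralizer (Set.centralizer
      (StarSubalgebra.centralizer ℂ (StarSubalgebra.centralizer ℂ S : Set (H →L[ℂ] H)) :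
        Set (H →L[ℂ] H))) =
      (StarSubalgebra.centralizer ℂ (StarSubalgebra.centralizer ℂ S : Set (H →L[ℂ] H)) :
        Set (H →L[ℂ] H))
    rw [StarSubalgebra.coe_centralizer_centralizer, Set.centralizer_centralizer_centralizer]

theorem subset_vnGen (S : Set (H →L[ℂ] H)) {x : H →L[ℂ] H} (hx : x ∈ S) :
    x ∈ (vnGen S).toStarSubalgebra := by
  have h : x ∈ (StarSubalgebra.centralizer ℂ
      (StarSubalgebra.centralizer ℂ S : Set (H →L[ℂ] H)) : Set (H →L[ℂ] H)) := by
    rw [StarSubalgebra.coe_centralizer_centralizer]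
    exact Set.subset_centralizer_centralizer (Or.inl hx)
  exact h

end Maps

variable {V : Type*} {G : SimpleGraph V} (W : MinimalWords G) {H : V → Type*}
  [∀ v, NormedAddCommGroup (H v)] [∀ v, InnerProductSpace ℂ (H v)] [∀ v, CompleteSpace (H v)]
  (A : ∀ v, StateAlgebra (H v))

/-- The graph product Hilbert space of the pointed Hilbert spaces `(H_v, ξ_v)`. -/
abbrev graphSpace : Type _ := GraphSpace (fun v => (A v).vec) W

/-- The vacuum vector `Ω`. -/
def graphVacuum : graphSpace W A := vacuum (fun v => (A v).vec) W

/-- The representation `λ_v` of `B(H_v)` on the graph product Hilbert space. -/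
def graphRep (v : V) (x : H v →L[ℂ] H v) : graphSpace W A →L[ℂ] graphSpace W A :=
  leftRep (fun v => (A v).vec) W (fun v => (A v).norm_vec) v x

/-- The graph product von Neumann algebra `M_Γ = (⋃ v, λ_v(M_v))''`. -/
def graphAlg : VonNeumannAlgebra (graphSpace W A) :=
  vnGen {T | ∃ v, ∃ x ∈ (A v).alg, graphRep W A v x = T}

/-- The inclusion `M_v → M_Γ`, `x ↦ λ_v(x)`. -/
def graphEmbed (v : V) (x : VN (A v).alg) : VN (graphAlg W A) :=
  ⟨graphRep W A v x, subset_vnGen _ ⟨v, x, x.2, rfl⟩⟩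

/-- `M_v° = {x ∈ M_v | ω_v(x) = 0}`. -/
def StateAlgebra.Centered {H : Type*} [NormedAddCommGroup H] [InnerProductSpace ℂ H]
    [CompleteSpace H] (A : StateAlgebra H) (x : VN A.alg) : Prop := vecState A.vec x = 0

/-- The product `a_1 ⋯ a_n ∈ M_Γ` of operators `a_k ∈ M_{w_k}`. -/
def graphProd (w : List V) (a : ∀ i : Fin w.length, VN (A (w.get i)).alg) : VN (graphAlg W A) :=
  (List.ofFn fun i => graphEmbed W A (w.get i) (a i)).prod

end VonNeumann

end GraphProd

end

open scoped TensorProduct InnerProductSpace ComplexOrder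

set_option linter.unusedSectionVars false

noncomputable section

namespace GraphProd

/-! ### Matchings, decorated words and reversal of words -/

section Words

variable {V : Type*} {G : SimpleGraph V}

/-! The idea is to dilate every vertex map, to form the graph product of the dilations, and to
compress back. The Stinespring construction for φ_v gives a Hilbert space L_v (`Dilation`), a
representation π_v of M_v on it (`dilationRep`) and an isometry Q_v : K_v → L_v (`dilationIso`) with
φ_v(x) = Q_v^* π_v(x) Q_v. Put χ_v = Q_v η_v. As φ_v preserves the states, x ξ_v ↦ π_v(x) χ_v is
isometric and extends to R_v : H_v → L_v, which intertwines M_v with π_v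
(`exists_dilation_intertwiner`). The graph product L of the pointed spaces (L_v, χ_v) receives
isometries Q : K → L and R : H → L (`graphMap`).

For reduced operators one has Q^* π(a_1) ⋯ π(a_n) Q = φ(a_1) ⋯ φ(a_n) (`inner_graphMap_leftProd`).
On the vacuum both sides are simple tensors, and the claim reduces to Q_v^* π_v(a) χ_v = φ_v(a) η_v.
Both sides commute with the right actions of the commutants N_v': these lift to L_v, and right
actions commute with left ones (`leftRep_commute_rightRep`). Since η_v is separating for N_v, it is
cyclic for N_v', so the vacuum is cyclic for these right actions.

To pass from reduced operators to M_Γ, π itself is not extended. Instead a maximal orthogonal family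
of partial isometries L → H intertwining the generators is assembled into a column J : L → H ⊗ ℓ².
Then J^* J fixes the range of every intertwiner H → L (`exists_intertwining_column`), and Q takes
its values in the closed span of such ranges, because R and its composites with lifted right actions
are intertwiners (`adjoint_column_graphMap`). Hence S = J Q is an isometry, and Φ(x) = S^* (x ⊗ 1) S
is normal, ucp and correct on reduced operators.

The span of the reduced operators contains 1 and is stable under left multiplication by the
generators. A double commutant argument on amplifications (`lpAmpl_mem_closure`) shows that it
determines all matrix coefficients of M_Γ; this gives both Φ(M_Γ) ⊆ N_Γ and uniqueness. Finally Φ(x)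
Ω = Q^* R x Ω, so T_Φ = Q^* R, which on each word is the tensor product of the operators Q_v^* R_v =
T_{φ_v}. -/

/-- There is at most one bijection matching the letters of two words. -/
theorem IsMatching.eq {l l' : List V} {σ τ : Fin l'.length ≃ Fin l.length}
    (hσ : IsMatching l l' σ) (hτ : IsMatching l l' τ) : σ = τ := by
  -- At a first disagreement i, the smaller value σ i is taken by τ at some j carrying the same
  -- letter; j < i contradicts injectivity of σ, and j > i the order of equal letters.
  have key : ∀ (σ τ : Fin l'.length ≃ Fin l.length), IsMatching l l' σ → IsMatching l l' τ →
      ∀ i, (∀ j < i, σ j = τ j) → ¬ σ i < τ i := by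
    intro σ τ hσ hτ i hi hlt
    obtain ⟨j, hj⟩ := τ.surjective (σ i)
    have hlet : l'.get j = l'.get i := by rw [← hτ.1, ← hσ.1, hj]
    rcases lt_trichotomy j i with h | h | h
    · exact h.ne (σ.injective ((hi j h).trans hj))
    · subst h
      exact hlt.ne hj.symm
    · exact absurd (hτ.2 i j h hlet.symm) (not_lt.2 (hj ▸ hlt.le))
  ext1 i
  induction i using WellFoundedLT.induction with
  | ind i ih =>
    have h1 := key σ τ hσ hτ i ih
    have h2 := key τ σ hτ hσ i (fun j hj => (ih j hj).symm)
    exact le_antisymm (not_lt.1 h2) (not_lt.1 h1)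

theorem IsMatching.trans {l l' l'' : List V} {σ : Fin l'.length ≃ Fin l.length}
    {τ : Fin l''.length ≃ Fin l'.length} (hσ : IsMatching l l' σ) (hτ : IsMatching l' l'' τ) :
    IsMatching l l'' (τ.trans σ) :=
  ⟨fun i => by rw [Equiv.trans_apply, hσ.1, hτ.1],
    fun i j hij he => hσ.2 _ _ (hτ.2 i j hij he) (by rw [hτ.1, hτ.1, he])⟩

theorem isMatching_refl (l : List V) : IsMatching l l (Equiv.refl _) :=
  ⟨fun _ => rfl, fun _ _ h _ => h⟩

/-- Interchanging two neighbouring syllables with different letters is induced by a matching of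
the underlying words. -/
theorem exists_matching_swap {α : Type*} (f : α → V) (p q : List α) (a b : α) (hab : f a ≠ f b) :
    ∃ σ : Fin ((p ++ b :: a :: q).map f).length ≃ Fin ((p ++ a :: b :: q).map f).length,
      IsMatching ((p ++ a :: b :: q).map f) ((p ++ b :: a :: q).map f) σ ∧
      ∀ i, (p ++ a :: b :: q)[(σ i : ℕ)]? = (p ++ b :: a :: q)[(i : ℕ)]? := by
  have hlen : ((p ++ b :: a :: q).map f).length = ((p ++ a :: b :: q).map f).length := by simp
  let x : Fin ((p ++ a :: b :: q).map f).length := ⟨p.length, by simp⟩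
  let y : Fin ((p ++ a :: b :: q).map f).length := ⟨p.length + 1, by simp⟩
  have hσ : ∀ i : Fin ((p ++ b :: a :: q).map f).length,
      (((finCongr hlen).trans (Equiv.swap x y)) i : ℕ) =
        if (i : ℕ) = p.length then p.length + 1 else
          if (i : ℕ) = p.length + 1 then p.length else i := by
    intro i
    simp only [Equiv.trans_apply, Equiv.swap_apply_def, Fin.ext_iff, finCongr_apply,
      Fin.val_cast, x, y]
    split_ifs <;> simp
  have hget : ∀ i : Fin ((p ++ b :: a :: q).map f).length,
      (p ++ a :: b :: q)[(((finCongr hlen).trans (Equiv.swap x y)) i : ℕ)]? =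
        (p ++ b :: a :: q)[(i : ℕ)]? := by
    intro i
    rw [hσ]
    obtain ⟨i, hi⟩ := i
    grind
  refine ⟨(finCongr hlen).trans (Equiv.swap x y), ⟨?_, ?_⟩, hget⟩
  · intro i
    have := congrArg (Option.map f) (hget i)
    rw [← List.getElem?_map, ← List.getElem?_map] at this
    rw [List.get_eq_getElem, List.get_eq_getElem]
    apply Option.some_injective
    rw [← List.getElem?_eq_getElem, ← List.getElem?_eq_getElem]
    exact this
  · intro i j hij he
    rw [Fin.lt_def, hσ, hσ]
    obtain ⟨i, hi⟩ := i
    obtain ⟨j, hj⟩ := j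
    simp only [List.get_eq_getElem, Fin.lt_def] at he hij ⊢
    grind

theorem TypeII.of_eq {l l' : List V} (h : l = l') : TypeII G l l' := h ▸ .refl _

/-- Syllables are moved according to the pulled back graph `G.comap f`, so two of them may be
interchanged exactly when their letters may. This makes the combinatorics of words available for
letters decorated with vectors or operators. -/
theorem TypeII.map {α : Type*} (f : α → V) {s s' : List α} (h : TypeII (G.comap f) s s') :
    TypeII G (s.map f) (s'.map f) := by
  induction h with
  | rel _ _ h =>
    obtain ⟨p, q, v, w, h⟩ := h
    simp only [List.map_append, List.map_cons]
    exact .rel _ _ (StepII.mk _ _ _ _ h)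
  | refl => exact .refl _
  | symm _ _ _ ih => exact ih.symm
  | trans _ _ _ _ _ ih1 ih2 => exact ih1.trans _ _ _ ih2

/-- Maps of syllables that respect the letters respect type II equivalence. -/
theorem TypeII.map_comap {α β : Type*} (f : α → V) (g : β → V) (k : α → β)
    (hk : ∀ a, g (k a) = f a) {s s' : List α} (h : TypeII (G.comap f) s s') :
    TypeII (G.comap g) (s.map k) (s'.map k) := by
  have : G.comap f = (G.comap g).comap k := by
    ext a b; simp [hk]
  rw [this] at h
  exact h.map k

theorem TypeII.reverse {l l' : List V} (h : TypeII G l l') : TypeII G l.reverse l'.reverse := by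
  induction h with
  | rel _ _ h =>
    obtain ⟨p, q, v, w, h⟩ := h
    have := StepII.mk (G := G) q.reverse p.reverse w v h.symm
    simp only [List.reverse_append, List.reverse_cons, List.append_assoc, List.cons_append,
      List.nil_append]
    exact .rel _ _ this
  | refl => exact .refl _
  | symm _ _ _ ih => exact ih.symm
  | trans _ _ _ _ _ ih1 ih2 => exact ih1.trans _ _ _ ih2

/-- Type II equivalences of words lift to words of syllables. -/
theorem TypeII.exists_lift {α : Type*} (f : α → V) {l l' : List V} (h : TypeII G l l') :
    (∀ s : List α, s.map f = l → ∃ s', s'.map f = l' ∧ TypeII (G.comap f) s s') ∧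
    (∀ s : List α, s.map f = l' → ∃ s', s'.map f = l ∧ TypeII (G.comap f) s s') := by
  -- One direction of a single move suffices, since a move of type II is undone by another one;
  -- carrying both directions makes the symmetric closure immediate.
  have step : ∀ l l' : List V, StepII G l l' →
      ∀ s : List α, s.map f = l → ∃ s', s'.map f = l' ∧ TypeII (G.comap f) s s' := by
    rintro _ _ ⟨p, q, v, w, hvw⟩ s hs
    obtain ⟨p', r, rfl, rfl, hr⟩ := List.map_eq_append_iff.1 hs
    obtain ⟨a, r', rfl, rfl, hr'⟩ := List.map_eq_cons_iff.1 hr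
    obtain ⟨b, r, rfl, rfl, rfl⟩ := List.map_eq_cons_iff.1 hr'
    exact ⟨p' ++ b :: a :: r, by simp, .rel _ _ (StepII.mk _ _ _ _ hvw)⟩
  induction h with
  | rel l l' h =>
    refine ⟨step _ _ h, step _ _ ?_⟩
    obtain ⟨p, q, v, w, h⟩ := h
    exact StepII.mk p q w v h.symm
  | refl => exact ⟨fun s hs => ⟨s, hs, .refl _⟩, fun s hs => ⟨s, hs, .refl _⟩⟩
  | symm _ _ _ ih => exact ih.symm
  | trans _ _ _ _ _ ih1 ih2 =>
    constructor
    · intro s hs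
      obtain ⟨s', h1, h2⟩ := ih1.1 s hs
      obtain ⟨s'', h3, h4⟩ := ih2.1 s' h1
      exact ⟨s'', h3, h2.trans _ _ _ h4⟩
    · intro s hs
      obtain ⟨s', h1, h2⟩ := ih2.2 s hs
      obtain ⟨s'', h3, h4⟩ := ih1.2 s' h1
      exact ⟨s'', h3, h2.trans _ _ _ h4⟩

theorem isReduced_reverse {l : List V} (h : IsReduced G l) : IsReduced G l.reverse := by
  intro p m q v hl
  obtain ⟨x, hx, hx'⟩ := h q.reverse m.reverse p.reverse v (by
    rw [← List.reverse_reverse l, hl]; simp)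
  exact ⟨x, by simpa using hx, hx'⟩

theorem isReduced_reverse_iff {l : List V} : IsReduced G l.reverse ↔ IsReduced G l :=
  ⟨fun h => by simpa using isReduced_reverse h, isReduced_reverse⟩

theorem IsReduced.tail {v : V} {l : List V} (h : IsReduced G (v :: l)) : IsReduced G l :=
  ((isReduced_cons G v l).1 h).2

/-- A syllable whose letter is reachable can be moved to the front. -/
theorem exists_typeII_cons_of_reach {α : Type*} (f : α → V) {v : V} :
    ∀ {s : List α}, Reach G v (s.map f) → ∃ a s', f a = v ∧ TypeII (G.comap f) s (a :: s')
  | [], h => h.elim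
  | a :: s, h => by
    rcases h with h | ⟨h1, h2⟩
    · exact ⟨a, s, h, .refl _⟩
    · obtain ⟨b, s', rfl, h3⟩ := exists_typeII_cons_of_reach f h2
      exact ⟨b, a :: s', rfl, (h3.cons _ a).trans _ _ _
        (.rel _ _ (StepII.mk [] s' a b (SimpleGraph.comap_adj.2 h1.symm)))⟩

/-- A letter that becomes reachable only through the appended w must be w itself, and everything
before it is then adjacent to v rather than equal to v. This is the one configuration in which a
letter split off on the left interferes with one split off on the right. -/
theorem reach_append_singleton {v w : V} {l : List V} (h : Reach G v (l ++ [w]))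
    (hn : ¬ Reach G v l) : w = v ∧ ∀ x ∈ l, G.Adj v x := by
  induction l with
  | nil => simpa [Reach] using h
  | cons a l ih =>
    simp only [List.cons_append, Reach, not_or, not_and] at h hn
    rcases h with h | h
    · exact absurd h hn.1
    · obtain ⟨h1, h2⟩ := ih h.2 (hn.2 h.1)
      exact ⟨h1, by simpa using ⟨h.1, h2⟩⟩

/-- A syllable whose letter is adjacent to all others can be moved from the front to the back. -/
theorem typeII_cons_append {α : Type*} (f : α → V) (a : α) :
    ∀ {s : List α}, (∀ x ∈ s.map f, G.Adj (f a) x) → TypeII (G.comap f) (a :: s) (s ++ [a])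
  | [], _ => .refl _
  | b :: s, h => by
    have h1 : TypeII (G.comap f) (a :: s) (s ++ [a]) :=
      typeII_cons_append f a fun x hx => h x (by simp only [List.map_cons, List.mem_cons]; tauto)
    have h2 : (G.comap f).Adj a b := SimpleGraph.comap_adj.2 (h _ (by simp))
    exact Relation.EqvGen.trans _ _ _ (.rel _ _ (StepII.mk [] s a b h2)) (h1.cons _ b)

end Words

/-! ### Vectors of the graph product space given by decorated words -/

section Vectors

variable {V : Type*} {H : V → Type*} [∀ v, NormedAddCommGroup (H v)]
  [∀ v, InnerProductSpace ℂ (H v)] (ξ : ∀ v, H v)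

/-- Words of syllables: letters `v` together with vectors of `H°_v`. -/
abbrev SylWord : Type _ := List (Σ v, circ (ξ v))

variable {ξ}

/-- The word formed by the letters of a word of syllables. -/
abbrev SylWord.word (s : SylWord ξ) : List V := s.map Sigma.fst

/-- The family of vectors in a word of syllables. -/
def SylWord.family : ∀ s : SylWord ξ, ∀ i : Fin s.word.length, circ (ξ (s.word.get i))
  | [] => fun i => i.elim0
  | a :: s => consFamily ξ a.2 (SylWord.family s)

/-- The simple tensor of the vectors in a word of syllables. -/
def SylWord.tensor (s : SylWord ξ) : WordSpace ξ s.word := tprod s.family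

/-- Entries are read off as pairs of a letter and a vector, so that families over different words
can be compared without transport between the spaces `circ (ξ v)`. -/
theorem SylWord.getElem?_eq (s : SylWord ξ) (i : Fin s.word.length) :
    s[(i : ℕ)]? = some ⟨s.word.get i, s.family i⟩ := by
  induction s with
  | nil => exact i.elim0
  | cons a s ih =>
    refine Fin.cases ?_ (fun i => ?_) i
    · rfl
    · exact ih i

theorem SylWord.tensor_cons (v : V) (ζ : circ (ξ v)) (s : SylWord ξ) :
    SylWord.tensor (⟨v, ζ⟩ :: s : SylWord ξ) = cons ξ v s.word s.tensor ζ :=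
  (cons_tprod ξ v s.word s.family ζ).symm

theorem castCirc_eq_of_sigma_eq {a b : V} (h : a = b) {x : circ (ξ a)} {y : circ (ξ b)}
    (hxy : (⟨a, x⟩ : Σ v, circ (ξ v)) = ⟨b, y⟩) : castCirc ξ h x = y := by
  subst h
  have := eq_of_heq (Sigma.mk.inj hxy).2
  subst this
  rfl

theorem castCirc_apply_of_eq {a b : V} (h : a = b) (x : circ (ξ a)) :
    (⟨b, castCirc ξ h x⟩ : Σ v, circ (ξ v)) = ⟨a, x⟩ := by
  subst h
  rfl

/-- Every family of vectors comes from a word of syllables. -/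
theorem tprod_induction {p : ∀ l : List V, WordSpace ξ l → Prop}
    (h : ∀ s : SylWord ξ, p s.word s.tensor) (l : List V)
    (x : ∀ i : Fin l.length, circ (ξ (l.get i))) : p l (tprod x) := by
  -- The predicate is generalised to families over a fixed word; the inductive step precomposes it
  -- with `consFamily ξ (x 0)`.
  suffices ∀ l : List V, ∀ p : (∀ i : Fin l.length, circ (ξ (l.get i))) → Prop,
      (∀ s : SylWord ξ, ∀ e : s.word = l, p (e ▸ s.family)) → ∀ x, p x by
    refine this l (fun x => p l (tprod x)) ?_ x
    rintro s rfl
    exact h s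
  intro l
  induction l with
  | nil =>
    intro p hp x
    have := hp [] rfl
    convert this using 1
    funext i
    exact i.elim0
  | cons v l ih =>
    intro p hp x
    have e : x = consFamily ξ (x 0) fun i => x i.succ := by
      funext i
      refine Fin.cases ?_ (fun i => ?_) i <;> rfl
    rw [e]
    refine ih (fun y => p (consFamily ξ (x 0) y)) ?_ _
    rintro s rfl
    exact hp (⟨v, x 0⟩ :: s) rfl

variable {G : SimpleGraph V}

/-- `permute` is built from a chosen matching; as matchings are unique, any matching at hand
computes it. -/
theorem permute_tprod {l l' : List V} (h : TypeII G l l') {σ : Fin l'.length ≃ Fin l.length}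
    (hσ : IsMatching l l' σ) (x : ∀ i : Fin l.length, circ (ξ (l.get i))) :
    permute ξ h (tprod x) = tprod fun i => castCirc ξ (hσ.1 i) (x (σ i)) := by
  have e : (exists_matching G h).choose = σ := (exists_matching G h).choose_spec.eq hσ
  subst e
  exact HilbertTensor.liftIsometry_tprod _ (fun x y => by
    rw [inner_tprod, prod_inner_matching ξ hσ]) x

theorem permute_self {l : List V} (h : TypeII G l l) (x : WordSpace ξ l) : permute ξ h x = x := by
  have : (permute ξ h).toContinuousLinearMap = ContinuousLinearMap.id ℂ _ :=
    HilbertTensor.clm_ext fun a => permute_tprod h (isMatching_refl l) a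
  exact congrArg (fun f => f x) this

/-- Composing the swap of a and b with the matching of the swapped word onto u yields a matching of
the original word, hence the one that computes its `permute`. The swap keeps the order of equal
letters because the two letters differ. -/
theorem permute_tensor_swap {p q : SylWord ξ} {a b : Σ v, circ (ξ v)} (hab : a.1 ≠ b.1)
    {u : List V} (h : TypeII G (SylWord.word (p ++ a :: b :: q)) u)
    (h' : TypeII G (SylWord.word (p ++ b :: a :: q)) u) :
    permute ξ h (SylWord.tensor _) = permute ξ h' (SylWord.tensor _) := by
  obtain ⟨τ, hτ, hτ'⟩ := exists_matching_swap Sigma.fst p q a b hab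
  have hσ := (exists_matching G h').choose_spec
  rw [SylWord.tensor, SylWord.tensor, permute_tprod h (hτ.trans hσ), permute_tprod h' hσ]
  congr 1
  funext i
  refine castCirc_eq_of_sigma_eq _ ?_
  rw [castCirc_apply_of_eq]
  have := hτ' ((exists_matching G h').choose i)
  have e1 := SylWord.getElem?_eq (p ++ a :: b :: q) (τ ((exists_matching G h').choose i))
  have e2 := SylWord.getElem?_eq (p ++ b :: a :: q) ((exists_matching G h').choose i)
  exact Option.some_injective _ (e1.symm.trans (this.trans e2))

variable (W : MinimalWords G)

theorem MinimalWords.rep_eq {l : List V} (hl : IsReduced G l) {u : W.carrier}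
    (h : TypeII G l u.1) : W.rep l hl = u :=
  W.eq_of_typeII (((W.rep_typeII l hl).symm).trans _ _ _ h)

open Classical in
/-- The vector of the graph product space given by a word of syllables; it is zero if the underlying
word is not reduced. -/
def vec (s : SylWord ξ) : GraphSpace ξ W :=
  if h : IsReduced G s.word then
    inclWord ξ W (W.rep _ h) (permute ξ (W.rep_typeII _ h) s.tensor) else 0

variable {W}

/-- Any minimal word known to be equivalent may replace the chosen representative. -/
theorem vec_eq_inclWord {s : SylWord ξ} (u : W.carrier) (h : TypeII G s.word u.1) :
    vec W s = inclWord ξ W u (permute ξ h s.tensor) := by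
  have hr : IsReduced G s.word := (isReduced_typeII G h).2 (W.isReduced _ u.2)
  obtain rfl := W.rep_eq hr h
  rw [vec, dif_pos hr]

theorem vec_eq_zero {s : SylWord ξ} (h : ¬ IsReduced G s.word) : vec W s = 0 := by
  rw [vec, dif_neg h]

theorem vec_of_mem {s : SylWord ξ} (h : s.word ∈ W.carrier) :
    vec W s = inclWord ξ W ⟨s.word, h⟩ s.tensor := by
  have h' : TypeII G s.word s.word := .refl _
  exact (vec_eq_inclWord ⟨s.word, h⟩ h').trans (congrArg _ (permute_self h' _))

theorem vec_nil : vec W ([] : SylWord ξ) = vacuum ξ W := by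
  rw [vec_of_mem W.nil_mem]
  have : SylWord.tensor ([] : SylWord ξ) = tprod fun i => i.elim0 := by
    refine congrArg tprod ?_
    funext i
    exact i.elim0
  rw [this]
  rfl

/-- Type II equivalence of words of syllables. -/
abbrev SylEquiv (G : SimpleGraph V) (s s' : SylWord ξ) : Prop := TypeII (G.comap Sigma.fst) s s'

theorem SylEquiv.word {s s' : SylWord ξ} (h : SylEquiv G s s') : TypeII G s.word s'.word :=
  TypeII.map Sigma.fst h

theorem SylEquiv.isReduced {s s' : SylWord ξ} (h : SylEquiv G s s') :
    IsReduced G s.word ↔ IsReduced G s'.word :=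
  isReduced_typeII G h.word

/-- From here on vectors are rewritten by commuting syllables, and the permutation unitaries no
longer have to be mentioned. -/
theorem SylEquiv.vec_eq {s s' : SylWord ξ} (h : SylEquiv G s s') : vec W s = vec W s' := by
  induction h with
  | rel s s' h =>
    by_cases hr : IsReduced G s.word
    · have hw := SylEquiv.word (G := G) (.rel _ _ h)
      obtain ⟨p, q, a, b, hab⟩ := h
      have h1 := W.rep_typeII _ hr
      have h2 := hw.symm.trans _ _ _ h1
      rw [vec_eq_inclWord _ h1, vec_eq_inclWord _ h2,
        permute_tensor_swap (SimpleGraph.comap_adj.1 hab).ne h1 h2]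
    · have hr' : ¬ IsReduced G s'.word := by
        rwa [← SylEquiv.isReduced (.rel _ _ h)]
      rw [vec_eq_zero hr, vec_eq_zero hr']
  | refl => rfl
  | symm _ _ _ ih => exact ih.symm
  | trans _ _ _ _ _ ih1 ih2 => exact ih1.trans ih2

/-- Every reduced word of syllables is equivalent to one with a minimal underlying word. -/
theorem exists_sylEquiv_minimal (W : MinimalWords G) {s : SylWord ξ} (h : IsReduced G s.word) :
    ∃ s', s'.word ∈ W.carrier ∧ SylEquiv G s s' := by
  obtain ⟨s', h1, h2⟩ := ((W.rep_typeII _ h).exists_lift Sigma.fst).1 s rfl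
  exact ⟨s', (congrArg (· ∈ W.carrier) h1).mpr (W.rep _ h).2, h2⟩

theorem exists_sylEquiv_cons_of_reach {v : V} {s : SylWord ξ} (h : Reach G v s.word) :
    ∃ ζ s', SylEquiv G s (⟨v, ζ⟩ :: s') := by
  obtain ⟨⟨w, ζ⟩, s', rfl, h2⟩ := exists_typeII_cons_of_reach Sigma.fst h
  exact ⟨ζ, s', h2⟩

/-- A bounded operator is determined by its values on the vectors `vec s`. -/
theorem clm_ext_vec {K : Type*} [NormedAddCommGroup K] [NormedSpace ℂ K]
    {S T : GraphSpace ξ W →L[ℂ] K} (h : ∀ s, IsReduced G s.word → S (vec W s) = T (vec W s)) :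
    S = T := by
  classical
  refine lp.ext_continuousLinearMap ENNReal.ofNat_ne_top fun w => ?_
  refine HilbertTensor.clm_ext fun y => ?_
  have e : ∀ z, lp.singleContinuousLinearMap ℂ (fun w : W.carrier => WordSpace ξ w.1) 2 w z =
      inclWord ξ W w z := by
    intro z
    simp only [inclWord, lp.singleContinuousLinearMap_apply, lp.lsingle]
    congr!
  rw [ContinuousLinearMap.comp_apply, ContinuousLinearMap.comp_apply, e]
  clear e
  refine tprod_induction (p := fun l z => ∀ hl : l ∈ W.carrier,
    S (inclWord ξ W ⟨l, hl⟩ z) = T (inclWord ξ W ⟨l, hl⟩ z)) ?_ w.1 y w.2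
  intro s hs
  rw [← vec_of_mem hs]
  exact h s (W.isReduced _ hs)

/-- A closed subspace containing all the vectors `vec s` is the whole space. -/
theorem mem_of_forall_vec_mem {P : Submodule ℂ (GraphSpace ξ W)} (hP : IsClosed (P : Set (GraphSpace ξ W)))
    (h : ∀ s, IsReduced G s.word → vec W s ∈ P) (x : GraphSpace ξ W) : x ∈ P := by
  have : CompleteSpace P := hP.completeSpace_coe
  -- The projection onto P fixes every `vec W s` with s reduced, and these determine a bounded
  -- operator.
  have e : P.starProjection = ContinuousLinearMap.id ℂ _ :=
    clm_ext_vec fun s hs => by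
      rw [Submodule.starProjection_eq_self_iff.2 (h s hs)]; rfl
  rw [← Submodule.starProjection_eq_self_iff, e]
  rfl

/-- The map `ζ ↦ vec ((v, ζ) :: s)`, for a reduced word `v s`. -/
def vecCons (W : MinimalWords G) (v : V) (s : SylWord ξ) (h : IsReduced G (v :: s.word)) :
    circ (ξ v) →L[ℂ] GraphSpace ξ W :=
  (inclWord ξ W (W.rep _ h)).toContinuousLinearMap ∘L
    (permute ξ (W.rep_typeII _ h)).toContinuousLinearMap ∘L cons ξ v s.word s.tensor

theorem vecCons_apply {v : V} {s : SylWord ξ} (h : IsReduced G (v :: s.word)) (ζ : circ (ξ v)) :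
    vecCons W v s h ζ = vec W (⟨v, ζ⟩ :: s) := by
  have h' : IsReduced G (SylWord.word (⟨v, ζ⟩ :: s : SylWord ξ)) := h
  rw [vec, dif_pos h', SylWord.tensor_cons]
  rfl

/-- For a reduced word `v s`, the map `H_v → H` that is `ξ ↦ s` on `ξ_v` and `ζ ↦ ζ ⊗ s`
on `H°_v`. -/
def leftVec (W : MinimalWords G) (v : V) (s : SylWord ξ) (h : IsReduced G (v :: s.word)) :
    H v →L[ℂ] GraphSpace ξ W :=
  (innerSL ℂ (ξ v)).smulRight (vec W s) + vecCons W v s h ∘L circProj (ξ v)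

theorem leftVec_apply {v : V} {s : SylWord ξ} (h : IsReduced G (v :: s.word)) (ζ : H v) :
    leftVec W v s h ζ = ⟪ξ v, ζ⟫_ℂ • vec W s + vec W (⟨v, circProj (ξ v) ζ⟩ :: s) := by
  rw [← vecCons_apply h]
  rfl

end Vectors

/-! ### The complement of the distinguished vector -/

section Circ

variable {H : Type*} [NormedAddCommGroup H] [InnerProductSpace ℂ H] {ξ : H}

theorem circProj_of_mem (ζ : circ ξ) : circProj ξ ζ = ζ := by
  simp [circProj]

theorem inner_circ (ζ : circ ξ) : ⟪ξ, (ζ : H)⟫_ℂ = 0 :=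
  (Submodule.mem_orthogonal_singleton_iff_inner_right.1 ζ.2)

theorem coe_circProj (hξ : ‖ξ‖ = 1) (x : H) : (circProj ξ x : H) = x - ⟪ξ, x⟫_ℂ • ξ := by
  rw [circProj]
  have h1 := Submodule.starProjection_orthogonal_val (K := (ℂ ∙ ξ)) (u := x)
  rw [Submodule.starProjection_unit_singleton ℂ hξ] at h1
  exact h1

theorem inner_self_of_norm_eq_one (hξ : ‖ξ‖ = 1) : ⟪ξ, ξ⟫_ℂ = 1 := by
  rw [inner_self_eq_norm_sq_to_K, hξ]; simp

theorem circProj_self (hξ : ‖ξ‖ = 1) : circProj ξ ξ = 0 := by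
  ext1
  rw [coe_circProj hξ, inner_self_of_norm_eq_one hξ]
  simp

variable {H' : Type*} [NormedAddCommGroup H'] [InnerProductSpace ℂ H'] {ξ' : H'}

/-- The restriction to the complements of the distinguished vectors of an isometry that respects
these. -/
def circIso (S : H →ₗᵢ[ℂ] H') (hS : S ξ = ξ') : circ ξ →ₗᵢ[ℂ] circ ξ' where
  toLinearMap := (S.toLinearMap.comp (circ ξ).subtype).codRestrict (circ ξ') fun ζ => by
    rw [Submodule.mem_orthogonal_singleton_iff_inner_right, ← hS]
    exact (S.inner_map_map _ _).trans (inner_circ ζ)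
  norm_map' ζ := S.norm_map ζ

theorem coe_circIso (S : H →ₗᵢ[ℂ] H') (hS : S ξ = ξ') (ζ : circ ξ) :
    (circIso S hS ζ : H') = S ζ := rfl

theorem circProj_circIso (S : H →ₗᵢ[ℂ] H') (hS : S ξ = ξ') (hξ : ‖ξ‖ = 1) (hξ' : ‖ξ'‖ = 1)
    (x : H) : circProj ξ' (S x) = circIso S hS (circProj ξ x) := by
  ext1
  rw [coe_circIso, coe_circProj hξ, coe_circProj hξ', map_sub, map_smul, hS]
  nth_rewrite 1 [← hS]
  rw [S.inner_map_map]

end Circ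

/-! ### The left action on decorated words -/

section LeftRep

variable {V : Type*} {H : V → Type*} [∀ v, NormedAddCommGroup (H v)]
  [∀ v, InnerProductSpace ℂ (H v)] {ξ : ∀ v, H v} {G : SimpleGraph V} {W : MinimalWords G}

theorem leftVec_self (hξ : ∀ v, ‖ξ v‖ = 1) {v : V} {s : SylWord ξ} (h : IsReduced G (v :: s.word)) :
    leftVec W v s h (ξ v) = vec W s := by
  rw [leftVec_apply, circProj_self (hξ v), inner_self_of_norm_eq_one (hξ v), ← vecCons_apply h]
  simp

theorem leftVec_coe {v : V} {s : SylWord ξ} (h : IsReduced G (v :: s.word)) (ζ : circ (ξ v)) :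
    leftVec W v s h ζ = vec W (⟨v, ζ⟩ :: s) := by
  rw [leftVec_apply, circProj_of_mem, inner_circ]
  simp

theorem SylEquiv.leftVec_eq {v : V} {s s' : SylWord ξ} (e : SylEquiv G s s')
    (h : IsReduced G (v :: s.word)) (h' : IsReduced G (v :: s'.word)) :
    leftVec W v s h = leftVec W v s' h' := by
  ext1 ζ
  rw [leftVec_apply, leftVec_apply, e.vec_eq]
  congr 1
  exact SylEquiv.vec_eq (TypeII.cons _ e _)

/-- The letter `v` can be split off on the left of every reduced word. -/
theorem exists_split_left (v : V) {s : SylWord ξ} (hs : IsReduced G s.word) :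
    ∃ s₀ : SylWord ξ, IsReduced G (v :: s₀.word) ∧
      (s = s₀ ∨ ∃ ζ, SylEquiv G s (⟨v, ζ⟩ :: s₀)) := by
  by_cases h : Reach G v s.word
  · obtain ⟨ζ, s', h'⟩ := exists_sylEquiv_cons_of_reach h
    exact ⟨s', h'.isReduced.1 hs, Or.inr ⟨ζ, h'⟩⟩
  · exact ⟨s, (isReduced_cons G v _).2 ⟨h, hs⟩, Or.inl rfl⟩

/-- On the range of each `leftVec` the operator λ_v(x) acts through x alone, so identities for λ_v
are checked there; these ranges contain all the spanning vectors. -/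
theorem exists_vec_eq_leftVec (hξ : ∀ v, ‖ξ v‖ = 1) (v : V) {s : SylWord ξ}
    (hs : IsReduced G s.word) :
    ∃ (s₀ : SylWord ξ) (h : IsReduced G (v :: s₀.word)) (ζ : H v),
      vec W s = leftVec W v s₀ h ζ := by
  obtain ⟨s₀, h, rfl | ⟨ζ, e⟩⟩ := exists_split_left v hs
  · exact ⟨s, h, ξ v, (leftVec_self hξ h).symm⟩
  · exact ⟨s₀, h, ζ, by rw [leftVec_coe, e.vec_eq]⟩

theorem clm_ext_leftVec (hξ : ∀ v, ‖ξ v‖ = 1) (v : V) {K : Type*} [NormedAddCommGroup K]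
    [NormedSpace ℂ K] {S T : GraphSpace ξ W →L[ℂ] K}
    (h : ∀ s (hs : IsReduced G (v :: s.word)) ζ,
      S (leftVec W v s hs ζ) = T (leftVec W v s hs ζ)) : S = T := by
  refine clm_ext_vec fun s hs => ?_
  obtain ⟨s₀, h₀, ζ, e⟩ := exists_vec_eq_leftVec hξ v hs
  rw [e]
  exact h _ _ _

theorem leftIsometry_apply (hξ : ∀ v, ‖ξ v‖ = 1) (v : V) (w : W.Left v) (x : H v)
    (η : WordSpace ξ w.1.1) :
    leftIsometry ξ W hξ v w (HilbertTensor₂.of (x ⊗ₜ[ℂ] η)) = leftBilin ξ W v w x η :=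
  HilbertTensor₂.liftIsometry_tmul _ _ _ _

open Classical in
theorem leftU_single (hξ : ∀ v, ‖ξ v‖ = 1) (v : V) (w : W.Left v) (x : H v)
    (η : WordSpace ξ w.1.1) :
    leftU ξ W hξ v (HilbertTensor₂.of
      (x ⊗ₜ[ℂ] (lp.single 2 w η : LeftSpace ξ W v))) = leftBilin ξ W v w x η := by
  have e : distribBilin ξ W v x (lp.single 2 w η : LeftSpace ξ W v) =
      lp.single 2 w (HilbertTensor₂.of (x ⊗ₜ[ℂ] η)) := by
    ext1
    funext w'
    change HilbertTensor₂.of (x ⊗ₜ[ℂ] (lp.single 2 w η : LeftSpace ξ W v) w') = _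
    by_cases h : w' = w
    · subst h
      rw [lp.single_apply_self, lp.single_apply_self]
    · rw [lp.single_apply_ne _ _ _ h, lp.single_apply_ne _ _ _ h, TensorProduct.tmul_zero, map_zero]
  rw [leftU, LinearIsometry.coe_comp, Function.comp_apply, HilbertTensor₂.liftIsometry_tmul, e,
    OrthogonalFamily.linearIsometry_apply_single, leftIsometry_apply]

theorem leftRep_leftU (hξ : ∀ v, ‖ξ v‖ = 1) (v : V) (x : H v →L[ℂ] H v) (ζ : H v)
    (η : LeftSpace ξ W v) :
    leftRep ξ W hξ v x (leftU ξ W hξ v (HilbertTensor₂.of (ζ ⊗ₜ[ℂ] η))) =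
      leftU ξ W hξ v (HilbertTensor₂.of (x ζ ⊗ₜ[ℂ] η)) := by
  have h : ∀ z, ContinuousLinearMap.adjoint (leftU ξ W hξ v).toContinuousLinearMap
      (leftU ξ W hξ v z) = z := fun z => by
    refine ext_inner_left ℂ fun y => ?_
    rw [ContinuousLinearMap.adjoint_inner_right]
    exact (leftU ξ W hξ v).inner_map_map y z
  rw [leftRep, ContinuousLinearMap.comp_apply, ContinuousLinearMap.comp_apply, h,
    HilbertTensor₂.ampl_tmul]
  rfl

/-- After s is replaced by an equivalent word whose letters form a minimal word, `leftVec` at ζ is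
U_v(ζ ⊗ s), where the definition of λ_v applies. Most later facts on `leftRep` rest on this formula
rather than on U_v. -/
theorem leftRep_leftVec (hξ : ∀ v, ‖ξ v‖ = 1) {v : V} (x : H v →L[ℂ] H v) {s : SylWord ξ}
    (h : IsReduced G (v :: s.word)) (ζ : H v) :
    leftRep ξ W hξ v x (leftVec W v s h ζ) = leftVec W v s h (x ζ) := by
  classical
  obtain ⟨s', hs', e⟩ := exists_sylEquiv_minimal W h.tail
  have h' : IsReduced G (v :: s'.word) := (isReduced_typeII G (TypeII.cons G e.word v)).1 h
  rw [e.leftVec_eq h h']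
  let w : W.Left v := ⟨⟨s'.word, hs'⟩, h'⟩
  have key : ∀ ζ, leftVec W v s' h' ζ = leftU ξ W hξ v (HilbertTensor₂.of
      (ζ ⊗ₜ[ℂ] (lp.single 2 w s'.tensor : LeftSpace ξ W v))) := by
    intro ζ
    rw [leftU_single, leftVec_apply, ← vecCons_apply h', vec_of_mem hs']
    rfl
  rw [key, key, leftRep_leftU]

theorem leftRep_vec_cons (hξ : ∀ v, ‖ξ v‖ = 1) {v : V} (x : H v →L[ℂ] H v) {s : SylWord ξ}
    (h : IsReduced G (v :: s.word)) (hx : ⟪ξ v, x (ξ v)⟫_ℂ = 0) :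
    leftRep ξ W hξ v x (vec W s) = vec W (⟨v, circProj (ξ v) (x (ξ v))⟩ :: s) := by
  rw [← leftVec_self hξ h, leftRep_leftVec, leftVec_apply, hx, zero_smul, zero_add]

theorem leftRep_mul (hξ : ∀ v, ‖ξ v‖ = 1) (v : V) (x y : H v →L[ℂ] H v) :
    leftRep ξ W hξ v (x * y) = leftRep ξ W hξ v x * leftRep ξ W hξ v y :=
  clm_ext_leftVec hξ v fun s hs ζ => by
    rw [mul_apply_eq_comp, leftRep_leftVec, leftRep_leftVec, leftRep_leftVec]
    rfl

theorem leftRep_one (hξ : ∀ v, ‖ξ v‖ = 1) (v : V) : leftRep ξ W hξ v 1 = 1 :=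
  clm_ext_leftVec hξ v fun s hs ζ => by rw [leftRep_leftVec]; rfl

theorem leftRep_add (hξ : ∀ v, ‖ξ v‖ = 1) (v : V) (x y : H v →L[ℂ] H v) :
    leftRep ξ W hξ v (x + y) = leftRep ξ W hξ v x + leftRep ξ W hξ v y :=
  clm_ext_leftVec hξ v fun s hs ζ => by
    rw [add_apply, leftRep_leftVec, leftRep_leftVec, leftRep_leftVec, ← map_add]
    rfl

theorem leftRep_smul (hξ : ∀ v, ‖ξ v‖ = 1) (v : V) (c : ℂ) (x : H v →L[ℂ] H v) :
    leftRep ξ W hξ v (c • x) = c • leftRep ξ W hξ v x :=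
  clm_ext_leftVec hξ v fun s hs ζ => by
    rw [smul_apply, leftRep_leftVec, leftRep_leftVec, ← map_smul]
    rfl

theorem HilbertTensor₂.clm_ext {E F K : Type*} [NormedAddCommGroup E] [InnerProductSpace ℂ E]
    [NormedAddCommGroup F] [InnerProductSpace ℂ F] [NormedAddCommGroup K] [NormedSpace ℂ K]
    {S T : HilbertTensor₂ E F →L[ℂ] K}
    (h : ∀ x y, S (HilbertTensor₂.of (x ⊗ₜ[ℂ] y)) = T (HilbertTensor₂.of (x ⊗ₜ[ℂ] y))) : S = T := by
  ext z
  refine HilbertTensor₂.denseRange_of.induction_on z (isClosed_eq S.continuous T.continuous) ?_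
  intro z
  induction z using TensorProduct.induction_on with
  | zero => simp only [map_zero]
  | add x y hx hy => simp only [map_add, hx, hy]
  | tmul x y => exact h x y

theorem HilbertTensor₂.adjoint_ampl {E F : Type*} [NormedAddCommGroup E] [InnerProductSpace ℂ E]
    [CompleteSpace E] [NormedAddCommGroup F] [InnerProductSpace ℂ F] (x : E →L[ℂ] E) :
    ContinuousLinearMap.adjoint (HilbertTensor₂.ampl F x) =
      HilbertTensor₂.ampl F (ContinuousLinearMap.adjoint x) := by
  refine HilbertTensor₂.clm_ext fun a b => ?_
  refine ext_inner_right ℂ fun z => ?_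
  rw [ContinuousLinearMap.adjoint_inner_left]
  suffices innerSL ℂ (HilbertTensor₂.of (a ⊗ₜ[ℂ] b)) ∘L HilbertTensor₂.ampl F x =
      innerSL ℂ (HilbertTensor₂.ampl F (ContinuousLinearMap.adjoint x)
        (HilbertTensor₂.of (a ⊗ₜ[ℂ] b))) from congrArg (fun f => f z) this
  refine HilbertTensor₂.clm_ext fun c d => ?_
  simp only [ContinuousLinearMap.comp_apply, innerSL_apply_apply, HilbertTensor₂.ampl_tmul,
    LinearIsometry.inner_map_map, TensorProduct.inner_tmul, ContinuousLinearMap.adjoint_inner_left]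

theorem adjoint_leftRep [∀ v, CompleteSpace (H v)] (hξ : ∀ v, ‖ξ v‖ = 1) (v : V)
    (x : H v →L[ℂ] H v) :
    ContinuousLinearMap.adjoint (leftRep ξ W hξ v x) =
      leftRep ξ W hξ v (ContinuousLinearMap.adjoint x) := by
  simp only [leftRep, ContinuousLinearMap.adjoint_comp, HilbertTensor₂.adjoint_ampl,
    ContinuousLinearMap.adjoint_adjoint]
  rfl

/-- Splitting off v and then w leaves a word s₁ with v w s₁ reduced. The vectors over s₁ form a copy
of H_v ⊗ H_w, because adjacent letters may be written in either order, and x and y act on different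
factors. -/
theorem leftRep_commute_of_adj (hξ : ∀ v, ‖ξ v‖ = 1) {v w : V} (hvw : G.Adj v w)
    (x : H v →L[ℂ] H v) (y : H w →L[ℂ] H w) :
    leftRep ξ W hξ v x * leftRep ξ W hξ w y = leftRep ξ W hξ w y * leftRep ξ W hξ v x := by
  refine clm_ext_vec fun s hs => ?_
  obtain ⟨s₀, h₀, e₀⟩ := exists_split_left v hs
  obtain ⟨s₁, h₁, e₁⟩ := exists_split_left w h₀.tail
  -- If w was split off, v is not reachable in s₁ either, since it could then be reached across the
  -- adjacent letter w.
  have hvs : IsReduced G (v :: s₁.word) := by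
    rcases e₁ with rfl | ⟨κ, e⟩
    · exact h₀
    · have := (isReduced_typeII G (TypeII.cons G e.word v)).1 h₀
      simp only [List.map_cons, isReduced_cons, Reach, not_or, not_and] at this ⊢
      exact ⟨this.1.2 hvw, this.2.2⟩
  have hvw' : IsReduced G (v :: w :: s₁.word) := by
    rw [isReduced_cons] at hvs ⊢
    refine ⟨?_, h₁⟩
    simp only [Reach, not_or, not_and]
    exact ⟨hvw.ne', fun _ => hvs.1⟩
  have hwv' : IsReduced G (w :: v :: s₁.word) :=
    (isReduced_stepII G (StepII.mk [] s₁.word v w hvw)).1 hvw'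
  -- Z ζ κ stands for ζ ⊗ κ ⊗ s₁, expressed by vectors on which λ_v acts; `hZ` expresses it by
  -- vectors on which λ_w acts.
  let Z : H v → H w → GraphSpace ξ W := fun ζ κ => ⟪ξ w, κ⟫_ℂ • leftVec W v s₁ hvs ζ +
    leftVec W v (⟨w, circProj (ξ w) κ⟩ :: s₁) hvw' ζ
  have hZ : ∀ ζ κ, Z ζ κ = ⟪ξ v, ζ⟫_ℂ • leftVec W w s₁ h₁ κ +
      leftVec W w (⟨v, circProj (ξ v) ζ⟩ :: s₁) hwv' κ := by
    intro ζ κ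
    simp only [Z, leftVec_apply, smul_add]
    have : vec W (⟨v, circProj (ξ v) ζ⟩ :: ⟨w, circProj (ξ w) κ⟩ :: s₁) =
        vec W (⟨w, circProj (ξ w) κ⟩ :: ⟨v, circProj (ξ v) ζ⟩ :: s₁) :=
      SylEquiv.vec_eq (.rel _ _ (StepII.mk [] s₁ _ _ (SimpleGraph.comap_adj.2 hvw)))
    rw [this, smul_comm (⟪ξ w, κ⟫_ℂ)]
    abel
  have h1 : ∀ ζ κ, leftRep ξ W hξ v x (Z ζ κ) = Z (x ζ) κ := by
    intro ζ κ
    simp only [Z, map_add, map_smul, leftRep_leftVec]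
  have h2 : ∀ ζ κ, leftRep ξ W hξ w y (Z ζ κ) = Z ζ (y κ) := by
    intro ζ κ
    simp only [hZ, map_add, map_smul, leftRep_leftVec]
  obtain ⟨ζ, κ, e⟩ : ∃ ζ κ, vec W s = Z ζ κ := by
    have key : ∃ κ, ∀ ζ, leftVec W v s₀ h₀ ζ = Z ζ κ := by
      rcases e₁ with rfl | ⟨κ, e⟩
      · refine ⟨ξ w, fun ζ => ?_⟩
        rw [hZ, leftVec_self hξ, leftVec_self hξ, leftVec_apply]
      · refine ⟨κ, fun ζ => ?_⟩
        simp only [Z, inner_circ, circProj_of_mem, zero_smul, zero_add]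
        rw [e.leftVec_eq h₀ hvw']
    obtain ⟨κ, hκ⟩ := key
    rcases e₀ with rfl | ⟨ζ, e⟩
    · exact ⟨ξ v, κ, by rw [← hκ, leftVec_self hξ]⟩
    · exact ⟨ζ, κ, by rw [← hκ, leftVec_coe, e.vec_eq]⟩
  rw [mul_apply_eq_comp, mul_apply_eq_comp, e, h2, h1, h1, h2]

end LeftRep

/-! ### Reversal of tensor factors and functoriality of the graph product space -/

section Functoriality

variable {V : Type*} {H : V → Type*} [∀ v, NormedAddCommGroup (H v)]
  [∀ v, InnerProductSpace ℂ (H v)] {ξ : ∀ v, H v} {G : SimpleGraph V} {W : MinimalWords G}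
  {H' : V → Type*} [∀ v, NormedAddCommGroup (H' v)]
  [∀ v, InnerProductSpace ℂ (H' v)] {ξ' : ∀ v, H' v}

/-- The words of a reversed or mapped list agree with the expected ones only propositionally;
comparing entries by position, as pairs, avoids transporting families along that equality. -/
theorem permute_tprod_congr {l l' u : List V} (e : l = l') (h : TypeII G l u) (h' : TypeII G l' u)
    {x : ∀ i : Fin l.length, circ (ξ (l.get i))} {y : ∀ i : Fin l'.length, circ (ξ (l'.get i))}
    (hxy : ∀ (i : Fin l.length) (j : Fin l'.length), (i : ℕ) = j →
      (⟨l.get i, x i⟩ : Σ v, circ (ξ v)) = ⟨l'.get j, y j⟩) :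
    permute ξ h (tprod x) = permute ξ h' (tprod y) := by
  subst e
  have : x = y := by
    funext i
    exact eq_of_heq (Sigma.mk.inj (hxy i i rfl)).2
  rw [this]

theorem getElem?_eq_family (s : SylWord ξ) (i : Fin s.word.length) (k : ℕ) (hk : k = i) :
    (some ⟨s.word.get i, s.family i⟩ : Option (Σ v, circ (ξ v))) = s[k]? := by
  subst hk
  exact (s.getElem?_eq i).symm

variable (ξ) in
/-- The reversal of tensor factors. -/
def revWord (l : List V) : WordSpace ξ l →ₗᵢ[ℂ] WordSpace ξ l.reverse :=
  have hl : ∀ i : Fin l.reverse.length, l.get ((finCongr List.length_reverse).trans Fin.revPerm i) =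
      l.reverse.get i := fun i => by
    simp [List.getElem_reverse, Fin.revPerm, Fin.val_rev, Nat.sub_sub, Nat.add_comm]
  HilbertTensor.liftIsometry (fun x => tprod fun i => castCirc ξ (hl i) (x _)) fun x y => by
    rw [inner_tprod]
    simp only [LinearIsometry.inner_map_map]
    exact ((finCongr List.length_reverse).trans Fin.revPerm).prod_comp fun i => ⟪x i, y i⟫_ℂ

theorem permute_revWord_tensor (s : SylWord ξ) {u : List V} (h : TypeII G s.word.reverse u)
    (h' : TypeII G (SylWord.word s.reverse) u) :
    permute ξ h (revWord ξ s.word s.tensor) = permute ξ h' (SylWord.tensor _) := by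
  rw [SylWord.tensor, revWord, HilbertTensor.liftIsometry_tprod]
  refine permute_tprod_congr List.map_reverse.symm h h' fun i j hij => ?_
  rw [castCirc_apply_of_eq]
  apply Option.some_injective
  rw [getElem?_eq_family s.reverse j j rfl, getElem?_eq_family s _ _ rfl]
  have hj : (j : ℕ) < s.length := by simpa using j.2
  rw [List.getElem?_reverse hj]
  congr 1
  simp [Fin.val_rev, hij, Nat.sub_sub, Nat.add_comm]

theorem orthogonalFamily_inclWord_comp {ι : Type*} {E : ι → Type*} [∀ i, NormedAddCommGroup (E i)]
    [∀ i, InnerProductSpace ℂ (E i)] (u : ι → W.carrier) (hu : Function.Injective u)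
    (f : ∀ i, E i →ₗᵢ[ℂ] WordSpace ξ (u i).1) :
    OrthogonalFamily ℂ E fun i => (inclWord ξ W (u i)).comp (f i) :=
  fun _ _ hij _ _ => inner_inclWord_of_ne ξ W (fun e => hij (hu e)) _ _

theorem rep_reverse_injective (W : MinimalWords G) : Function.Injective fun w : W.carrier =>
    W.rep w.1.reverse (isReduced_reverse (W.isReduced _ w.2)) := by
  intro w w' h
  have h1 := W.rep_typeII _ (isReduced_reverse (W.isReduced _ w.2))
  have h2 := W.rep_typeII _ (isReduced_reverse (W.isReduced _ w'.2))
  simp only at h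
  rw [← h] at h2
  have h3 : TypeII G w.1.reverse w'.1.reverse := Relation.EqvGen.trans _ _ _ h1 h2.symm
  have := h3.reverse
  rw [List.reverse_reverse, List.reverse_reverse] at this
  exact W.eq_of_typeII this

variable (ξ W) in
/-- The reversal of words on the graph product space. -/
def reversal : GraphSpace ξ W →ₗᵢ[ℂ] GraphSpace ξ W :=
  (orthogonalFamily_inclWord_comp (ξ := ξ) (E := fun w : W.carrier => WordSpace ξ w.1) _
    (rep_reverse_injective W) fun w => (permute ξ (W.rep_typeII _ _)).comp
      (revWord ξ w.1)).linearIsometry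

theorem inclWord_apply [DecidableEq W.carrier] (w : W.carrier) (z : WordSpace ξ w.1) :
    inclWord ξ W w z = lp.single 2 w z := by
  have h : ∀ d d' : DecidableEq W.carrier,
      @lp.single _ (fun w : W.carrier => WordSpace ξ w.1) _ d 2 w z =
        @lp.single _ (fun w : W.carrier => WordSpace ξ w.1) _ d' 2 w z := by
    intro d d'; congr!
  exact h _ _

theorem reversal_inclWord (w : W.carrier) (z : WordSpace ξ w.1) :
    reversal ξ W (inclWord ξ W w z) =
      inclWord ξ W (W.rep w.1.reverse (isReduced_reverse (W.isReduced _ w.2)))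
        (permute ξ (W.rep_typeII _ _) (revWord ξ w.1 z)) := by
  classical
  rw [inclWord_apply, reversal, OrthogonalFamily.linearIsometry_apply_single]
  rfl

theorem reversal_vec {s : SylWord ξ} (hs : IsReduced G s.word) :
    reversal ξ W (vec W s) = vec W s.reverse := by
  obtain ⟨s', h1, h2⟩ := exists_sylEquiv_minimal W hs
  rw [h2.vec_eq, SylEquiv.vec_eq (TypeII.reverse h2), vec_of_mem h1, reversal_inclWord]
  have h3 := W.rep_typeII _ (isReduced_reverse (W.isReduced _ h1))
  have h4 : TypeII G (SylWord.word s'.reverse) (W.rep _ (isReduced_reverse (W.isReduced _ h1))).1 := by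
    rw [SylWord.word, List.map_reverse]; exact h3
  rw [vec_eq_inclWord _ h4]
  exact congrArg _ (permute_revWord_tensor s' h3 h4)

theorem reversal_reversal (x : GraphSpace ξ W) : reversal ξ W (reversal ξ W x) = x := by
  have : (reversal ξ W).toContinuousLinearMap ∘L (reversal ξ W).toContinuousLinearMap =
      ContinuousLinearMap.id ℂ _ := clm_ext_vec fun s hs => by
    have hs' : IsReduced G (SylWord.word s.reverse) := by
      rw [SylWord.word, List.map_reverse]; exact isReduced_reverse hs
    change reversal ξ W (reversal ξ W _) = vec W s
    rw [reversal_vec hs, reversal_vec hs', List.reverse_reverse]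
  exact congrArg (fun f => f x) this

/-- The tensor product of isometries. -/
def mapWord (S : ∀ v, circ (ξ v) →ₗᵢ[ℂ] circ (ξ' v)) (l : List V) :
    WordSpace ξ l →ₗᵢ[ℂ] WordSpace ξ' l :=
  HilbertTensor.liftIsometry (fun x => tprod fun i => S _ (x i)) fun x y => by
    rw [inner_tprod]; simp only [LinearIsometry.inner_map_map]

theorem mapWord_tprod (S : ∀ v, circ (ξ v) →ₗᵢ[ℂ] circ (ξ' v)) (l : List V)
    (x : ∀ i : Fin l.length, circ (ξ (l.get i))) :
    mapWord S l (tprod x) = tprod fun i => S _ (x i) :=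
  HilbertTensor.liftIsometry_tprod _ _ x

variable (W) in
/-- The isometry between graph product spaces given by isometries between the vertex spaces that
respect the distinguished vectors. -/
def graphMap (S : ∀ v, H v →ₗᵢ[ℂ] H' v) (hS : ∀ v, S v (ξ v) = ξ' v) :
    GraphSpace ξ W →ₗᵢ[ℂ] GraphSpace ξ' W :=
  (orthogonalFamily_inclWord_comp (ξ := ξ') (E := fun w : W.carrier => WordSpace ξ w.1) id
    Function.injective_id fun w => mapWord (fun v => circIso (S v) (hS v)) w.1).linearIsometry

variable {S : ∀ v, H v →ₗᵢ[ℂ] H' v} {hS : ∀ v, S v (ξ v) = ξ' v}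

theorem graphMap_inclWord (w : W.carrier) (z : WordSpace ξ w.1) :
    graphMap W S hS (inclWord ξ W w z) =
      inclWord ξ' W w (mapWord (fun v => circIso (S v) (hS v)) w.1 z) := by
  classical
  rw [inclWord_apply, graphMap, OrthogonalFamily.linearIsometry_apply_single]
  rfl

theorem graphMap_vacuum : graphMap W S hS (vacuum ξ W) = vacuum ξ' W := by
  rw [vacuum, graphMap_inclWord, mapWord_tprod, vacuum]
  congr 2
  funext i
  exact i.elim0

/-- Apply isometries to all the syllables of a word. -/
abbrev SylWord.map (S : ∀ v, H v →ₗᵢ[ℂ] H' v) (hS : ∀ v, S v (ξ v) = ξ' v) (s : SylWord ξ) :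
    SylWord ξ' := List.map (Sigma.map id fun v => circIso (S v) (hS v)) s

theorem SylWord.word_map (s : SylWord ξ) : (s.map S hS).word = s.word := by
  simp only [SylWord.word, SylWord.map, List.map_map]
  rfl

theorem graphMap_vec {s : SylWord ξ} (hs : IsReduced G s.word) :
    graphMap W S hS (vec W s) = vec W (s.map S hS) := by
  obtain ⟨s', h1, h2⟩ := exists_sylEquiv_minimal W hs
  have h3 : SylEquiv G (s.map S hS) (s'.map S hS) := TypeII.map_comap _ _ _ (fun _ => rfl) h2
  have h5 : TypeII G s'.word s'.word := .refl _
  have h4 : TypeII G (s'.map S hS).word s'.word := TypeII.of_eq s'.word_map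
  rw [h2.vec_eq, h3.vec_eq, vec_of_mem h1, graphMap_inclWord,
    vec_eq_inclWord ⟨s'.word, h1⟩ h4, SylWord.tensor, mapWord_tprod]
  refine congrArg _ (Eq.trans (permute_self h5 _).symm ?_)
  refine permute_tprod_congr s'.word_map.symm h5 h4 fun i j hij => ?_
  apply Option.some_injective
  rw [getElem?_eq_family (s'.map S hS) j i hij, SylWord.map, List.getElem?_map,
    ← getElem?_eq_family s' i i rfl]
  rfl

theorem graphMap_reversal (x : GraphSpace ξ W) :
    graphMap W S hS (reversal ξ W x) = reversal ξ' W (graphMap W S hS x) := by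
  have : (graphMap W S hS).toContinuousLinearMap ∘L (reversal ξ W).toContinuousLinearMap =
      (reversal ξ' W).toContinuousLinearMap ∘L (graphMap W S hS).toContinuousLinearMap :=
    clm_ext_vec fun s hs => by
      have hs' : IsReduced G (SylWord.word s.reverse) := by
        rw [SylWord.word, List.map_reverse]; exact isReduced_reverse hs
      change graphMap W S hS (reversal ξ W _) = reversal ξ' W (graphMap W S hS _)
      rw [reversal_vec hs, graphMap_vec hs, graphMap_vec hs', reversal_vec (by rwa [SylWord.word_map]),
        SylWord.map, List.map_reverse]
  exact congrArg (fun f => f x) this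

theorem graphMap_leftVec (hξ : ∀ v, ‖ξ v‖ = 1) (hξ' : ∀ v, ‖ξ' v‖ = 1) {v : V} {s : SylWord ξ}
    (h : IsReduced G (v :: s.word)) (h' : IsReduced G (v :: (s.map S hS).word)) (ζ : H v) :
    graphMap W S hS (leftVec W v s h ζ) = leftVec W v (s.map S hS) h' (S v ζ) := by
  rw [leftVec_apply, leftVec_apply, map_add, map_smul, graphMap_vec h.tail,
    graphMap_vec (s := ⟨v, circProj (ξ v) ζ⟩ :: s) h, circProj_circIso (S v) (hS v) (hξ v) (hξ' v),
    show ⟪ξ' v, S v ζ⟫_ℂ = ⟪ξ v, ζ⟫_ℂ by rw [← (S v).inner_map_map, hS]]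
  rfl

/-- `graphMap` carries `leftVec` at ζ to `leftVec` at S_v ζ, and on these ranges the two actions are
given by x and x'. -/
theorem graphMap_leftRep (hξ : ∀ v, ‖ξ v‖ = 1) (hξ' : ∀ v, ‖ξ' v‖ = 1) {v : V}
    {x : H v →L[ℂ] H v} {x' : H' v →L[ℂ] H' v} (hx : ∀ ζ, S v (x ζ) = x' (S v ζ))
    (z : GraphSpace ξ W) :
    graphMap W S hS (leftRep ξ W hξ v x z) = leftRep ξ' W hξ' v x' (graphMap W S hS z) := by
  have : (graphMap W S hS).toContinuousLinearMap ∘L leftRep ξ W hξ v x =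
      leftRep ξ' W hξ' v x' ∘L (graphMap W S hS).toContinuousLinearMap :=
    clm_ext_leftVec hξ v fun s hs ζ => by
      have hs' : IsReduced G (v :: (s.map S hS).word) := by rwa [SylWord.word_map]
      change graphMap W S hS (leftRep ξ W hξ v x _) = leftRep ξ' W hξ' v x' (graphMap W S hS _)
      rw [leftRep_leftVec, graphMap_leftVec hξ hξ' hs hs', graphMap_leftVec hξ hξ' hs hs',
        leftRep_leftVec, hx]
  exact congrArg (fun f => f z) this

end Functoriality

/-! ### The right action and its commutation with the left action -/

section RightRep

variable {V : Type*} {H : V → Type*} [∀ v, NormedAddCommGroup (H v)]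
  [∀ v, InnerProductSpace ℂ (H v)] {ξ : ∀ v, H v} {G : SimpleGraph V} {W : MinimalWords G}
  {H' : V → Type*} [∀ v, NormedAddCommGroup (H' v)]
  [∀ v, InnerProductSpace ℂ (H' v)] {ξ' : ∀ v, H' v}

variable (ξ W) in
/-- The representation of `B(H_v)` that acts on the last tensor factors. -/
def rightRep (hξ : ∀ v, ‖ξ v‖ = 1) (v : V) (y : H v →L[ℂ] H v) :
    GraphSpace ξ W →L[ℂ] GraphSpace ξ W :=
  (reversal ξ W).toContinuousLinearMap ∘L leftRep ξ W hξ v y ∘L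
    (reversal ξ W).toContinuousLinearMap

theorem rightRep_apply (hξ : ∀ v, ‖ξ v‖ = 1) (v : V) (y : H v →L[ℂ] H v) (x : GraphSpace ξ W) :
    rightRep ξ W hξ v y x = reversal ξ W (leftRep ξ W hξ v y (reversal ξ W x)) := rfl

theorem graphMap_rightRep {S : ∀ v, H v →ₗᵢ[ℂ] H' v} {hS : ∀ v, S v (ξ v) = ξ' v}
    (hξ : ∀ v, ‖ξ v‖ = 1) (hξ' : ∀ v, ‖ξ' v‖ = 1) {v : V}
    {x : H v →L[ℂ] H v} {x' : H' v →L[ℂ] H' v} (hx : ∀ ζ, S v (x ζ) = x' (S v ζ))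
    (z : GraphSpace ξ W) :
    graphMap W S hS (rightRep ξ W hξ v x z) = rightRep ξ' W hξ' v x' (graphMap W S hS z) := by
  rw [rightRep_apply, rightRep_apply, graphMap_reversal, graphMap_leftRep hξ hξ' hx,
    graphMap_reversal]

theorem word_append_singleton_reverse (s : SylWord ξ) (v : V) :
    (s.word ++ [v]).reverse = v :: SylWord.word s.reverse := by
  simp [SylWord.word]

theorem isReduced_cons_reverse {v : V} {s : SylWord ξ} (h : IsReduced G (s.word ++ [v])) :
    IsReduced G (v :: SylWord.word s.reverse) := by
  rw [← word_append_singleton_reverse]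
  exact isReduced_reverse h

theorem isReduced_append_left {l : List V} {v : V} (h : IsReduced G (l ++ [v])) : IsReduced G l := by
  have := isReduced_reverse h
  rw [List.reverse_append, List.reverse_singleton, List.singleton_append] at this
  exact isReduced_reverse_iff.1 this.tail

/-- For a reduced word `s v`, the map `H_v → H` that is `ξ ↦ s` on `ξ_v` and `ζ ↦ s ⊗ ζ`
on `H°_v`. -/
def rightVec (W : MinimalWords G) (v : V) (s : SylWord ξ) (h : IsReduced G (s.word ++ [v])) :
    H v →L[ℂ] GraphSpace ξ W :=
  (reversal ξ W).toContinuousLinearMap ∘L leftVec W v s.reverse (isReduced_cons_reverse h)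

theorem rightVec_apply {v : V} {s : SylWord ξ} (h : IsReduced G (s.word ++ [v])) (ζ : H v) :
    rightVec W v s h ζ = ⟪ξ v, ζ⟫_ℂ • vec W s + vec W (s ++ [⟨v, circProj (ξ v) ζ⟩]) := by
  change reversal ξ W (leftVec W v s.reverse _ ζ) = _
  have h1 := isReduced_cons_reverse h
  rw [leftVec_apply, map_add, map_smul, reversal_vec h1.tail,
    reversal_vec (s := ⟨v, circProj (ξ v) ζ⟩ :: s.reverse) h1]
  simp

theorem rightRep_rightVec (hξ : ∀ v, ‖ξ v‖ = 1) {v : V} (y : H v →L[ℂ] H v) {s : SylWord ξ}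
    (h : IsReduced G (s.word ++ [v])) (ζ : H v) :
    rightRep ξ W hξ v y (rightVec W v s h ζ) = rightVec W v s h (y ζ) := by
  change reversal ξ W (leftRep ξ W hξ v y (reversal ξ W (reversal ξ W _))) = reversal ξ W _
  rw [reversal_reversal]
  exact congrArg _ (leftRep_leftVec hξ y _ ζ)

theorem rightVec_self (hξ : ∀ v, ‖ξ v‖ = 1) {v : V} {s : SylWord ξ}
    (h : IsReduced G (s.word ++ [v])) : rightVec W v s h (ξ v) = vec W s := by
  change reversal ξ W (leftVec W v s.reverse _ (ξ v)) = _
  have h1 := isReduced_cons_reverse h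
  rw [leftVec_self hξ, reversal_vec h1.tail, List.reverse_reverse]

theorem exists_split_right (v : V) {s : SylWord ξ} (hs : IsReduced G s.word) :
    ∃ s₀ : SylWord ξ, IsReduced G (s₀.word ++ [v]) ∧
      (s = s₀ ∨ ∃ ζ, SylEquiv G s (s₀ ++ [⟨v, ζ⟩])) := by
  have hs' : IsReduced G (SylWord.word s.reverse) := by
    rw [SylWord.word, List.map_reverse]; exact isReduced_reverse hs
  obtain ⟨s₀, h, h'⟩ := exists_split_left v hs'
  refine ⟨s₀.reverse, ?_, ?_⟩
  · rw [← isReduced_reverse_iff, word_append_singleton_reverse, List.reverse_reverse]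
    exact h
  · rcases h' with h' | ⟨ζ, e⟩
    · left; rw [← h', List.reverse_reverse]
    · right
      refine ⟨ζ, ?_⟩
      have := TypeII.reverse e
      rwa [List.reverse_reverse, List.reverse_cons] at this

/-- Split v off on the left and w off on the right, leaving s₁. If v s₁ w is reduced, the vectors
over s₁ form a copy of H_v ⊗ H_w and x, y act on different factors. Otherwise v = w is adjacent to
every letter of s₁; both operators act on one copy of H_v, and commutation of x and y themselves is
needed. -/
theorem leftRep_commute_rightRep (hξ : ∀ v, ‖ξ v‖ = 1) {v w : V}
    (x : H v →L[ℂ] H v) (y : H w →L[ℂ] H w)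
    (hxy : ∀ (e : w = v) (ζ : H v), x ((e ▸ y) ζ) = (e ▸ y : H v →L[ℂ] H v) (x ζ)) :
    leftRep ξ W hξ v x * rightRep ξ W hξ w y = rightRep ξ W hξ w y * leftRep ξ W hξ v x := by
  refine clm_ext_vec fun s hs => ?_
  rw [mul_apply_eq_comp, mul_apply_eq_comp]
  obtain ⟨s₀, h₀, e₀⟩ := exists_split_left v hs
  obtain ⟨s₁, h₁, e₁⟩ := exists_split_right w h₀.tail
  obtain ⟨ζ, hζ⟩ : ∃ ζ, vec W s = leftVec W v s₀ h₀ ζ := by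
    rcases e₀ with rfl | ⟨ζ, e⟩
    · exact ⟨ξ v, (leftVec_self hξ h₀).symm⟩
    · exact ⟨ζ, by rw [leftVec_coe, e.vec_eq]⟩
  rw [hζ]
  by_cases hvw : IsReduced G (v :: (s₁.word ++ [w]))
  · have hv : IsReduced G (v :: s₁.word) := isReduced_append_left hvw
    have hvw₁ : ∀ κ : circ (ξ w), IsReduced G (v :: SylWord.word (s₁ ++ [⟨w, κ⟩])) := fun κ => by
      simpa [SylWord.word] using hvw
    let Z : H v → H w → GraphSpace ξ W := fun ζ κ => ⟪ξ w, κ⟫_ℂ • leftVec W v s₁ hv ζ +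
      leftVec W v (s₁ ++ [⟨w, circProj (ξ w) κ⟩]) (hvw₁ _) ζ
    have hZ : ∀ ζ κ, Z ζ κ = ⟪ξ v, ζ⟫_ℂ • rightVec W w s₁ h₁ κ +
        rightVec W w (⟨v, circProj (ξ v) ζ⟩ :: s₁) hvw κ := by
      intro ζ κ
      simp only [Z, leftVec_apply, rightVec_apply, smul_add, List.cons_append]
      rw [smul_comm (⟪ξ w, κ⟫_ℂ)]
      abel
    have h1 : ∀ ζ κ, leftRep ξ W hξ v x (Z ζ κ) = Z (x ζ) κ := by
      intro ζ κ
      simp only [Z, map_add, map_smul, leftRep_leftVec]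
    have h2 : ∀ ζ κ, rightRep ξ W hξ w y (Z ζ κ) = Z ζ (y κ) := by
      intro ζ κ
      simp only [hZ, map_add, map_smul, rightRep_rightVec]
    obtain ⟨κ, hκ⟩ : ∃ κ, leftVec W v s₀ h₀ ζ = Z ζ κ := by
      rcases e₁ with rfl | ⟨κ, e⟩
      · refine ⟨ξ w, ?_⟩
        rw [hZ, rightVec_self hξ, rightVec_self hξ, leftVec_apply]
      · refine ⟨κ, ?_⟩
        simp only [Z, inner_circ, circProj_of_mem, zero_smul, zero_add]
        rw [e.leftVec_eq h₀ (hvw₁ _)]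
    rw [hκ, h2, h1, h1, h2]
  -- Had w really been split off, v s₁ w would be equivalent to the reduced word v s₀.
  · have hs₀ : s₀ = s₁ := by
      rcases e₁ with e | ⟨κ, e⟩
      · exact e
      · refine absurd ?_ hvw
        have := (isReduced_typeII G (TypeII.cons G e.word v)).1 h₀
        simpa [SylWord.word] using this
    subst hs₀
    rw [isReduced_cons, not_and'] at hvw
    obtain ⟨e, hadj⟩ := reach_append_singleton (not_not.1 (hvw h₁)) ((isReduced_cons G _ _).1 h₀).1
    subst e
    -- The new syllable is adjacent to all others and may stand at either end.
    have key : ∀ ζ, leftVec W w s₀ h₀ ζ = rightVec W w s₀ h₁ ζ := by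
      intro ζ
      rw [leftVec_apply, rightVec_apply, SylEquiv.vec_eq (typeII_cons_append Sigma.fst _ hadj)]
    rw [leftRep_leftVec, key, key, rightRep_rightVec, rightRep_rightVec, ← key, leftRep_leftVec,
      ← key, hxy rfl]

end RightRep

/-! ### Cyclicity of the vacuum vector -/

section Invariance

variable {V : Type*} {H : V → Type*} [∀ v, NormedAddCommGroup (H v)]
  [∀ v, InnerProductSpace ℂ (H v)] {ξ : ∀ v, H v} {G : SimpleGraph V} {W : MinimalWords G}

theorem reversal_vacuum : reversal ξ W (vacuum ξ W) = vacuum ξ W := by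
  rw [← vec_nil, reversal_vec (isReduced_nil G)]
  rfl

/-- The vacuum vector is cyclic for left actions for which the distinguished vectors are cyclic. -/
theorem mem_closure_of_leftRep (hξ : ∀ v, ‖ξ v‖ = 1) {D : ∀ v, Set (H v →L[ℂ] H v)}
    (hD : ∀ v ζ, ζ ∈ closure {k | ∃ y ∈ D v, y (ξ v) = k}) (Q : Submodule ℂ (GraphSpace ξ W))
    (h0 : vacuum ξ W ∈ Q) (hQ : ∀ v, ∀ y ∈ D v, ∀ k ∈ Q, leftRep ξ W hξ v y k ∈ Q)
    (x : GraphSpace ξ W) : x ∈ closure (Q : Set (GraphSpace ξ W)) := by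
  have hQ' : ∀ v, ∀ y ∈ D v, ∀ k ∈ closure (Q : Set (GraphSpace ξ W)),
      leftRep ξ W hξ v y k ∈ closure (Q : Set (GraphSpace ξ W)) := fun v y hy k hk =>
    map_mem_closure (leftRep ξ W hξ v y).continuous hk (hQ v y hy)
  refine mem_of_forall_vec_mem (P := Q.topologicalClosure)
    (Submodule.isClosed_topologicalClosure _) (fun s hs => ?_) x
  induction s with
  | nil => rw [vec_nil]; exact subset_closure h0
  | cons p s ih =>
    obtain ⟨v, ζ⟩ := p
    have hs' : IsReduced G (v :: SylWord.word s) := hs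
    rw [← leftVec_coe hs']
    -- By density it suffices to treat ζ = y ξ_v with y in D v, where `leftVec` is λ_v(y) applied to
    -- the vector of the shorter word.
    refine closure_minimal (s := {k | ∃ y ∈ D v, y (ξ v) = k})
      (t := leftVec W v s hs' ⁻¹' closure (Q : Set (GraphSpace ξ W))) ?_
      (isClosed_closure.preimage (leftVec W v s hs').continuous) (hD v ζ)
    rintro _ ⟨y, hy, rfl⟩
    rw [Set.mem_preimage, ← leftRep_leftVec hξ, leftVec_self hξ]
    exact hQ' v y hy _ (ih hs'.tail)

/-- Conjugation by the reversal, which fixes the vacuum, turns right actions into left ones. -/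
theorem mem_closure_of_rightRep (hξ : ∀ v, ‖ξ v‖ = 1) {D : ∀ v, Set (H v →L[ℂ] H v)}
    (hD : ∀ v ζ, ζ ∈ closure {k | ∃ y ∈ D v, y (ξ v) = k}) (Q : Submodule ℂ (GraphSpace ξ W))
    (h0 : vacuum ξ W ∈ Q) (hQ : ∀ v, ∀ y ∈ D v, ∀ k ∈ Q, rightRep ξ W hξ v y k ∈ Q)
    (x : GraphSpace ξ W) : x ∈ closure (Q : Set (GraphSpace ξ W)) := by
  have h := mem_closure_of_leftRep hξ hD (Q.comap (reversal ξ W).toLinearMap)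
    (show reversal ξ W (vacuum ξ W) ∈ Q by rwa [reversal_vacuum])
    (fun v y hy k hk => show reversal ξ W _ ∈ Q by
      have := hQ v y hy _ hk
      rw [rightRep_apply] at this
      rw [← reversal_reversal k]
      exact this) (reversal ξ W x)
  rw [← reversal_reversal x]
  exact map_mem_closure (reversal ξ W).continuous h fun k hk => hk

theorem inner_reversal_left (x y : GraphSpace ξ W) :
    ⟪reversal ξ W x, y⟫_ℂ = ⟪x, reversal ξ W y⟫_ℂ := by
  rw [← (reversal ξ W).inner_map_map, reversal_reversal]

theorem inner_rightRep_left [∀ v, CompleteSpace (H v)] (hξ : ∀ v, ‖ξ v‖ = 1) (v : V)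
    (y : H v →L[ℂ] H v) (x x' : GraphSpace ξ W) :
    ⟪rightRep ξ W hξ v (ContinuousLinearMap.adjoint y) x, x'⟫_ℂ =
      ⟪x, rightRep ξ W hξ v y x'⟫_ℂ := by
  rw [rightRep_apply, rightRep_apply, inner_reversal_left, ← adjoint_leftRep,
    ContinuousLinearMap.adjoint_inner_left, ← inner_reversal_left]

end Invariance

/-! ### Products of left operators -/

section LeftProd

variable {V : Type*} {H : V → Type*} [∀ v, NormedAddCommGroup (H v)]
  [∀ v, InnerProductSpace ℂ (H v)] {ξ : ∀ v, H v} {G : SimpleGraph V} {W : MinimalWords G}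
  {α : V → Type*}

variable (ξ W) in
/-- The product of the operators `λ_v(ρ_v(a))` for the members `(v, a)` of a list. -/
def leftProd (hξ : ∀ v, ‖ξ v‖ = 1) (ρ : ∀ v, α v → H v →L[ℂ] H v) (l : List (Σ v, α v)) :
    GraphSpace ξ W →L[ℂ] GraphSpace ξ W :=
  (l.map fun p => leftRep ξ W hξ p.1 (ρ p.1 p.2)).prod

variable (hξ : ∀ v, ‖ξ v‖ = 1) (ρ : ∀ v, α v → H v →L[ℂ] H v)

theorem leftProd_nil : leftProd ξ W hξ ρ [] = 1 := rfl

theorem leftProd_cons (p : Σ v, α v) (l : List (Σ v, α v)) :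
    leftProd ξ W hξ ρ (p :: l) = leftRep ξ W hξ p.1 (ρ p.1 p.2) * leftProd ξ W hξ ρ l := by
  simp only [leftProd, List.map_cons, List.prod_cons]

theorem leftProd_typeII {l l' : List (Σ v, α v)} (h : TypeII (G.comap Sigma.fst) l l') :
    leftProd ξ W hξ ρ l = leftProd ξ W hξ ρ l' := by
  induction h with
  | rel _ _ h =>
    obtain ⟨p, q, a, b, h⟩ := h
    simp only [leftProd, List.map_append, List.prod_append, List.map_cons, List.prod_cons]
    rw [← mul_assoc (leftRep ξ W hξ a.1 _), leftRep_commute_of_adj hξ (SimpleGraph.comap_adj.1 h),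
      mul_assoc]
  | refl => rfl
  | symm _ _ _ ih => exact ih.symm
  | trans _ _ _ _ _ ih1 ih2 => exact ih1.trans ih2

/-- A centered operator sends ξ_v into H°_v, so each factor of a reduced product only creates one
more syllable in front. -/
theorem leftProd_vacuum {l : List (Σ v, α v)} (hl : IsReduced G (l.map Sigma.fst))
    (hc : ∀ p ∈ l, ⟪ξ p.1, ρ p.1 p.2 (ξ p.1)⟫_ℂ = 0) :
    leftProd ξ W hξ ρ l (vacuum ξ W) =
      vec W (l.map (Sigma.map id fun v a => circProj (ξ v) (ρ v a (ξ v)))) := by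
  induction l with
  | nil => exact vec_nil.symm
  | cons p l ih =>
    have hl' : IsReduced G (p.1 :: SylWord.word
        (l.map (Sigma.map id fun v a => circProj (ξ v) (ρ v a (ξ v))))) := by
      rw [SylWord.word, List.map_map]
      exact hl
    rw [leftProd_cons, mul_apply_eq_comp, ih hl.tail fun q hq => hc q (List.mem_cons_of_mem _ hq),
      leftRep_vec_cons hξ _ hl' (hc p List.mem_cons_self)]
    rfl

/-- Maps that intertwine left actions intertwine products. -/
theorem leftProd_intertwine {H' : V → Type*} [∀ v, NormedAddCommGroup (H' v)]
    [∀ v, InnerProductSpace ℂ (H' v)] {ξ' : ∀ v, H' v} (hξ' : ∀ v, ‖ξ' v‖ = 1)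
    (ρ' : ∀ v, α v → H' v →L[ℂ] H' v) (j : GraphSpace ξ W → GraphSpace ξ' W)
    (hj : ∀ v a z, j (leftRep ξ W hξ v (ρ v a) z) = leftRep ξ' W hξ' v (ρ' v a) (j z))
    (l : List (Σ v, α v)) (z : GraphSpace ξ W) :
    j (leftProd ξ W hξ ρ l z) = leftProd ξ' W hξ' ρ' l (j z) := by
  induction l with
  | nil => rfl
  | cons p l ih => rw [leftProd_cons, leftProd_cons, mul_apply_eq_comp, mul_apply_eq_comp, hj, ih]

theorem exists_ofFn_sigma (l : List (Σ v, α v)) :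
    ∃ (w : List V) (a : ∀ i : Fin w.length, α (w.get i)),
      List.ofFn (fun i => (⟨w.get i, a i⟩ : Σ v, α v)) = l := by
  induction l with
  | nil => exact ⟨[], fun i => i.elim0, rfl⟩
  | cons p l ih =>
    obtain ⟨w, a, rfl⟩ := ih
    refine ⟨p.1 :: w, Fin.cases p.2 a, ?_⟩
    simp only [List.length_cons, List.ofFn_succ]
    rfl

end LeftProd

/-! ### Adjoints of maps between graph product spaces -/

section Adjoint

variable {V : Type*} {H : V → Type*} [∀ v, NormedAddCommGroup (H v)]
  [∀ v, InnerProductSpace ℂ (H v)] {ξ : ∀ v, H v} {G : SimpleGraph V} {W : MinimalWords G}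
  {H' : V → Type*} [∀ v, NormedAddCommGroup (H' v)]
  [∀ v, InnerProductSpace ℂ (H' v)] {ξ' : ∀ v, H' v}

/-- The hypothesis concerns minimal words; it passes to all reduced words because f changes no
letter and so respects commutation of syllables. -/
theorem map_vec_of_inclWord {P : GraphSpace ξ W → GraphSpace ξ' W}
    (f : ∀ v, circ (ξ v) → circ (ξ' v))
    (hP : ∀ (w : W.carrier) x, P (inclWord ξ W w (tprod x)) =
      inclWord ξ' W w (tprod fun i => f _ (x i))) {s : SylWord ξ} (hs : IsReduced G s.word) :
    P (vec W s) = vec W (List.map (Sigma.map id f) s) := by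
  obtain ⟨s', h1, h2⟩ := exists_sylEquiv_minimal W hs
  let m : SylWord ξ → SylWord ξ' := List.map (Sigma.map id f)
  have hw : ∀ s, (m s).word = s.word := fun s => by
    simp only [SylWord.word, m, List.map_map]
    rfl
  have h3 : SylEquiv G (m s) (m s') := TypeII.map_comap _ _ _ (fun _ => rfl) h2
  have h5 : TypeII G s'.word s'.word := .refl _
  have h4 : TypeII G (m s').word s'.word := TypeII.of_eq (hw s')
  change P (vec W s) = vec W (m s)
  rw [h2.vec_eq, h3.vec_eq, vec_of_mem h1, vec_eq_inclWord ⟨s'.word, h1⟩ h4, SylWord.tensor, hP]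
  refine congrArg _ (Eq.trans (permute_self h5 _).symm ?_)
  refine permute_tprod_congr (hw s').symm h5 h4 fun i j hij => ?_
  apply Option.some_injective
  rw [getElem?_eq_family (m s') j i hij, List.getElem?_map, ← getElem?_eq_family s' i i rfl]
  rfl

theorem ext_inner_inclWord {x y : GraphSpace ξ W}
    (h : ∀ (w : W.carrier) z, ⟪inclWord ξ W w (tprod z), x⟫_ℂ = ⟪inclWord ξ W w (tprod z), y⟫_ℂ) :
    x = y := by
  refine ext_inner_right ℂ fun z => ?_
  suffices e : innerSL ℂ x = innerSL ℂ y from congrArg (fun f => f z) e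
  refine clm_ext_vec fun s hs => ?_
  obtain ⟨s', h1, h2⟩ := exists_sylEquiv_minimal W hs
  rw [h2.vec_eq, vec_of_mem h1, SylWord.tensor, innerSL_apply_apply, innerSL_apply_apply,
    ← inner_conj_symm, h, inner_conj_symm]

/-- Since `graphMap` respects the summands, so does its adjoint; within a summand, inner products of
simple tensors factor and `hf` applies to each factor. -/
theorem adjoint_graphMap_inclWord {S : ∀ v, H v →ₗᵢ[ℂ] H' v} {hS : ∀ v, S v (ξ v) = ξ' v}
    (f : ∀ v, circ (ξ' v) → circ (ξ v))
    (hf : ∀ v (x : circ (ξ v)) (y : circ (ξ' v)), ⟪S v x, (y : H' v)⟫_ℂ = ⟪(x : H v), (f v y : H v)⟫_ℂ)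
    (w : W.carrier) (y : ∀ i : Fin w.1.length, circ (ξ' (w.1.get i))) :
    ContinuousLinearMap.adjoint (graphMap W S hS).toContinuousLinearMap
      (inclWord ξ' W w (tprod y)) = inclWord ξ W w (tprod fun i => f _ (y i)) := by
  refine ext_inner_inclWord fun w' x => ?_
  rw [ContinuousLinearMap.adjoint_inner_right]
  change ⟪graphMap W S hS _, _⟫_ℂ = _
  rw [graphMap_inclWord]
  by_cases h : w' = w
  · subst h
    rw [LinearIsometry.inner_map_map, LinearIsometry.inner_map_map, mapWord_tprod, inner_tprod,
      inner_tprod]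
    exact Finset.prod_congr rfl fun i _ => hf _ _ _
  · rw [inner_inclWord_of_ne _ _ h, inner_inclWord_of_ne _ _ h]

end Adjoint

/-! ### Amplifications, square roots and polar decomposition -/

section Operators

variable {H L : Type*} [NormedAddCommGroup H] [InnerProductSpace ℂ H] [CompleteSpace H]
  [NormedAddCommGroup L] [InnerProductSpace ℂ L] [CompleteSpace L]

/-- A bounded family of operators `L → H`, as an operator from `L` to the direct sum of copies
of `H`. -/
def lpColumn {I : Type*} (s : I → L →L[ℂ] H) (C : ℝ) (hC : 0 ≤ C)
    (h : ∀ e (F : Finset I), ∑ i ∈ F, ‖s i e‖ ^ 2 ≤ (C * ‖e‖) ^ 2) :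
    L →L[ℂ] lp (fun _ : I => H) 2 :=
  have h' : ∀ e (F : Finset I), ∑ i ∈ F, ‖s i e‖ ^ (2 : ENNReal).toReal ≤
      (C * ‖e‖) ^ (2 : ENNReal).toReal := fun e F => by
    simpa using h e F
  LinearMap.mkContinuous
    { toFun := fun e => ⟨fun i => s i e, memℓp_gen' (h' e)⟩
      map_add' := fun x y => by ext1; funext i; exact map_add (s i) x y
      map_smul' := fun c x => by ext1; funext i; exact map_smul (s i) c x } C
    fun e => lp.norm_le_of_forall_sum_le (by norm_num) (by positivity) (h' e)

/-- The operator `x ⊗ 1` on a direct sum of copies of `H`. -/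
def lpAmpl (I : Type*) (x : H →L[ℂ] H) : lp (fun _ : I => H) 2 →L[ℂ] lp (fun _ : I => H) 2 :=
  lpColumn (fun i => x ∘L lp.evalCLM ℂ (fun _ : I => H) 2 i) ‖x‖ (norm_nonneg x) fun e F => by
    have h1 := lp.sum_rpow_le_norm_rpow (p := 2) (by norm_num) e F
    simp only [ENNReal.toReal_ofNat, Real.rpow_ofNat] at h1
    calc ∑ i ∈ F, ‖x (e i)‖ ^ 2 ≤ ∑ i ∈ F, ‖x‖ ^ 2 * ‖e i‖ ^ 2 := by
          refine Finset.sum_le_sum fun i _ => ?_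
          rw [← mul_pow]
          exact pow_le_pow_left₀ (norm_nonneg _) (x.le_opNorm _) 2
      _ ≤ (‖x‖ * ‖e‖) ^ 2 := by
          rw [← Finset.mul_sum, mul_pow]
          gcongr

theorem lpAmpl_apply {I : Type*} (x : H →L[ℂ] H) (f : lp (fun _ : I => H) 2) (i : I) :
    lpAmpl I x f i = x (f i) := rfl

theorem adjoint_lpAmpl {I : Type*} (x : H →L[ℂ] H) :
    ContinuousLinearMap.adjoint (lpAmpl I x) = lpAmpl I (ContinuousLinearMap.adjoint x) := by
  refine ContinuousLinearMap.ext fun f => ext_inner_right ℂ fun g => ?_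
  rw [ContinuousLinearMap.adjoint_inner_left, lp.inner_eq_tsum, lp.inner_eq_tsum]
  refine tsum_congr fun i => ?_
  rw [lpAmpl_apply, lpAmpl_apply, ContinuousLinearMap.adjoint_inner_left]

theorem lpAmpl_single {I : Type*} [DecidableEq I] (x : H →L[ℂ] H) (i : I) (h : H) :
    lpAmpl I x (lp.single 2 i h) = lp.single 2 i (x h) := by
  ext1
  funext j
  rw [lpAmpl_apply]
  by_cases hj : j = i
  · subst hj
    rw [lp.single_apply_self, lp.single_apply_self]
  · rw [lp.single_apply_ne _ _ _ hj, lp.single_apply_ne _ _ _ hj, map_zero]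

/-- The projection onto a closed subspace commutes with the operators that, together with their
adjoints, leave the subspace invariant. -/
theorem starProjection_apply_commute (P : Submodule ℂ L) [P.HasOrthogonalProjection]
    (b : L →L[ℂ] L) (hb : ∀ x ∈ P, b x ∈ P)
    (hb' : ∀ x ∈ P, ContinuousLinearMap.adjoint b x ∈ P) (x : L) :
    P.starProjection (b x) = b (P.starProjection x) := by
  refine Submodule.eq_starProjection_of_mem_of_inner_eq_zero
    (hb _ (Submodule.starProjection_apply_mem _ _)) fun y hy => ?_
  rw [← map_sub, ← ContinuousLinearMap.adjoint_inner_right]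
  exact Submodule.starProjection_inner_eq_zero _ _ (hb' y hy)

/-- The absolute value of a bounded operator between Hilbert spaces. -/
theorem exists_absoluteValue (T : H →L[ℂ] L) : ∃ a : H →L[ℂ] H,
    (∀ x, ‖a x‖ = ‖T x‖) ∧
    ∀ b : H →L[ℂ] H, Commute (ContinuousLinearMap.adjoint T ∘L T) b → Commute a b := by
  have hp : 0 ≤ ContinuousLinearMap.adjoint T ∘L T :=
    (ContinuousLinearMap.nonneg_iff_isPositive _).2 (ContinuousLinearMap.isPositive_adjoint_comp_self T)
  refine ⟨CFC.sqrt (ContinuousLinearMap.adjoint T ∘L T), fun x => ?_, fun b hb => ?_⟩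
  · have hs : IsSelfAdjoint (CFC.sqrt (ContinuousLinearMap.adjoint T ∘L T)) :=
      (CFC.sqrt_nonneg _).isSelfAdjoint
    have h1 := CFC.sqrt_mul_sqrt_self _ hp
    have h2 : ⟪CFC.sqrt (ContinuousLinearMap.adjoint T ∘L T) x,
        CFC.sqrt (ContinuousLinearMap.adjoint T ∘L T) x⟫_ℂ = ⟪T x, T x⟫_ℂ := by
      rw [← ContinuousLinearMap.adjoint_inner_right, ← ContinuousLinearMap.star_eq_adjoint, hs.star_eq,
        ← mul_apply_eq_comp, h1, ContinuousLinearMap.comp_apply, ContinuousLinearMap.adjoint_inner_right]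
    simp only [inner_self_eq_norm_sq_to_K] at h2
    exact (sq_eq_sq₀ (norm_nonneg _) (norm_nonneg _)).1 (by exact_mod_cast h2)
  -- The square root belongs to the functional calculus of T^* T, so it commutes with whatever T^* T
  -- commutes with.
  · exact Commute.cfcₙ_nnreal hb _

/-- The square root of `‖y‖² - y^* y`. -/
theorem exists_defect (y : H →L[ℂ] H) : ∃ z : H →L[ℂ] H,
    (∀ h h', ⟪z h, z h'⟫_ℂ = (‖y‖ : ℂ) ^ 2 * ⟪h, h'⟫_ℂ - ⟪y h, y h'⟫_ℂ) ∧
    ∀ b, Commute y b → Commute (star y) b → Commute z b := by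
  have hp : 0 ≤ algebraMap ℝ (H →L[ℂ] H) (‖y‖ ^ 2) - star y * y :=
    sub_nonneg.2 CStarAlgebra.star_mul_le_algebraMap_norm_sq
  refine ⟨CFC.sqrt (algebraMap ℝ (H →L[ℂ] H) (‖y‖ ^ 2) - star y * y), fun h h' => ?_,
    fun b hb hb' => ?_⟩
  · have hs : IsSelfAdjoint (CFC.sqrt (algebraMap ℝ (H →L[ℂ] H) (‖y‖ ^ 2) - star y * y)) :=
      (CFC.sqrt_nonneg _).isSelfAdjoint
    rw [← ContinuousLinearMap.adjoint_inner_right, ← ContinuousLinearMap.star_eq_adjoint, hs.star_eq,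
      ← mul_apply_eq_comp, CFC.sqrt_mul_sqrt_self _ hp, sub_apply, inner_sub_right, mul_apply_eq_comp,
      ContinuousLinearMap.star_eq_adjoint, ContinuousLinearMap.adjoint_inner_right,
      Algebra.algebraMap_eq_smul_one, smul_apply, one_apply_eq_self]
    rw [show (‖y‖ ^ 2 : ℝ) • h' = ((‖y‖ : ℂ) ^ 2) • h' by
      rw [← Complex.coe_smul]; push_cast; rfl, inner_smul_right]
  · exact Commute.cfcₙ_nnreal (Commute.sub_left (Algebra.commutes _ b) (hb'.mul_left hb)) _

/-- The partial isometry in the polar decomposition of the adjoint of `T`. -/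
theorem exists_polar (T : H →L[ℂ] L) : ∃ (u : L →L[ℂ] H) (a : H →L[ℂ] H),
    (∀ h, u (T h) = a h) ∧ (∀ e, (∀ h, ⟪T h, e⟫_ℂ = 0) → u e = 0) ∧ (∀ h, ‖a h‖ = ‖T h‖) ∧
    ∀ b : H →L[ℂ] H, Commute (ContinuousLinearMap.adjoint T ∘L T) b → Commute a b := by
  obtain ⟨a, ha, hac⟩ := exists_absoluteValue T
  let P : Submodule ℂ L := (LinearMap.range T.toLinearMap).topologicalClosure
  have hP : IsClosed (P : Set L) := Submodule.isClosed_topologicalClosure _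
  have : CompleteSpace P := hP.completeSpace_coe
  have hT : ∀ h, T h ∈ P := fun h => Submodule.le_topologicalClosure _ ⟨h, rfl⟩
  let T' : H →ₗ[ℂ] P := T.toLinearMap.codRestrict P hT
  have hd : DenseRange T' := by
    intro x
    rw [closure_subtype]
    have := x.2
    change (x : L) ∈ closure _ at this
    convert this using 2
    ext y
    constructor
    · rintro ⟨_, ⟨h, rfl⟩, rfl⟩
      exact ⟨h, rfl⟩
    · rintro ⟨h, rfl⟩
      exact ⟨T' h, ⟨h, rfl⟩, rfl⟩
  -- As ‖a h‖ = ‖T h‖, the assignment T h ↦ a h is well defined and bounded; u is its extension to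
  -- the closure P of the range, and zero on the complement.
  have hb : ∀ h, ‖a.toLinearMap h‖ ≤ 1 * ‖T' h‖ := fun h => by
    rw [one_mul]; exact (ha h).le
  refine ⟨(a.toLinearMap.extendOfNorm T') ∘L P.orthogonalProjectionOnto, a, fun h => ?_,
    fun e he => ?_, ha, hac⟩
  · have : P.orthogonalProjectionOnto (T h) = T' h :=
      Submodule.orthogonalProjectionOnto_mem_subspace_eq_self (T' h)
    rw [ContinuousLinearMap.comp_apply, this, LinearMap.extendOfNorm_eq hd ⟨1, hb⟩]
    rfl
  · have : P.orthogonalProjectionOnto e = 0 := by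
      rw [Submodule.orthogonalProjectionOnto_eq_zero_iff, Submodule.mem_orthogonal]
      intro y hy
      have hc : IsClosed {y : L | ⟪y, e⟫_ℂ = 0} := isClosed_eq (by fun_prop) (by fun_prop)
      refine closure_minimal (s := (LinearMap.range T.toLinearMap : Set L)) ?_ hc hy
      rintro _ ⟨h, rfl⟩
      exact he h
    rw [ContinuousLinearMap.comp_apply, this, map_zero]

end Operators

/-! ### Maximal systems of intertwining partial isometries, and density in the double commutant -/

section Intertwiners

variable {H L : Type*} [NormedAddCommGroup H] [InnerProductSpace ℂ H] [CompleteSpace H]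
  [NormedAddCommGroup L] [InnerProductSpace ℂ L] [CompleteSpace L]

open ContinuousLinearMap (adjoint adjoint_inner_left adjoint_inner_right)

/-- A family of nonzero partial isometries with pairwise orthogonal initial spaces that intertwine
the pairs of operators in `𝒢`. -/
structure IsOrthogonalSystem (𝒢 : Set ((H →L[ℂ] H) × (L →L[ℂ] L))) (𝒮 : Set (L →L[ℂ] H)) : Prop where
  intertwines : ∀ s ∈ 𝒮, ∀ p ∈ 𝒢, ∀ e, s (p.2 e) = p.1 (s e)
  ne_zero : ∀ s ∈ 𝒮, s ≠ 0
  partialIsometry : ∀ s ∈ 𝒮, ∀ e, s (adjoint s (s e)) = s e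
  orthogonal : ∀ s ∈ 𝒮, ∀ s' ∈ 𝒮, s ≠ s' → ∀ h, s (adjoint s' h) = 0

variable {𝒢 : Set ((H →L[ℂ] H) × (L →L[ℂ] L))} {𝒮 : Set (L →L[ℂ] H)}

/-- Bessel's inequality: w = ∑ s^* s e is the projection of e onto the sum of finitely many initial
spaces, and 0 ≤ ‖e - w‖² = ‖e‖² - ∑ ‖s e‖². The factor 1 is the constant expected by `lpColumn`. -/
theorem IsOrthogonalSystem.sum_le (h𝒮 : IsOrthogonalSystem 𝒢 𝒮) (e : L) (F : Finset 𝒮) :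
    ∑ s ∈ F, ‖s.1 e‖ ^ 2 ≤ (1 * ‖e‖) ^ 2 := by
  classical
  let w : L := ∑ s ∈ F, adjoint s.1 (s.1 e)
  have h1 : ∀ s ∈ F, s.1 w = s.1 e := by
    intro s hs
    rw [map_sum, Finset.sum_eq_single s, h𝒮.partialIsometry s.1 s.2]
    · intro s' _ hne
      exact h𝒮.orthogonal _ s.2 _ s'.2 (fun e => hne (Subtype.ext e.symm)) _
    · exact fun h => absurd hs h
  -- Used for y = e and for y = w, giving ⟪w, e⟫ and ‖w‖².
  have h2 : ∀ y, (∀ s ∈ F, s.1 y = s.1 e) → ⟪w, y⟫_ℂ = ((∑ s ∈ F, ‖s.1 e‖ ^ 2 : ℝ) : ℂ) := by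
    intro y hy
    rw [sum_inner]
    push_cast
    refine Finset.sum_congr rfl fun s hs => ?_
    rw [adjoint_inner_left, hy s hs, inner_self_eq_norm_sq_to_K]
    rfl
  have h3 := h2 e fun _ _ => rfl
  have h4 := h2 w h1
  have h5 : ‖e - w‖ ^ 2 = ‖e‖ ^ 2 - ∑ s ∈ F, ‖s.1 e‖ ^ 2 := by
    have h6 : ‖w‖ ^ 2 = ∑ s ∈ F, ‖s.1 e‖ ^ 2 := by
      rw [inner_self_eq_norm_sq_to_K] at h4
      refine Complex.ofReal_injective (Eq.trans ?_ h4)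
      push_cast
      rfl
    rw [@norm_sub_sq ℂ, ← inner_conj_symm, h3, h6, Complex.conj_ofReal]
    simp only [RCLike.re_to_complex, Complex.ofReal_re]
    ring
  rw [one_mul]
  nlinarith [sq_nonneg ‖e - w‖]

/-- Zorn's lemma applies because each condition involves at most two partial isometries, which lie
in a common member of a chain. -/
theorem exists_maximal_orthogonalSystem (𝒢 : Set ((H →L[ℂ] H) × (L →L[ℂ] L))) :
    ∃ 𝒮, Maximal (IsOrthogonalSystem 𝒢) 𝒮 := by
  obtain ⟨𝒮, h⟩ := zorn_subset {𝒮 | IsOrthogonalSystem 𝒢 𝒮} fun c hc hchain => by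
    refine ⟨⋃₀ c, ⟨?_, ?_, ?_, ?_⟩, fun s hs => Set.subset_sUnion_of_mem hs⟩
    · rintro s ⟨t, ht, hs⟩
      exact (hc ht).intertwines s hs
    · rintro s ⟨t, ht, hs⟩
      exact (hc ht).ne_zero s hs
    · rintro s ⟨t, ht, hs⟩
      exact (hc ht).partialIsometry s hs
    · rintro s ⟨t, ht, hs⟩ s' ⟨t', ht', hs'⟩ hne
      rcases hchain.total ht ht' with hle | hle
      · exact (hc ht').orthogonal s (hle hs) s' hs' hne
      · exact (hc ht).orthogonal s hs s' (hle hs') hne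
  exact ⟨𝒮, h⟩

/-- Given a star-closed set of pairs of operators on `H` and `L`, there is an intertwining operator
from `L` to a sum of copies of `H` that is isometric on the ranges of all the intertwiners
from `H` to `L`. -/
theorem exists_intertwining_column (h𝒢 : ∀ p ∈ 𝒢, (adjoint p.1, adjoint p.2) ∈ 𝒢) :
    ∃ (𝒮 : Set (L →L[ℂ] H)) (J : L →L[ℂ] lp (fun _ : 𝒮 => H) 2),
      (∀ i, ∀ p ∈ 𝒢, ∀ e, J (p.2 e) i = p.1 (J e i)) ∧
      ∀ t : H →L[ℂ] L, (∀ p ∈ 𝒢, ∀ h, t (p.1 h) = p.2 (t h)) →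
        ∀ h, adjoint J (J (t h)) = t h := by
  classical
  obtain ⟨𝒮, hmax⟩ := exists_maximal_orthogonalSystem 𝒢
  have h𝒮 := hmax.prop
  let J : L →L[ℂ] lp (fun _ : 𝒮 => H) 2 := lpColumn (fun s => s.1) 1 zero_le_one h𝒮.sum_le
  refine ⟨𝒮, J, fun i p hp e => h𝒮.intertwines i i.2 p hp e, fun t ht => ?_⟩
  -- P will be the closed span of the initial spaces of 𝒮. As J^* J fixes P, it is enough that every
  -- intertwiner takes its values in P.
  let P₀ : Submodule ℂ L := Submodule.span ℂ {e | ∃ s ∈ 𝒮, ∃ h, adjoint s h = e}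
  let P : Submodule ℂ L := P₀.topologicalClosure
  have hP : IsClosed (P : Set L) := Submodule.isClosed_topologicalClosure _
  have : CompleteSpace P := hP.completeSpace_coe
  have hmem : ∀ s ∈ 𝒮, ∀ h, adjoint s h ∈ P := fun s hs h =>
    Submodule.le_topologicalClosure _ (Submodule.subset_span ⟨s, hs, h, rfl⟩)
  have hext : ∀ Q : Submodule ℂ L, IsClosed (Q : Set L) → (∀ s ∈ 𝒮, ∀ h, adjoint s h ∈ Q) →
      P ≤ Q := fun Q hQ h => by
    refine Submodule.topologicalClosure_minimal _ (Submodule.span_le.2 ?_) hQ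
    rintro _ ⟨s, hs, h', rfl⟩
    exact h s hs h'
  have hJP : ∀ e ∈ P, adjoint J (J e) = e := by
    have hker := hext (LinearMap.ker (adjoint J ∘L J - ContinuousLinearMap.id ℂ L).toLinearMap)
      (ContinuousLinearMap.isClosed_ker (adjoint J ∘L J - ContinuousLinearMap.id ℂ L)) ?_
    · intro e he
      simpa [sub_eq_zero] using hker he
    · intro s hs h
      have : adjoint J (J (adjoint s h)) = adjoint s h := by
        refine ext_inner_right ℂ fun e => ?_
        rw [adjoint_inner_left, lp.inner_eq_tsum, tsum_eq_single ⟨s, hs⟩]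
        · change ⟪s (adjoint s h), s e⟫_ℂ = _
          rw [← adjoint_inner_right, adjoint_inner_left, adjoint_inner_left,
            h𝒮.partialIsometry s hs]
        · intro s' hne
          change ⟪s'.1 (adjoint s h), s'.1 e⟫_ℂ = 0
          rw [h𝒮.orthogonal _ s'.2 _ hs (fun e => hne (Subtype.ext e)), inner_zero_left]
      simpa [sub_eq_zero] using this
  have hinv : ∀ p ∈ 𝒢, ∀ e ∈ P, p.2 e ∈ P := by
    intro p hp
    refine hext (P.comap p.2.toLinearMap) (hP.preimage p.2.continuous) fun s hs h => ?_
    have : p.2 (adjoint s h) = adjoint s (p.1 h) := by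
      refine ext_inner_left ℂ fun e => ?_
      rw [← adjoint_inner_left, adjoint_inner_right, adjoint_inner_right,
        h𝒮.intertwines s hs _ (h𝒢 p hp), adjoint_inner_left]
    rw [Submodule.mem_comap]
    exact this ▸ hmem s hs _
  suffices h : ∀ h, t h ∈ P from fun h' => hJP _ (h h')
  by_contra hcon
  push Not at hcon
  obtain ⟨h₀, hh₀⟩ := hcon
  -- If t leaves P, cut it down to the complement. The projection commutes with the generators, so q
  -- ∘ t is a nonzero intertwiner, and the partial isometry from its polar decomposition enlarges 𝒮.
  let q : L →L[ℂ] L := ContinuousLinearMap.id ℂ L - P.starProjection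
  have hq : ∀ p ∈ 𝒢, ∀ e, q (p.2 e) = p.2 (q e) := by
    intro p hp e
    simp only [q, sub_apply, ContinuousLinearMap.id_apply, map_sub]
    rw [starProjection_apply_commute P p.2 (hinv p hp) (hinv _ (h𝒢 p hp))]
  have hqP : ∀ e, ∀ x ∈ P, ⟪q e, x⟫_ℂ = 0 := fun e x hx =>
    Submodule.starProjection_inner_eq_zero _ _ hx
  let T : H →L[ℂ] L := q ∘L t
  have hT : ∀ p ∈ 𝒢, ∀ h, T (p.1 h) = p.2 (T h) := fun p hp h => by
    simp only [T, ContinuousLinearMap.comp_apply, ht p hp, hq p hp]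
  have hT₀ : T h₀ ≠ 0 := by
    intro h
    refine hh₀ ?_
    have : t h₀ = P.starProjection (t h₀) := sub_eq_zero.1 h
    rw [this]
    exact Submodule.starProjection_apply_mem _ _
  obtain ⟨u, a, hu, hu', ha, hac⟩ := exists_polar T
  have hTadj : ∀ p ∈ 𝒢, ∀ e, adjoint T (p.2 e) = p.1 (adjoint T e) := by
    intro p hp e
    refine ext_inner_left ℂ fun h => ?_
    rw [adjoint_inner_right, ← adjoint_inner_left, ← hT _ (h𝒢 p hp), ← adjoint_inner_right,
      adjoint_inner_left]
  have hacp : ∀ p ∈ 𝒢, ∀ h, a (p.1 h) = p.1 (a h) := by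
    intro p hp h
    have : Commute a p.1 := hac _ (ContinuousLinearMap.ext fun h => by
      simp only [mul_apply_eq_comp, ContinuousLinearMap.comp_apply, hT p hp, hTadj p hp])
    exact congrArg (fun f => f h) this
  let Q : Submodule ℂ L := (LinearMap.range T.toLinearMap).topologicalClosure
  have hQ : IsClosed (Q : Set L) := Submodule.isClosed_topologicalClosure _
  have : CompleteSpace Q := hQ.completeSpace_coe
  have hTQ : ∀ h, T h ∈ Q := fun h => Submodule.le_topologicalClosure _ ⟨h, rfl⟩
  have hQind : ∀ Q' : Submodule ℂ L, IsClosed (Q' : Set L) → (∀ h, T h ∈ Q') → Q ≤ Q' := by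
    intro Q' hQ' h
    refine Submodule.topologicalClosure_minimal _ ?_ hQ'
    rintro _ ⟨h', rfl⟩
    exact h h'
  have huQ : ∀ e, u e = u (Q.starProjection e) := by
    intro e
    rw [← sub_eq_zero, ← map_sub]
    refine hu' _ fun h => ?_
    rw [← inner_conj_symm, Submodule.starProjection_inner_eq_zero _ _ (hTQ h), map_zero]
  have huu : ∀ e, adjoint u (u e) = Q.starProjection e := by
    -- By polarization of ‖a h‖ = ‖T h‖ and by continuity, u is isometric on the closure Q of the
    -- range of T; hence u^* u is the projection onto Q.
    have h1 : ∀ e ∈ Q, ∀ e' ∈ Q, ⟪u e, u e'⟫_ℂ = ⟪e, e'⟫_ℂ := by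
      have h0 : ∀ h h', ⟪a h, a h'⟫_ℂ = ⟪T h, T h'⟫_ℂ := by
        intro h h'
        rw [inner_eq_sum_norm_sq_div_four, inner_eq_sum_norm_sq_div_four (T h)]
        simp only [← map_smul, ← map_add, ← map_sub, ha]
      intro e he e' he'
      have hc : IsClosed {z : L × L | ⟪u z.1, u z.2⟫_ℂ = ⟪z.1, z.2⟫_ℂ} :=
        isClosed_eq (by fun_prop) (by fun_prop)
      have := closure_minimal (s := (LinearMap.range T.toLinearMap : Set L) ×ˢ
        (LinearMap.range T.toLinearMap : Set L)) ?_ hc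
      · rw [closure_prod_eq] at this
        exact this (Set.mk_mem_prod he he')
      · rintro ⟨_, _⟩ ⟨⟨h, rfl⟩, ⟨h', rfl⟩⟩
        change ⟪u (T h), u (T h')⟫_ℂ = ⟪T h, T h'⟫_ℂ
        rw [hu, hu, h0]
    intro e
    refine ext_inner_right ℂ fun e' => ?_
    rw [adjoint_inner_left, huQ e, huQ e', h1 _ (Submodule.starProjection_apply_mem _ _) _
      (Submodule.starProjection_apply_mem _ _), ← sub_eq_zero, ← inner_sub_right,
      ← inner_conj_symm, ← neg_sub, inner_neg_left,
      Submodule.starProjection_inner_eq_zero _ _ (Submodule.starProjection_apply_mem _ _)]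
    simp
  have huint : ∀ p ∈ 𝒢, ∀ e, u (p.2 e) = p.1 (u e) := by
    intro p hp e
    have hinvQ : ∀ p ∈ 𝒢, ∀ e ∈ Q, p.2 e ∈ Q := fun p hp =>
      hQind (Q.comap p.2.toLinearMap) (hQ.preimage p.2.continuous) fun h => by
        rw [Submodule.mem_comap]
        exact (hT p hp h) ▸ hTQ _
    rw [huQ, huQ e, starProjection_apply_commute Q p.2 (hinvQ p hp) (hinvQ _ (h𝒢 p hp))]
    -- On the range of T the relation u T = a reduces the claim to a commuting with the generators;
    -- it passes to the closure.
    have hker : Q ≤ LinearMap.ker (u ∘L p.2 - p.1 ∘L u).toLinearMap := by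
      refine hQind _ (ContinuousLinearMap.isClosed_ker (u ∘L p.2 - p.1 ∘L u)) fun h => ?_
      change u (p.2 (T h)) - p.1 (u (T h)) = 0
      rw [← hT p hp, hu, hu, hacp p hp, sub_self]
    exact sub_eq_zero.1 (hker (Submodule.starProjection_apply_mem Q e))
  have hu0 : u ≠ 0 := by
    rintro rfl
    have := hu h₀
    rw [zero_apply] at this
    have h2 := ha h₀
    rw [← this, norm_zero] at h2
    exact hT₀ (norm_eq_zero.1 h2.symm)
  have hpi : ∀ e, u (adjoint u (u e)) = u e := fun e => by rw [huu, ← huQ]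
  have horth : ∀ s ∈ 𝒮, ∀ h, u (adjoint s h) = 0 := fun s hs h =>
    hu' _ fun h' => hqP _ _ (hmem s hs h)
  have horth' : ∀ s ∈ 𝒮, ∀ h, s (adjoint u h) = 0 := fun s hs h => by
    refine ext_inner_left ℂ fun k => ?_
    rw [← adjoint_inner_left, adjoint_inner_right, horth s hs, inner_zero_left, inner_zero_right]
  have hnew : IsOrthogonalSystem 𝒢 (insert u 𝒮) := by
    refine ⟨?_, ?_, ?_, ?_⟩
    · rintro s (rfl | hs)
      exacts [huint, h𝒮.intertwines s hs]
    · rintro s (rfl | hs)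
      exacts [hu0, h𝒮.ne_zero s hs]
    · rintro s (rfl | hs)
      exacts [hpi, h𝒮.partialIsometry s hs]
    · rintro s (rfl | hs) s' (rfl | hs') hne
      exacts [absurd rfl hne, horth s' hs', horth' s hs, h𝒮.orthogonal s hs s' hs' hne]
  -- Maximality puts u into 𝒮, but u vanishes on the initial space of every member of 𝒮, now
  -- including its own; so u = u u^* u = 0.
  have hmemu : u ∈ 𝒮 := hmax.le_of_ge hnew (Set.subset_insert _ _) (Set.mem_insert _ _)
  refine hu0 (ContinuousLinearMap.ext fun e => ?_)
  rw [← hpi e, horth u hmemu]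
  rfl

/-- Density of a unital algebra `𝒜` in the double commutant of a star-closed set of generators,
in the strong topology on a sum of copies of `H`. -/
theorem lpAmpl_mem_closure {I : Type*} (X : Set (H →L[ℂ] H)) (hX : ∀ g ∈ X, adjoint g ∈ X)
    (𝒜 : Submodule ℂ (H →L[ℂ] H)) (h1 : 1 ∈ 𝒜) (hmul : ∀ g ∈ X, ∀ m ∈ 𝒜, g * m ∈ 𝒜)
    {x : H →L[ℂ] H} (hx : ∀ y, (∀ g ∈ X, g * y = y * g) → x * y = y * x)
    (ζ : lp (fun _ : I => H) 2) :
    lpAmpl I x ζ ∈ closure {z | ∃ m ∈ 𝒜, lpAmpl I m ζ = z} := by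
  classical
  have hadd : ∀ m m' : H →L[ℂ] H, lpAmpl I (m + m') ζ = lpAmpl I m ζ + lpAmpl I m' ζ := by
    intro m m'; ext1; funext i; rfl
  have hsmul : ∀ (c : ℂ) (m : H →L[ℂ] H), lpAmpl I (c • m) ζ = c • lpAmpl I m ζ := by
    intro c m; ext1; funext i; rfl
  -- This is (𝒜 ⊗ 1) ζ. Its invariance under the amplified generators only needs 𝒜 to be stable
  -- under left multiplication by them.
  let P₀ : Submodule ℂ (lp (fun _ : I => H) 2) :=
    { carrier := {z | ∃ m ∈ 𝒜, lpAmpl I m ζ = z}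
      add_mem' := by
        rintro _ _ ⟨m, hm, rfl⟩ ⟨m', hm', rfl⟩
        exact ⟨m + m', 𝒜.add_mem hm hm', hadd _ _⟩
      zero_mem' := ⟨0, 𝒜.zero_mem, by ext1; funext i; rfl⟩
      smul_mem' := by
        rintro c _ ⟨m, hm, rfl⟩
        exact ⟨c • m, 𝒜.smul_mem c hm, hsmul _ _⟩ }
  let P := P₀.topologicalClosure
  have hP : IsClosed (P : Set (lp (fun _ : I => H) 2)) := Submodule.isClosed_topologicalClosure _
  have : CompleteSpace P := hP.completeSpace_coe
  have hinv : ∀ g ∈ X, ∀ e ∈ P, lpAmpl I g e ∈ P := by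
    intro g hg
    refine Submodule.topologicalClosure_minimal (t := P.comap (lpAmpl I g).toLinearMap) _ ?_
      (hP.preimage (lpAmpl I g).continuous)
    rintro _ ⟨m, hm, rfl⟩
    refine Submodule.le_topologicalClosure _ ⟨g * m, hmul g hg m hm, ?_⟩
    ext1; funext i; rfl
  have hcomm : ∀ g ∈ X, ∀ e, P.starProjection (lpAmpl I g e) = lpAmpl I g (P.starProjection e) := by
    intro g hg e
    refine starProjection_apply_commute P _ (hinv g hg) (fun x hx => ?_) e
    rw [adjoint_lpAmpl]
    exact hinv _ (hX g hg) x hx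
  have hxc : P.starProjection ∘L lpAmpl I x = lpAmpl I x ∘L P.starProjection := by
    refine lp.ext_continuousLinearMap ENNReal.ofNat_ne_top fun j => ContinuousLinearMap.ext fun h => ?_
    simp only [ContinuousLinearMap.comp_apply, lp.singleContinuousLinearMap_apply, lpAmpl_single]
    ext1
    funext i
    -- The matrix entries of the projection commute with the generators, hence with x. So x ⊗ 1
    -- commutes with the projection and leaves P, which contains ζ, invariant.
    let y : H →L[ℂ] H := lp.evalCLM ℂ (fun _ : I => H) 2 i ∘L P.starProjection ∘L
      lp.singleContinuousLinearMap ℂ (fun _ : I => H) 2 j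
    have hy := hx y fun g hg => ContinuousLinearMap.ext fun h => by
      have := congrArg (fun f => f i) (hcomm g hg (lp.single 2 j h))
      rw [lpAmpl_single] at this
      exact this.symm
    exact (congrArg (fun f => f h) hy).symm
  have hζ : ζ ∈ P := Submodule.le_topologicalClosure _ ⟨1, h1, by ext1; funext i; rfl⟩
  have := congrArg (fun f => f ζ) hxc
  simp only [ContinuousLinearMap.comp_apply] at this
  rw [Submodule.starProjection_eq_self_iff.2 hζ] at this
  exact Submodule.starProjection_eq_self_iff.1 this

theorem inner_lpAmpl_eq_zero {I : Type*} (X : Set (H →L[ℂ] H)) (hX : ∀ g ∈ X, adjoint g ∈ X)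
    (𝒜 : Submodule ℂ (H →L[ℂ] H)) (h1 : 1 ∈ 𝒜) (hmul : ∀ g ∈ X, ∀ m ∈ 𝒜, g * m ∈ 𝒜)
    {x : H →L[ℂ] H} (hx : ∀ y, (∀ g ∈ X, g * y = y * g) → x * y = y * x)
    (ζ κ : lp (fun _ : I => H) 2) (h : ∀ m ∈ 𝒜, ⟪κ, lpAmpl I m ζ⟫_ℂ = 0) :
    ⟪κ, lpAmpl I x ζ⟫_ℂ = 0 := by
  have hc : IsClosed {z : lp (fun _ : I => H) 2 | ⟪κ, z⟫_ℂ = 0} :=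
    isClosed_eq (by fun_prop) (by fun_prop)
  refine closure_minimal ?_ hc (lpAmpl_mem_closure X hX 𝒜 h1 hmul hx ζ)
  rintro _ ⟨m, hm, rfl⟩
  exact h m hm

end Intertwiners

/-! ### The Stinespring dilation of a ucp map -/

section Dilation

variable {H K : Type*} [NormedAddCommGroup H] [InnerProductSpace ℂ H] [CompleteSpace H]
  [NormedAddCommGroup K] [InnerProductSpace ℂ K] [CompleteSpace K]
  {M : VonNeumannAlgebra H} {N : VonNeumannAlgebra K} {φ : VN M →ₗ[ℂ] VN N}

open ContinuousLinearMap (adjoint adjoint_inner_left adjoint_inner_right)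

/-- The Stinespring form is summed over finite supports, so complete positivity is transported from
`Fin n` to arbitrary finite index sets. -/
theorem IsUCP.sum_nonneg (hφ : IsUCP φ) {α : Type*} (F : Finset α) (c : α → α → VN M)
    (hc : ∀ h : α → H, 0 ≤ ∑ a ∈ F, ∑ b ∈ F, ⟪h a, (c a b : H →L[ℂ] H) (h b)⟫_ℂ) (k : α → K) :
    0 ≤ ∑ a ∈ F, ∑ b ∈ F, ⟪k a, (φ (c a b) : K →L[ℂ] K) (k b)⟫_ℂ := by
  classical
  let e : Fin F.card ≃ F := F.equivFin.symm
  have key : ∀ f : α → α → ℂ, ∑ a ∈ F, ∑ b ∈ F, f a b = ∑ i, ∑ j, f (e i) (e j) := by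
    intro f
    rw [← Finset.sum_coe_sort F, ← e.sum_comp]
    refine Finset.sum_congr rfl fun i _ => ?_
    rw [← Finset.sum_coe_sort F, ← e.sum_comp]
  rw [key]
  refine hφ.2 F.card (fun i j => c (e i) (e j)) (fun x => ?_) fun i => k (e i)
  have := hc fun a => if h : a ∈ F then x (e.symm ⟨a, h⟩) else 0
  rw [key] at this
  simpa using this

/-- The algebraic Stinespring space of a ucp map. -/
def PreDilation (_ : IsUCP φ) : Type _ := VN M →₀ K

variable (hφ : IsUCP φ)

instance : AddCommGroup (PreDilation hφ) := inferInstanceAs (AddCommGroup (VN M →₀ K))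
instance : Module ℂ (PreDilation hφ) := inferInstanceAs (Module ℂ (VN M →₀ K))

/-- The form `⟪a ⊗ k, b ⊗ l⟫ = ⟪k, φ(a^* b) l⟫`. -/
def dilationForm (φ : VN M →ₗ[ℂ] VN N) (x y : VN M →₀ K) : ℂ :=
  x.sum fun a k => y.sum fun b l => ⟪k, (φ (star a * b) : K →L[ℂ] K) l⟫_ℂ

theorem dilationForm_add_left (x x' y : VN M →₀ K) :
    dilationForm φ (x + x') y = dilationForm φ x y + dilationForm φ x' y :=
  Finsupp.sum_add_index' (fun a => by simp) fun a k k' => by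
    simp only [inner_add_left, Finsupp.sum_add]

theorem dilationForm_smul_left (c : ℂ) (x y : VN M →₀ K) :
    dilationForm φ (c • x) y = star c * dilationForm φ x y := by
  refine (Finsupp.sum_smul_index' (fun a => by simp)).trans ?_
  simp only [dilationForm, inner_smul_left, Finsupp.sum, Finset.mul_sum]
  rfl

theorem dilationForm_add_right (x y y' : VN M →₀ K) :
    dilationForm φ x (y + y') = dilationForm φ x y + dilationForm φ x y' := by
  rw [dilationForm, dilationForm, dilationForm, ← Finsupp.sum_add]
  refine Finsupp.sum_congr fun a _ => ?_
  exact Finsupp.sum_add_index' (fun a => by simp) fun b l l' => by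
    simp only [map_add, inner_add_right]

theorem dilationForm_smul_right (c : ℂ) (x y : VN M →₀ K) :
    dilationForm φ x (c • y) = c * dilationForm φ x y := by
  rw [dilationForm, dilationForm, Finsupp.sum, Finsupp.sum, Finset.mul_sum]
  refine Finset.sum_congr rfl fun a _ => ?_
  refine (Finsupp.sum_smul_index' (fun a => by simp)).trans ?_
  simp only [map_smul, inner_smul_right, Finsupp.sum, Finset.mul_sum]

theorem dilationForm_single (a b : VN M) (k l : K) :
    dilationForm φ (Finsupp.single a k) (Finsupp.single b l) =
      ⟪k, (φ (star a * b) : K →L[ℂ] K) l⟫_ℂ := by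
  rw [dilationForm, Finsupp.sum_single_index (by simp), Finsupp.sum_single_index (by simp)]

/-- The matrix (a^* b) is positive, its form at h being ‖∑ a h_a‖², and φ preserves positivity of
matrices. -/
theorem dilationForm_self_nonneg (hφ : IsUCP φ) (x : VN M →₀ K) : 0 ≤ dilationForm φ x x := by
  refine hφ.sum_nonneg x.support (fun a b => star a * b) (fun h => ?_) x
  have : ∑ a ∈ x.support, ∑ b ∈ x.support, ⟪h a, ((star a * b : VN M) : H →L[ℂ] H) (h b)⟫_ℂ =
      ⟪∑ a ∈ x.support, (a : H →L[ℂ] H) (h a), ∑ a ∈ x.support, (a : H →L[ℂ] H) (h a)⟫_ℂ := by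
    simp only [sum_inner, inner_sum]
    refine Finset.sum_comm.trans (Finset.sum_congr rfl fun b _ => Finset.sum_congr rfl fun a _ => ?_)
    rw [← adjoint_inner_right]
    rfl
  rw [this, inner_self_eq_norm_sq_to_K]
  positivity

/-- Hermitian symmetry follows from positivity by polarization, as the form is real at x, y, x + y
and x + i y. That φ respects adjoints need not be proved separately. -/
theorem conj_dilationForm (hφ : IsUCP φ) (x y : VN M →₀ K) :
    star (dilationForm φ y x) = dilationForm φ x y := by
  have h1 := (Complex.nonneg_iff.1 (dilationForm_self_nonneg hφ (x + y))).2
  have h2 := (Complex.nonneg_iff.1 (dilationForm_self_nonneg hφ (x + Complex.I • y))).2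
  have h3 := (Complex.nonneg_iff.1 (dilationForm_self_nonneg hφ x)).2
  have h4 := (Complex.nonneg_iff.1 (dilationForm_self_nonneg hφ y)).2
  simp only [dilationForm_add_left, dilationForm_add_right, dilationForm_smul_left,
    dilationForm_smul_right, Complex.add_im, Complex.add_re, Complex.mul_im, Complex.mul_re, Complex.star_def,
    Complex.conj_I, Complex.neg_re, Complex.neg_im, Complex.I_re, Complex.I_im] at h1 h2
  refine Complex.ext ?_ ?_
  · simp only [Complex.star_def, Complex.conj_re]
    linarith
  · simp only [Complex.star_def, Complex.conj_im]
    linarith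

/-- The Stinespring form, as a positive semidefinite form. -/
@[reducible] def dilationCore : PreInnerProductSpace.Core ℂ (PreDilation hφ) where
  inner := dilationForm φ
  conj_inner_symm x y := conj_dilationForm hφ x y
  re_inner_nonneg x := (Complex.nonneg_iff.1 (dilationForm_self_nonneg hφ x)).1
  add_left x y z := dilationForm_add_left x y z
  smul_left x y r := dilationForm_smul_left r x y

instance : SeminormedAddCommGroup (PreDilation hφ) :=
  @InnerProductSpace.Core.toSeminormedAddCommGroup ℂ _ _ _ _ (dilationCore hφ)
instance : InnerProductSpace ℂ (PreDilation hφ) := InnerProductSpace.ofCore (dilationCore hφ)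

/-- The Stinespring space of a ucp map. -/
def Dilation : Type _ := UniformSpace.Completion (PreDilation hφ)

instance : NormedAddCommGroup (Dilation hφ) :=
  inferInstanceAs (NormedAddCommGroup (UniformSpace.Completion (PreDilation hφ)))
instance : InnerProductSpace ℂ (Dilation hφ) :=
  inferInstanceAs (InnerProductSpace ℂ (UniformSpace.Completion (PreDilation hφ)))
instance : CompleteSpace (Dilation hφ) :=
  inferInstanceAs (CompleteSpace (UniformSpace.Completion (PreDilation hφ)))

/-- The canonical map to the Stinespring space. -/
def Dilation.of : PreDilation hφ →ₗᵢ[ℂ] Dilation hφ :=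
  (UniformSpace.Completion.toComplₗᵢ :
    PreDilation hφ →ₗᵢ[ℂ] UniformSpace.Completion (PreDilation hφ))

/-- The vector `a ⊗ k`. -/
def Dilation.tmul (a : VN M) (k : K) : Dilation hφ := Dilation.of hφ (Finsupp.single a k)

theorem Dilation.inner_tmul (a b : VN M) (k l : K) :
    ⟪Dilation.tmul hφ a k, Dilation.tmul hφ b l⟫_ℂ = ⟪k, (φ (star a * b) : K →L[ℂ] K) l⟫_ℂ :=
  ((Dilation.of hφ).inner_map_map _ _).trans (dilationForm_single a b k l)

theorem Dilation.clm_ext {F : Type*} [NormedAddCommGroup F] [NormedSpace ℂ F]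
    {S T : Dilation hφ →L[ℂ] F} (h : ∀ a k, S (tmul hφ a k) = T (tmul hφ a k)) : S = T := by
  ext x
  have hd : DenseRange (Dilation.of hφ) := UniformSpace.Completion.denseRange_coe
  refine hd.induction_on x (isClosed_eq S.continuous T.continuous) fun x => ?_
  have h' : (S.toLinearMap ∘ₗ (Dilation.of hφ).toLinearMap : (VN M →₀ K) →ₗ[ℂ] F) =
      T.toLinearMap ∘ₗ (Dilation.of hφ).toLinearMap :=
    Finsupp.lhom_ext fun a k => h a k
  exact congrArg (fun f => f x) h'

/-- A linear map on the algebraic Stinespring space that is bounded extends to the Stinespring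
space. -/
theorem Dilation.exists_extension (f : (VN M →₀ K) →ₗ[ℂ] (VN M →₀ K)) (C : ℝ) (hC : 0 ≤ C)
    (h : ∀ x, 0 ≤ (C : ℂ) ^ 2 * dilationForm φ x x - dilationForm φ (f x) (f x)) :
    ∃ T : Dilation hφ →L[ℂ] Dilation hφ, ∀ x, T (Dilation.of hφ x) = Dilation.of hφ (f x) := by
  let f' : PreDilation hφ →ₗ[ℂ] PreDilation hφ := f
  have hb : ∀ x : PreDilation hφ, ‖f' x‖ ≤ C * ‖x‖ := by
    intro x
    refine (sq_le_sq₀ (norm_nonneg _) (mul_nonneg hC (norm_nonneg _))).1 ?_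
    have h1 := (Complex.nonneg_iff.1 (h x)).1
    have e1 : dilationForm φ x x = ((‖x‖ ^ 2 : ℝ) : ℂ) := by
      have := inner_self_eq_norm_sq_to_K (𝕜 := ℂ) x
      push_cast
      exact this
    have e2 : dilationForm φ (f x) (f x) = ((‖f' x‖ ^ 2 : ℝ) : ℂ) := by
      have := inner_self_eq_norm_sq_to_K (𝕜 := ℂ) (f' x)
      push_cast
      exact this
    rw [e1, e2, ← Complex.ofReal_pow, ← Complex.ofReal_mul, ← Complex.ofReal_sub,
      Complex.ofReal_re] at h1
    rw [mul_pow]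
    linarith
  let g : PreDilation hφ →L[ℂ] Dilation hφ :=
    (Dilation.of hφ).toContinuousLinearMap ∘L f'.mkContinuous C hb
  exact ⟨(g.fromCompletion : UniformSpace.Completion (PreDilation hφ) →L[ℂ] Dilation hφ),
    fun x => ContinuousLinearMap.fromCompletion_apply_coe g x⟩

/-- Left multiplication by x is bounded by ‖x‖ because the matrix ‖x‖² a^* b - (x a)^* (x b) is
positive: its form at h is ‖x‖² ‖g‖² - ‖x g‖² with g = ∑ a h_a. -/
theorem exists_dilationRep (x : VN M) : ∃ T : Dilation hφ →L[ℂ] Dilation hφ,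
    ∀ a k, T (Dilation.tmul hφ a k) = Dilation.tmul hφ (x * a) k := by
  let f : (VN M →₀ K) →ₗ[ℂ] (VN M →₀ K) := Finsupp.lmapDomain K ℂ (x * ·)
  obtain ⟨T, hT⟩ := Dilation.exists_extension hφ f ‖(x : H →L[ℂ] H)‖ (norm_nonneg _) fun y => by
    have e : dilationForm φ (f y) (f y) =
        y.sum fun a k => y.sum fun b l => ⟪k, (φ (star (x * a) * (x * b)) : K →L[ℂ] K) l⟫_ℂ := by
      change dilationForm φ (Finsupp.mapDomain _ y) (Finsupp.mapDomain _ y) = _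
      rw [dilationForm, Finsupp.sum_mapDomain_index (by simp)
        (fun a k k' => by simp only [inner_add_left, Finsupp.sum_add])]
      refine Finsupp.sum_congr fun a _ => ?_
      rw [Finsupp.sum_mapDomain_index (by simp)
        (fun b l l' => by simp only [map_add, inner_add_right])]
    have := hφ.sum_nonneg y.support (fun a b => ((‖(x : H →L[ℂ] H)‖ : ℂ) ^ 2) • (star a * b) -
      star (x * a) * (x * b)) (fun h => ?_) y
    · rw [e, dilationForm]
      convert this using 1
      simp only [Finsupp.sum, Finset.mul_sum, map_sub, map_smul]
      rw [← Finset.sum_sub_distrib]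
      refine Finset.sum_congr rfl fun a _ => ?_
      rw [← Finset.sum_sub_distrib]
      refine Finset.sum_congr rfl fun b _ => ?_
      rw [← inner_smul_right, ← inner_sub_right]
      rfl
    · have e : ∑ a ∈ y.support, ∑ b ∈ y.support, ⟪h a,
          ((((‖(x : H →L[ℂ] H)‖ : ℂ) ^ 2) • (star a * b) - star (x * a) * (x * b) : VN M) :
            H →L[ℂ] H) (h b)⟫_ℂ =
          ((‖(x : H →L[ℂ] H)‖ : ℂ) ^ 2) * ⟪∑ a ∈ y.support, (a : H →L[ℂ] H) (h a),
            ∑ a ∈ y.support, (a : H →L[ℂ] H) (h a)⟫_ℂ -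
          ⟪(x : H →L[ℂ] H) (∑ a ∈ y.support, (a : H →L[ℂ] H) (h a)),
            (x : H →L[ℂ] H) (∑ a ∈ y.support, (a : H →L[ℂ] H) (h a))⟫_ℂ := by
        simp only [map_sum, sum_inner, inner_sum, Finset.mul_sum]
        rw [Finset.sum_comm, ← Finset.sum_sub_distrib]
        refine Finset.sum_congr rfl fun b _ => ?_
        rw [← Finset.sum_sub_distrib]
        refine Finset.sum_congr rfl fun a _ => ?_
        rw [← adjoint_inner_right (a : H →L[ℂ] H), ← inner_smul_right,
          ← mul_apply_eq_comp (x : H →L[ℂ] H) (a : H →L[ℂ] H),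
          ← adjoint_inner_right ((x : H →L[ℂ] H) * (a : H →L[ℂ] H)), ← inner_sub_right]
        rfl
      rw [e, inner_self_eq_norm_sq_to_K, inner_self_eq_norm_sq_to_K]
      have h1 := (x : H →L[ℂ] H).le_opNorm (∑ a ∈ y.support, (a : H →L[ℂ] H) (h a))
      have h2 := pow_le_pow_left₀ (norm_nonneg _) h1 2
      rw [mul_pow] at h2
      have h3 := Complex.real_le_real.2 h2
      push_cast at h3
      exact sub_nonneg.2 h3
  refine ⟨T, fun a k => ?_⟩
  exact (hT _).trans (congrArg _ Finsupp.mapDomain_single)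

/-- The Stinespring representation. -/
def dilationRep (x : VN M) : Dilation hφ →L[ℂ] Dilation hφ := (exists_dilationRep hφ x).choose

theorem dilationRep_tmul (x a : VN M) (k : K) :
    dilationRep hφ x (Dilation.tmul hφ a k) = Dilation.tmul hφ (x * a) k :=
  (exists_dilationRep hφ x).choose_spec a k

theorem adjoint_dilationRep (x : VN M) : adjoint (dilationRep hφ x) = dilationRep hφ (star x) := by
  refine Dilation.clm_ext hφ fun a k => ext_inner_right ℂ fun z => ?_
  suffices innerSL ℂ (Dilation.tmul hφ a k) ∘L dilationRep hφ x =
      innerSL ℂ (dilationRep hφ (star x) (Dilation.tmul hφ a k)) by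
    rw [adjoint_inner_left]
    exact congrArg (fun f => f z) this
  refine Dilation.clm_ext hφ fun b l => ?_
  simp only [ContinuousLinearMap.comp_apply, innerSL_apply_apply, dilationRep_tmul,
    Dilation.inner_tmul, star_mul, star_star, mul_assoc]

/-- For the bound, write ‖y‖² - y^* y = z^* z with z commuting with the range of φ. Then ‖y‖² times
the form at x, minus the form at (1 ⊗ y) x, is the form at (1 ⊗ z) x, which is nonnegative. -/
theorem exists_dilationCommutant {y : K →L[ℂ] K} (hy : y ∈ N.commutant) :
    ∃ T : Dilation hφ →L[ℂ] Dilation hφ,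
      ∀ a k, T (Dilation.tmul hφ a k) = Dilation.tmul hφ a (y k) := by
  have hc : ∀ n : VN N, Commute y (n : K →L[ℂ] K) := fun n =>
    (VonNeumannAlgebra.mem_commutant_iff.1 hy _ n.2).symm
  have hc' : ∀ n : VN N, Commute (star y) (n : K →L[ℂ] K) := fun n => by
    have := (hc (star n)).star_star
    rwa [show star ((star n : VN N) : K →L[ℂ] K) = n from star_star (n : K →L[ℂ] K)] at this
  obtain ⟨z, hz, hzc⟩ := exists_defect y
  have hform : ∀ (t : K →L[ℂ] K) (x : VN M →₀ K),
      dilationForm φ (Finsupp.mapRange.linearMap t.toLinearMap x)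
        (Finsupp.mapRange.linearMap t.toLinearMap x) =
      x.sum fun a k => x.sum fun b l => ⟪t k, (φ (star a * b) : K →L[ℂ] K) (t l)⟫_ℂ := by
    intro t x
    change dilationForm φ (Finsupp.mapRange t (map_zero t) x) (Finsupp.mapRange t (map_zero t) x) = _
    rw [dilationForm, Finsupp.sum_mapRange_index (by simp)]
    refine Finsupp.sum_congr fun a _ => ?_
    rw [Finsupp.sum_mapRange_index (by simp)]
  obtain ⟨T, hT⟩ := Dilation.exists_extension hφ (Finsupp.mapRange.linearMap y.toLinearMap) ‖y‖
    (norm_nonneg _) fun x => by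
      have h0 := dilationForm_self_nonneg hφ (Finsupp.mapRange.linearMap z.toLinearMap x)
      rw [hform] at h0 ⊢
      convert h0 using 1
      simp only [dilationForm, Finsupp.sum, Finset.mul_sum]
      rw [← Finset.sum_sub_distrib]
      refine Finset.sum_congr rfl fun a _ => ?_
      rw [← Finset.sum_sub_distrib]
      refine Finset.sum_congr rfl fun b _ => ?_
      have h1 : ∀ k, (φ (star a * b) : K →L[ℂ] K) (z k) = z ((φ (star a * b) : K →L[ℂ] K) k) :=
        fun k => congrArg (fun f => f k) (hzc _ (hc _) (hc' _)).symm
      have h2 : ∀ k, (φ (star a * b) : K →L[ℂ] K) (y k) = y ((φ (star a * b) : K →L[ℂ] K) k) :=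
        fun k => congrArg (fun f => f k) (hc _).symm
      rw [h1, h2, hz]
  refine ⟨T, fun a k => ?_⟩
  exact (hT _).trans (congrArg (Dilation.of hφ) (Finsupp.mapRange_single (hf := map_zero y)))

/-- The isometry `k ↦ 1 ⊗ k`. -/
def dilationIso : K →ₗᵢ[ℂ] Dilation hφ :=
  ((Dilation.of hφ).toLinearMap ∘ₗ (Finsupp.lsingle (1 : VN M) : K →ₗ[ℂ] (VN M →₀ K)) :
    K →ₗ[ℂ] Dilation hφ).isometryOfInner fun k l => by
      refine (Dilation.inner_tmul hφ 1 1 k l).trans ?_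
      rw [star_one, one_mul, hφ.1]
      rfl

theorem dilationIso_apply (k : K) : dilationIso hφ k = Dilation.tmul hφ 1 k := rfl

theorem inner_dilationIso_rep (x : VN M) (k l : K) :
    ⟪dilationIso hφ k, dilationRep hφ x (dilationIso hφ l)⟫_ℂ = ⟪k, (φ x : K →L[ℂ] K) l⟫_ℂ := by
  rw [dilationIso_apply, dilationIso_apply, dilationRep_tmul, Dilation.inner_tmul, star_one,
    one_mul, mul_one]

/-- If `φ` respects vector states given by `ξ` and `η`, and `ξ` is cyclic, then the Stinespring
representation contains a copy of the identical representation. -/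
theorem exists_dilation_intertwiner {ξ : H} {η : K} (hξ : Dense {ζ : H | ∃ x ∈ M, x ξ = ζ})
    (hst : ∀ x, vecState η (φ x) = vecState ξ x) :
    ∃ R : H →ₗᵢ[ℂ] Dilation hφ, R ξ = dilationIso hφ η ∧
      ∀ (x : VN M) h, R ((x : H →L[ℂ] H) h) = dilationRep hφ x (R h) := by
  let e : VN M →ₗ[ℂ] H :=
    { toFun := fun x => (x : H →L[ℂ] H) ξ
      map_add' := fun _ _ => rfl
      map_smul' := fun _ _ => rfl }
  have hzero : ∀ z : Dilation hφ, innerSL ℂ z = 0 → z = 0 := fun z h => by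
    have := congrArg (fun f => f z) h
    rwa [zero_apply, innerSL_apply_apply, inner_self_eq_zero] at this
  -- The space before separation is free on the set M, so linearity of x ↦ x ⊗ η holds only in
  -- `Dilation`; it is tested against all vectors a ⊗ k.
  have hadd : ∀ x y : VN M, Dilation.tmul hφ (x + y) η =
      Dilation.tmul hφ x η + Dilation.tmul hφ y η := by
    intro x y
    rw [← sub_eq_zero]
    refine hzero _ (Dilation.clm_ext hφ fun a k => ?_)
    simp only [innerSL_apply_apply, inner_sub_left, inner_add_left, Dilation.inner_tmul, star_add,
      add_mul, map_add, zero_apply]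
    exact sub_eq_zero.2 (inner_add_right _ _ _)
  have hsmul : ∀ (c : ℂ) (x : VN M), Dilation.tmul hφ (c • x) η = c • Dilation.tmul hφ x η := by
    intro c x
    rw [← sub_eq_zero]
    refine hzero _ (Dilation.clm_ext hφ fun a k => ?_)
    simp only [innerSL_apply_apply, inner_sub_left, inner_smul_left, Dilation.inner_tmul, star_smul,
      smul_mul_assoc, map_smul, zero_apply]
    exact sub_eq_zero.2 (inner_smul_right _ _ _)
  let f : VN M →ₗ[ℂ] Dilation hφ :=
    { toFun := fun x => Dilation.tmul hφ x η
      map_add' := hadd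
      map_smul' := hsmul }
  have hd : DenseRange e := by
    change Dense (Set.range e)
    convert hξ using 1
    ext ζ
    exact ⟨fun ⟨x, hx⟩ => ⟨x, x.2, hx⟩, fun ⟨x, hx, hx'⟩ => ⟨⟨x, hx⟩, hx'⟩⟩
  -- ‖x ⊗ η‖² = ⟪η, φ(x^* x) η⟫ = ⟪ξ, x^* x ξ⟫ = ‖x ξ‖², by preservation of the state.
  have hn : ∀ x, ‖f x‖ = ‖e x‖ := by
    intro x
    have : ⟪f x, f x⟫_ℂ = ⟪e x, e x⟫_ℂ := by
      refine (Dilation.inner_tmul hφ x x η η).trans ((hst (star x * x)).trans ?_)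
      change ⟪ξ, star (x : H →L[ℂ] H) ((x : H →L[ℂ] H) ξ)⟫_ℂ = _
      rw [ContinuousLinearMap.star_eq_adjoint, adjoint_inner_right]
      rfl
    simp only [inner_self_eq_norm_sq_to_K] at this
    exact (sq_eq_sq₀ (norm_nonneg _) (norm_nonneg _)).1 (by exact_mod_cast this)
  have hb : ∀ x, ‖f x‖ ≤ 1 * ‖e x‖ := fun x => by rw [one_mul, hn]
  have hRe : ∀ x, f.extendOfNorm e (e x) = f x := LinearMap.extendOfNorm_eq hd ⟨1, hb⟩
  let R : H →ₗᵢ[ℂ] Dilation hφ :=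
    { toLinearMap := (f.extendOfNorm e).toLinearMap
      norm_map' := fun h => by
        refine hd.induction_on h (isClosed_eq (f.extendOfNorm e).continuous.norm continuous_norm)
          fun x => ?_
        exact (congrArg _ (hRe x)).trans (hn x) }
  refine ⟨R, hRe 1, fun x h => ?_⟩
  refine hd.induction_on h (isClosed_eq (R.continuous.comp (x : H →L[ℂ] H).continuous)
    ((dilationRep hφ x).continuous.comp R.continuous)) fun a => ?_
  have h1 : R (e a) = f a := hRe a
  have h2 : R ((x : H →L[ℂ] H) (e a)) = f (x * a) := hRe (x * a)
  rw [h1, h2]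
  exact (dilationRep_tmul hφ x a η).symm

end Dilation

/-! ### Normal functionals, commutants and separating vectors -/

section NormalFunctionals

variable {H K : Type*} [NormedAddCommGroup H] [InnerProductSpace ℂ H] [CompleteSpace H]
  [NormedAddCommGroup K] [InnerProductSpace ℂ K] [CompleteSpace K]

open ContinuousLinearMap (adjoint adjoint_inner_left adjoint_inner_right)

theorem summable_norm_sq {I : Type*} (ζ : lp (fun _ : I => H) 2) : Summable fun i => ‖ζ i‖ ^ 2 := by
  have := (lp.memℓp ζ).summable (by norm_num)
  simpa using this

theorem norm_sq_eq_tsum {I : Type*} (ζ : lp (fun _ : I => H) 2) : ‖ζ‖ ^ 2 = ∑' i, ‖ζ i‖ ^ 2 := by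
  have := lp.norm_rpow_eq_tsum (p := 2) (by norm_num) ζ
  simpa using this

/-- A square summable family, as an element of the direct sum. -/
def lpOfSummable {I : Type*} (ζ : I → H) (h : Summable fun i => ‖ζ i‖ ^ 2) :
    lp (fun _ : I => H) 2 :=
  ⟨ζ, memℓp_gen (by simpa using h)⟩

/-- Over the index set I ⊕ I' the difference of the two coefficients becomes a single one, of ζ ⊕ ζ'
against κ ⊕ (-κ'), and it vanishes on 𝒜. -/
theorem inner_lpAmpl_eq {I I' : Type*} (X : Set (H →L[ℂ] H)) (hX : ∀ g ∈ X, adjoint g ∈ X)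
    (𝒜 : Submodule ℂ (H →L[ℂ] H)) (h1 : 1 ∈ 𝒜) (hmul : ∀ g ∈ X, ∀ m ∈ 𝒜, g * m ∈ 𝒜)
    {x : H →L[ℂ] H} (hx : ∀ y, (∀ g ∈ X, g * y = y * g) → x * y = y * x)
    (ζ κ : lp (fun _ : I => H) 2) (ζ' κ' : lp (fun _ : I' => H) 2)
    (h : ∀ m ∈ 𝒜, ⟪κ, lpAmpl I m ζ⟫_ℂ = ⟪κ', lpAmpl I' m ζ'⟫_ℂ) :
    ⟪κ, lpAmpl I x ζ⟫_ℂ = ⟪κ', lpAmpl I' x ζ'⟫_ℂ := by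
  have hs : ∀ (f : lp (fun _ : I => H) 2) (g : lp (fun _ : I' => H) 2),
      Summable fun i : I ⊕ I' => ‖(Sum.elim f g i : H)‖ ^ 2 := by
    intro f g
    obtain ⟨a, ha⟩ := summable_norm_sq f
    obtain ⟨b, hb⟩ := summable_norm_sq g
    exact ⟨a + b, HasSum.sum (f := fun i : I ⊕ I' => ‖(Sum.elim f g i : H)‖ ^ 2) ha hb⟩
  have key : ∀ m : H →L[ℂ] H, ⟪lpOfSummable _ (hs κ (-κ')), lpAmpl (I ⊕ I') m
      (lpOfSummable _ (hs ζ ζ'))⟫_ℂ = ⟪κ, lpAmpl I m ζ⟫_ℂ - ⟪κ', lpAmpl I' m ζ'⟫_ℂ := by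
    intro m
    rw [sub_eq_add_neg, ← inner_neg_left]
    exact (lp.hasSum_inner _ _).unique (HasSum.sum (lp.hasSum_inner κ (lpAmpl I m ζ))
      (lp.hasSum_inner (-κ') (lpAmpl I' m ζ')))
  rw [← sub_eq_zero, ← key]
  refine inner_lpAmpl_eq_zero X hX 𝒜 h1 hmul hx _ _ fun m hm => ?_
  rw [key, h m hm, sub_self]

/-- In the definition of normal functionals, arbitrary index sets can be used. -/
theorem isNormalFunctional_of_tsum {M : VonNeumannAlgebra H} (f : VN M →ₗ[ℂ] ℂ) {J : Type*}
    (ξ η : J → H) (hξ : Summable fun j => ‖ξ j‖ ^ 2) (hη : Summable fun j => ‖η j‖ ^ 2)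
    (hf : ∀ x : VN M, f x = ∑' j, ⟪η j, (x : H →L[ℂ] H) (ξ j)⟫_ℂ) : IsNormalFunctional f := by
  -- Only countably many ξ_j are nonzero, and the other terms of the series vanish; the support is
  -- injected into ℕ and the families are extended by zero.
  have hcount : (Function.support fun j => ‖ξ j‖ ^ 2).Countable := hξ.countable_support
  let C : Set J := Function.support fun j => ‖ξ j‖ ^ 2
  obtain ⟨e, he⟩ : ∃ e : C → ℕ, Function.Injective e := (Set.countable_iff_exists_injective).1 hcount
  have hext : ∀ {β γ : Type _} [Zero β] [Zero γ] (g : C → β) (F : β → γ), F 0 = 0 →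
      (fun n => F (Function.extend e g 0 n)) = Function.extend e (fun c => F (g c)) 0 := by
    intro β γ _ _ g F hF
    funext n
    by_cases hn : ∃ c, e c = n
    · obtain ⟨c, rfl⟩ := hn
      rw [he.extend_apply, he.extend_apply]
    · rw [Function.extend_apply' _ _ _ hn, Function.extend_apply' _ _ _ hn]
      exact hF
  have hsq : ∀ ζ : J → H, (Summable fun j => ‖ζ j‖ ^ 2) →
      Summable fun n => ‖Function.extend e (fun c : C => ζ c) 0 n‖ ^ 2 := by
    intro ζ hζ
    have h2 : (fun n => ‖Function.extend e (fun c : C => ζ c) 0 n‖ ^ 2) =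
        Function.extend e (fun c : C => ‖ζ c‖ ^ 2) 0 :=
      hext (fun c : C => ζ c) (fun z : H => ‖z‖ ^ 2) (by simp)
    rw [h2]
    exact (summable_extend_zero he).2 (hζ.subtype C)
  refine ⟨Function.extend e (fun c : C => ξ c) 0, Function.extend e (fun c : C => η c) 0,
    hsq ξ hξ, hsq η hη, fun x => ?_⟩
  have h3 : (fun n => ⟪Function.extend e (fun c : C => η c) 0 n,
      (x : H →L[ℂ] H) (Function.extend e (fun c : C => ξ c) 0 n)⟫_ℂ) =
      Function.extend e (fun c : C => ⟪η c, (x : H →L[ℂ] H) (ξ c)⟫_ℂ) 0 := by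
    funext n
    by_cases hn : ∃ c, e c = n
    · obtain ⟨c, rfl⟩ := hn
      rw [he.extend_apply, he.extend_apply, he.extend_apply]
    · rw [Function.extend_apply' _ _ _ hn, Function.extend_apply' _ _ _ hn,
        Function.extend_apply' _ _ _ hn]
      simp
  rw [h3, tsum_extend_zero he, hf]
  refine (tsum_subtype_eq_of_support_subset ?_).symm
  intro j hj
  rw [Function.mem_support] at hj ⊢
  intro h
  refine hj ?_
  rw [pow_eq_zero_iff two_ne_zero, norm_eq_zero] at h
  rw [h, map_zero, inner_zero_right]

/-- Normal functionals as matrix coefficients of the amplification. -/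
theorem IsNormalFunctional.exists_lp {M : VonNeumannAlgebra H} {f : VN M →ₗ[ℂ] ℂ}
    (hf : IsNormalFunctional f) : ∃ ζ κ : lp (fun _ : ℕ => H) 2,
      ∀ x : VN M, f x = ⟪κ, lpAmpl ℕ (x : H →L[ℂ] H) ζ⟫_ℂ := by
  obtain ⟨ξ, η, hξ, hη, h⟩ := hf
  refine ⟨lpOfSummable ξ hξ, lpOfSummable η hη, fun x => ?_⟩
  rw [h, lp.inner_eq_tsum]
  rfl

/-- Matrix coefficients are normal functionals. -/
theorem isNormalFunctional_inner {M : VonNeumannAlgebra H} (f : VN M →ₗ[ℂ] ℂ) (k l : H)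
    (h : ∀ x : VN M, f x = ⟪l, (x : H →L[ℂ] H) k⟫_ℂ) : IsNormalFunctional f := by
  have hk : ∀ m : H, Summable fun _ : PUnit.{1} => ‖m‖ ^ 2 := fun m => (hasSum_fintype _).summable
  refine isNormalFunctional_of_tsum f (fun _ : PUnit.{1} => k) (fun _ => l) (hk k) (hk l) fun x => ?_
  rw [h, tsum_fintype, Fintype.sum_unique]

/-- The maps `x ↦ S^* (x ⊗ 1) S` are normal. -/
theorem isNormalFunctional_compression {I : Type*} {M : VonNeumannAlgebra H}
    (f : VN M →ₗ[ℂ] ℂ) (S : K →L[ℂ] lp (fun _ : I => H) 2) (ξ η : ℕ → K)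
    (hξ : Summable fun n => ‖ξ n‖ ^ 2) (hη : Summable fun n => ‖η n‖ ^ 2)
    (hf : ∀ x : VN M, f x = ∑' n, ⟪S (η n), lpAmpl I (x : H →L[ℂ] H) (S (ξ n))⟫_ℂ) :
    IsNormalFunctional f := by
  have hs : ∀ ζ : ℕ → K, (Summable fun n => ‖ζ n‖ ^ 2) →
      Summable fun p : ℕ × I => ‖S (ζ p.1) p.2‖ ^ 2 := by
    intro ζ hζ
    refine (summable_prod_of_nonneg fun p => sq_nonneg _).2
      ⟨fun n => summable_norm_sq (S (ζ n)), ?_⟩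
    have h1 : ∀ n, ∑' i, ‖S (ζ n) i‖ ^ 2 = ‖S (ζ n)‖ ^ 2 := fun n => (norm_sq_eq_tsum _).symm
    simp only [h1]
    refine Summable.of_nonneg_of_le (fun n => by positivity) (fun n => ?_) (hζ.mul_left (‖S‖ ^ 2))
    rw [← mul_pow]
    exact pow_le_pow_left₀ (norm_nonneg _) (S.le_opNorm _) 2
  -- The components of S ξ_n and S η_n form square summable families over ℕ × I.
  refine isNormalFunctional_of_tsum f (fun p : ℕ × I => S (ξ p.1) p.2) (fun p => S (η p.1) p.2)
    (hs ξ hξ) (hs η hη) fun x => ?_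
  rw [hf]
  have hsum : Summable fun p : ℕ × I => ⟪S (η p.1) p.2, (x : H →L[ℂ] H) (S (ξ p.1) p.2)⟫_ℂ := by
    refine Summable.of_norm_bounded (((hs η hη).add (hs ξ hξ)).mul_left ‖(x : H →L[ℂ] H)‖) fun p => ?_
    refine (norm_inner_le_norm _ _).trans ?_
    have h1 := (x : H →L[ℂ] H).le_opNorm (S (ξ p.1) p.2)
    have h2 := two_mul_le_add_sq ‖S (η p.1) p.2‖ ‖S (ξ p.1) p.2‖
    have h3 := mul_nonneg (norm_nonneg (S (η p.1) p.2)) (norm_nonneg (S (ξ p.1) p.2))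
    calc ‖S (η p.1) p.2‖ * ‖(x : H →L[ℂ] H) (S (ξ p.1) p.2)‖
        ≤ ‖S (η p.1) p.2‖ * (‖(x : H →L[ℂ] H)‖ * ‖S (ξ p.1) p.2‖) := by gcongr
      _ = ‖(x : H →L[ℂ] H)‖ * (‖S (η p.1) p.2‖ * ‖S (ξ p.1) p.2‖) := by ring
      _ ≤ _ := by gcongr; linarith
  rw [hsum.tsum_prod]
  exact tsum_congr fun n => lp.inner_eq_tsum _ _

/-- The compression of an amplification is completely positive. -/
theorem matrixNonneg_compression {I : Type*} {n : ℕ} (a : Fin n → Fin n → H →L[ℂ] H)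
    (ha : ∀ x : Fin n → H, 0 ≤ ∑ i, ∑ j, ⟪x i, a i j (x j)⟫_ℂ)
    (x : Fin n → lp (fun _ : I => H) 2) :
    0 ≤ ∑ i, ∑ j, ⟪x i, lpAmpl I (a i j) (x j)⟫_ℂ := by
  have h : HasSum (fun l => ∑ i, ∑ j, ⟪x i l, a i j (x j l)⟫_ℂ)
      (∑ i, ∑ j, ⟪x i, lpAmpl I (a i j) (x j)⟫_ℂ) :=
    hasSum_sum fun i _ => hasSum_sum fun j _ => lp.hasSum_inner (x i) (lpAmpl I (a i j) (x j))
  exact h.nonneg fun l => ha fun i => x i l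

theorem vnGen_commute {X : Set (H →L[ℂ] H)} (hX : ∀ g ∈ X, adjoint g ∈ X) {x : H →L[ℂ] H}
    (hx : x ∈ vnGen X) (y : H →L[ℂ] H) (hy : ∀ g ∈ X, g * y = y * g) : x * y = y * x := by
  have h1 : x ∈ StarSubalgebra.centralizer ℂ
    (StarSubalgebra.centralizer ℂ X : Set (H →L[ℂ] H)) := hx
  rw [StarSubalgebra.mem_centralizer_iff] at h1
  refine ((h1 y ?_).1).symm
  rw [SetLike.mem_coe, StarSubalgebra.mem_centralizer_iff]
  exact fun g hg => ⟨hy g hg, hy _ (hX g hg)⟩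

/-- A vector that is separating for a von Neumann algebra is cyclic for the commutant. -/
theorem dense_commutant {M : VonNeumannAlgebra H} {ξ : H}
    (hsep : ∀ x ∈ M, x ξ = 0 → x = 0) (ζ : H) : ζ ∈ closure {k | ∃ y ∈ M.commutant, y ξ = k} := by
  let P₀ : Submodule ℂ H :=
    { carrier := {k | ∃ y ∈ M.commutant, y ξ = k}
      add_mem' := by
        rintro _ _ ⟨y, hy, rfl⟩ ⟨z, hz, rfl⟩
        exact ⟨y + z, add_mem (S := VonNeumannAlgebra H) hy hz, rfl⟩
      zero_mem' := ⟨0, zero_mem (S := VonNeumannAlgebra H) _, rfl⟩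
      smul_mem' := by
        rintro c _ ⟨y, hy, rfl⟩
        exact ⟨c • y, M.commutant.toStarSubalgebra.smul_mem hy c, rfl⟩ }
  let P := P₀.topologicalClosure
  have hP : IsClosed (P : Set H) := Submodule.isClosed_topologicalClosure _
  have : CompleteSpace P := hP.completeSpace_coe
  have hinv : ∀ y ∈ M.commutant, ∀ e ∈ P, y e ∈ P := by
    intro y hy
    refine Submodule.topologicalClosure_minimal (t := P.comap y.toLinearMap) _ ?_
      (hP.preimage y.continuous)
    rintro _ ⟨m, hm, rfl⟩
    exact Submodule.le_topologicalClosure _ (show y (m ξ) ∈ P₀ from ⟨y * m, mul_mem (S := VonNeumannAlgebra H) hy hm, rfl⟩)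
  -- The projection onto the closure of M' ξ commutes with M', so it lies in M'' = M; its complement
  -- kills the separating vector ξ and is therefore zero.
  have hmem : P.starProjection ∈ M := by
    rw [← M.commutant_commutant, VonNeumannAlgebra.mem_commutant_iff]
    intro y hy
    refine ContinuousLinearMap.ext fun e => ?_
    exact (starProjection_apply_commute P y (hinv y hy) (hinv _ (star_mem (S := VonNeumannAlgebra H) hy)) e).symm
  have h0 := hsep (1 - P.starProjection) (sub_mem (one_mem _) hmem) (by
    rw [sub_apply, one_apply_eq_self, sub_eq_zero]
    exact (Submodule.starProjection_eq_self_iff.2 (Submodule.le_topologicalClosure _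
      (show ξ ∈ P₀ from ⟨1, one_mem (S := VonNeumannAlgebra H) _, rfl⟩))).symm)
  have h1 : ζ ∈ P := by
    rw [← Submodule.starProjection_eq_self_iff, ← sub_eq_zero.1 h0]
    rfl
  exact h1

end NormalFunctionals

section

open ContinuousLinearMap (adjoint adjoint_inner_left adjoint_inner_right)

/-! ### Compressions of amplifications as normal ucp maps -/

section AmplLinear

variable {H : Type*} [NormedAddCommGroup H] [InnerProductSpace ℂ H] [CompleteSpace H]
  (I : Type*)

theorem lpAmpl_zero : lpAmpl I (0 : H →L[ℂ] H) = 0 :=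
  ContinuousLinearMap.ext fun ζ => lp.ext (funext fun i => lpAmpl_apply 0 ζ i)

theorem lpAmpl_one : lpAmpl I (1 : H →L[ℂ] H) = 1 :=
  ContinuousLinearMap.ext fun ζ => lp.ext (funext fun i => lpAmpl_apply 1 ζ i)

theorem lpAmpl_add (x y : H →L[ℂ] H) : lpAmpl I (x + y) = lpAmpl I x + lpAmpl I y :=
  ContinuousLinearMap.ext fun ζ => lp.ext (funext fun i => lpAmpl_apply (x + y) ζ i)

theorem lpAmpl_smul (c : ℂ) (x : H →L[ℂ] H) : lpAmpl I (c • x) = c • lpAmpl I x :=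
  ContinuousLinearMap.ext fun ζ => lp.ext (funext fun i => lpAmpl_apply (c • x) ζ i)

end AmplLinear

section Compression

variable {H K : Type*} [NormedAddCommGroup H] [InnerProductSpace ℂ H] [CompleteSpace H]
  [NormedAddCommGroup K] [InnerProductSpace ℂ K] [CompleteSpace K]
  {M : VonNeumannAlgebra H} {N : VonNeumannAlgebra K}

/-- The operators in `P` determine the matrix coefficients, on amplifications over `I`, of the
members of `M`. -/
def Determines (P : Set (H →L[ℂ] H)) (M : VonNeumannAlgebra H) (I : Type*) : Prop :=
  ∀ x : VN M, ∀ ζ κ ζ' κ' : lp (fun _ : I => H) 2,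
    (∀ m ∈ P, ⟪κ, lpAmpl I m ζ⟫_ℂ = ⟪κ', lpAmpl I m ζ'⟫_ℂ) →
      ⟪κ, lpAmpl I (x : H →L[ℂ] H) ζ⟫_ℂ = ⟪κ', lpAmpl I (x : H →L[ℂ] H) ζ'⟫_ℂ

/-- Vector functionals on N pull back to normal functionals on M, which are matrix coefficients of
amplifications over ℕ and hence determined by P. -/
theorem Determines.linearMap_eq {P : Set (H →L[ℂ] H)} (hP : Determines P M ℕ)
    {Φ Ψ : VN M →ₗ[ℂ] VN N} (hΦ : IsNormal Φ) (hΨ : IsNormal Ψ)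
    (h : ∀ m ∈ P, ∃ x : VN M, (x : H →L[ℂ] H) = m ∧ Ψ x = Φ x) : Ψ = Φ := by
  refine LinearMap.ext fun x => Subtype.ext (ContinuousLinearMap.ext fun k => ?_)
  refine ext_inner_left ℂ fun l => ?_
  let f : VN N →ₗ[ℂ] ℂ :=
    { toFun := fun y => ⟪l, (y : K →L[ℂ] K) k⟫_ℂ
      map_add' := fun y z => inner_add_right _ _ _
      map_smul' := fun c y => inner_smul_right _ _ _ }
  have hf : IsNormalFunctional f := isNormalFunctional_inner f k l fun _ => rfl
  obtain ⟨ζ, κ, h1⟩ := (hΦ f hf).exists_lp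
  obtain ⟨ζ', κ', h2⟩ := (hΨ f hf).exists_lp
  refine (h2 x).trans (Eq.trans ?_ (h1 x).symm)
  refine hP x ζ' κ' ζ κ fun m hm => ?_
  obtain ⟨y, rfl, hy⟩ := h m hm
  rw [← h1, ← h2, LinearMap.comp_apply, LinearMap.comp_apply, hy]

variable {I : Type*} (S : K →L[ℂ] lp (fun _ : I => H) 2)

/-- By the double commutant theorem it is enough to commute with every y in N'. This is an equality
of two matrix coefficients in x; it holds on P, where the compression lies in N, and `Determines`
extends it to M. -/
theorem Determines.compression_mem {P : Set (H →L[ℂ] H)} (hP : Determines P M I)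
    (hS : ∀ m ∈ P, ∃ y : VN N, ∀ k k', ⟪S k', lpAmpl I m (S k)⟫_ℂ = ⟪k', (y : K →L[ℂ] K) k⟫_ℂ)
    (x : VN M) : adjoint S ∘L lpAmpl I (x : H →L[ℂ] H) ∘L S ∈ N.toStarSubalgebra := by
  have h : adjoint S ∘L lpAmpl I (x : H →L[ℂ] H) ∘L S ∈ N.commutant.commutant := by
    rw [VonNeumannAlgebra.mem_commutant_iff]
    intro y hy
    refine ContinuousLinearMap.ext fun k => ext_inner_left ℂ fun k' => ?_
    rw [mul_apply_eq_comp, mul_apply_eq_comp, ← adjoint_inner_left]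
    simp only [ContinuousLinearMap.comp_apply, adjoint_inner_right]
    refine hP x _ _ _ _ fun m hm => ?_
    obtain ⟨z, hz⟩ := hS m hm
    rw [hz, hz, adjoint_inner_left]
    have h2 := (VonNeumannAlgebra.mem_commutant_iff.1 hy) (z : K →L[ℂ] K) z.2
    exact congrArg (fun T : K →L[ℂ] K => ⟪k', T k⟫_ℂ) h2.symm
  rwa [VonNeumannAlgebra.commutant_commutant] at h

variable {S} (hS : ∀ x : VN M, adjoint S ∘L lpAmpl I (x : H →L[ℂ] H) ∘L S ∈ N.toStarSubalgebra)

/-- The map `x ↦ S^* (x ⊗ 1) S` between von Neumann algebras. -/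
def compressionMap : VN M →ₗ[ℂ] VN N where
  toFun x := ⟨_, hS x⟩
  map_add' x y := by
    refine Subtype.ext (ContinuousLinearMap.ext fun k => ?_)
    change adjoint S (lpAmpl I ((x : H →L[ℂ] H) + (y : H →L[ℂ] H)) (S k)) = _
    rw [lpAmpl_add, add_apply, map_add]
    rfl
  map_smul' c x := by
    refine Subtype.ext (ContinuousLinearMap.ext fun k => ?_)
    change adjoint S (lpAmpl I (c • (x : H →L[ℂ] H)) (S k)) = _
    rw [lpAmpl_smul, smul_apply, map_smul]
    rfl

theorem compressionMap_apply (x : VN M) (k : K) :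
    (compressionMap hS x : K →L[ℂ] K) k = adjoint S (lpAmpl I (x : H →L[ℂ] H) (S k)) := rfl

theorem inner_compressionMap (x : VN M) (k k' : K) :
    ⟪k', (compressionMap hS x : K →L[ℂ] K) k⟫_ℂ = ⟪S k', lpAmpl I (x : H →L[ℂ] H) (S k)⟫_ℂ :=
  adjoint_inner_right S _ _

theorem isUCP_compressionMap (h1 : ∀ k, adjoint S (S k) = k) : IsUCP (compressionMap hS) := by
  refine ⟨?_, fun n a ha x => ?_⟩
  · refine Subtype.ext (ContinuousLinearMap.ext fun k => ?_)
    refine (compressionMap_apply hS 1 k).trans ?_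
    change adjoint S (lpAmpl I (1 : H →L[ℂ] H) (S k)) = k
    rw [lpAmpl_one]
    exact h1 k
  · simp only [inner_compressionMap]
    exact matrixNonneg_compression (fun i j => (a i j : H →L[ℂ] H)) ha fun i => S (x i)

theorem isNormal_compressionMap : IsNormal (compressionMap hS) := by
  rintro f ⟨ξ, η, hξ, hη, hf⟩
  refine isNormalFunctional_compression _ S ξ η hξ hη fun x => ?_
  rw [LinearMap.comp_apply, hf]
  simp only [inner_compressionMap]

end Compression

end

section

open ContinuousLinearMap (adjoint adjoint_inner_left adjoint_inner_right)

/-! ### The span of the reduced operators -/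

section ReducedSpan

variable {V : Type*} {G : SimpleGraph V} (W : MinimalWords G) {H : V → Type*}
  [∀ v, NormedAddCommGroup (H v)] [∀ v, InnerProductSpace ℂ (H v)] [∀ v, CompleteSpace (H v)]
  (A : ∀ v, StateAlgebra (H v))

/-- The product of the operators in a list of elements of the vertex algebras. -/
abbrev listProd (l : List (Σ v, VN (A v).alg)) : graphSpace W A →L[ℂ] graphSpace W A :=
  leftProd (fun v => (A v).vec) W (fun v => (A v).norm_vec)
    (fun v (x : VN (A v).alg) => (x : H v →L[ℂ] H v)) l

/-- Lists of centered elements of the vertex algebras that belong to a reduced word. -/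
def IsReducedList (G : SimpleGraph V) (l : List (Σ v, VN (A v).alg)) : Prop :=
  IsReduced G (l.map Sigma.fst) ∧ ∀ p ∈ l, (A p.1).Centered p.2

/-- The linear span of the reduced operators. -/
def reducedSpan : Submodule ℂ (graphSpace W A →L[ℂ] graphSpace W A) :=
  Submodule.span ℂ {T | ∃ l, IsReducedList A G l ∧ listProd W A l = T}

variable {W A}

theorem listProd_nil : listProd W A [] = 1 := rfl

theorem listProd_cons (p : Σ v, VN (A v).alg) (l : List (Σ v, VN (A v).alg)) :
    listProd W A (p :: l) = graphRep W A p.1 p.2 * listProd W A l :=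
  leftProd_cons _ _ p l

theorem listProd_mem {l : List (Σ v, VN (A v).alg)} (hl : IsReducedList A G l) :
    listProd W A l ∈ reducedSpan W A := Submodule.subset_span ⟨l, hl, rfl⟩

theorem isReducedList_nil : IsReducedList A G [] := ⟨isReduced_nil G, by simp⟩

theorem one_mem_reducedSpan : 1 ∈ reducedSpan W A := listProd_mem isReducedList_nil

/-- Write x = (x - ω_v(x)) + ω_v(x): the centered part prolongs the reduced product by a letter, the
scalar returns a multiple of it. -/
theorem graphRep_mul_listProd_mem {v : V} (x : VN (A v).alg) {l : List (Σ v, VN (A v).alg)}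
    (hl : IsReducedList A G l) (hv : IsReduced G (v :: l.map Sigma.fst)) :
    graphRep W A v x * listProd W A l ∈ reducedSpan W A := by
  let c : ℂ := vecState (A v).vec x
  have hc : (A v).Centered (x - c • 1) := by
    change ⟪(A v).vec, (x : H v →L[ℂ] H v) (A v).vec - c • (A v).vec⟫_ℂ = 0
    rw [inner_sub_right, inner_smul_right, inner_self_of_norm_eq_one (A v).norm_vec, mul_one]
    exact sub_self c
  have e : graphRep W A v x * listProd W A l =
      listProd W A (⟨v, x - c • 1⟩ :: l) + c • listProd W A l := by
    rw [listProd_cons]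
    have : (x : H v →L[ℂ] H v) = ((x - c • 1 : VN (A v).alg) : H v →L[ℂ] H v) + c • 1 := by
      change (x : H v →L[ℂ] H v) = (x - c • 1) + c • 1
      rw [sub_add_cancel]
    conv_lhs => rw [this]
    rw [graphRep, leftRep_add, leftRep_smul, leftRep_one]
    rfl
  rw [e]
  refine add_mem (listProd_mem ⟨hv, ?_⟩) (Submodule.smul_mem _ _ (listProd_mem hl))
  intro p hp
  rcases List.mem_cons.1 hp with rfl | hp
  · exact hc
  · exact hl.2 p hp

theorem mem_of_typeII {α : Type*} {G : SimpleGraph α} {l l' : List α} (h : TypeII G l l') (a : α) :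
    a ∈ l ↔ a ∈ l' := by
  induction h with
  | rel _ _ h =>
    obtain ⟨p, q, v, w, h⟩ := h
    simp only [List.mem_append, List.mem_cons]
    tauto
  | refl => rfl
  | symm _ _ _ ih => exact ih.symm
  | trans _ _ _ _ _ ih1 ih2 => exact ih1.trans ih2

/-- If v is reachable in the word, its letter is moved to the front and absorbed into x; otherwise v
is prepended. Stability under left multiplication by the generators, together with membership of 1,
is what the density argument requires. -/
theorem graphRep_mul_mem {v : V} (x : VN (A v).alg) {m : graphSpace W A →L[ℂ] graphSpace W A}
    (hm : m ∈ reducedSpan W A) : graphRep W A v x * m ∈ reducedSpan W A := by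
  induction hm using Submodule.span_induction with
  | zero => rw [mul_zero]; exact zero_mem _
  | add m m' _ _ h h' => rw [mul_add]; exact add_mem h h'
  | smul c m _ h => rw [mul_smul_comm]; exact Submodule.smul_mem _ _ h
  | mem m hm =>
    obtain ⟨l, hl, rfl⟩ := hm
    by_cases h : Reach G v (l.map Sigma.fst)
    · obtain ⟨⟨_, a⟩, l', rfl, h'⟩ := exists_typeII_cons_of_reach Sigma.fst h
      have hred := (isReduced_typeII G (TypeII.map _ h')).1 hl.1
      have hl' : IsReducedList A G l' := ⟨IsReduced.tail hred, fun p hp => hl.2 p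
        ((mem_of_typeII h' p).2 (List.mem_cons_of_mem _ hp))⟩
      have e : listProd W A l = listProd W A (⟨_, a⟩ :: l') := leftProd_typeII _ _ h'
      rw [e, listProd_cons, ← mul_assoc, graphRep, graphRep, ← leftRep_mul]
      exact graphRep_mul_listProd_mem (x * a) hl' hred
    · exact graphRep_mul_listProd_mem x hl ((isReduced_cons G _ _).2 ⟨h, hl.1⟩)

variable (W A) in
/-- The set of generators of the graph product von Neumann algebra. -/
def graphGens : Set (graphSpace W A →L[ℂ] graphSpace W A) :=
  {T | ∃ v, ∃ x ∈ (A v).alg, graphRep W A v x = T}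

theorem adjoint_mem_graphGens {g : graphSpace W A →L[ℂ] graphSpace W A}
    (hg : g ∈ graphGens W A) : adjoint g ∈ graphGens W A := by
  obtain ⟨v, x, hx, rfl⟩ := hg
  exact ⟨v, adjoint x, star_mem (S := VonNeumannAlgebra (H v)) hx, (adjoint_leftRep _ v x).symm⟩

theorem graphAlg_commute {x : graphSpace W A →L[ℂ] graphSpace W A}
    (hx : x ∈ (graphAlg W A).toStarSubalgebra) (y) (hy : ∀ g ∈ graphGens W A, g * y = y * g) :
    x * y = y * x :=
  vnGen_commute (fun _ => adjoint_mem_graphGens) hx y hy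

/-- This is the density argument for the reduced span; linearity reduces its hypothesis to single
reduced products. -/
theorem determines_listProd (I : Type*) :
    Determines {T | ∃ l, IsReducedList A G l ∧ listProd W A l = T} (graphAlg W A) I := by
  intro x ζ κ ζ' κ' h
  refine inner_lpAmpl_eq (graphGens W A) (fun _ => adjoint_mem_graphGens) (reducedSpan W A)
    one_mem_reducedSpan ?_ (graphAlg_commute x.2) ζ κ ζ' κ' fun m hm => ?_
  · rintro _ ⟨v, x, hx, rfl⟩ m hm
    exact graphRep_mul_mem ⟨x, hx⟩ hm
  · induction hm using Submodule.span_induction with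
    | zero => simp only [lpAmpl_zero, zero_apply, inner_zero_right]
    | add m m' _ _ h h' => simp only [lpAmpl_add, add_apply, inner_add_right, h, h']
    | smul c m _ h => simp only [lpAmpl_smul, smul_apply, inner_smul_right, h]
    | mem m hm => exact h m hm

theorem coe_graphProd (w : List V) (a : ∀ i : Fin w.length, VN (A (w.get i)).alg) :
    (graphProd W A w a : graphSpace W A →L[ℂ] graphSpace W A) =
      listProd W A (List.ofFn fun i => ⟨w.get i, a i⟩) := by
  have h : ∀ l : List (VN (graphAlg W A)), ((l.prod : VN (graphAlg W A)) :
      graphSpace W A →L[ℂ] graphSpace W A) = (l.map Subtype.val).prod := by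
    intro l
    induction l with
    | nil => rfl
    | cons a l ih => rw [List.prod_cons, List.map_cons, List.prod_cons, ← ih]; rfl
  rw [graphProd, h, listProd, leftProd, List.map_ofFn, List.map_ofFn]
  rfl

theorem isReducedList_ofFn {w : List V} {a : ∀ i : Fin w.length, VN (A (w.get i)).alg}
    (hw : IsReduced G w) (ha : ∀ i, (A (w.get i)).Centered (a i)) :
    IsReducedList A G (List.ofFn fun i => ⟨w.get i, a i⟩) := by
  refine ⟨?_, ?_⟩
  · rw [List.map_ofFn]
    exact (List.ofFn_get w).symm ▸ hw
  · intro p hp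
    obtain ⟨i, rfl⟩ := List.mem_ofFn.1 hp
    exact ha i

theorem exists_graphProd {l : List (Σ v, VN (A v).alg)} (hl : IsReducedList A G l) :
    ∃ (w : List V) (a : ∀ i : Fin w.length, VN (A (w.get i)).alg), IsReduced G w ∧
      (∀ i, (A (w.get i)).Centered (a i)) ∧ (List.ofFn fun i => ⟨w.get i, a i⟩) = l := by
  obtain ⟨w, a, rfl⟩ := exists_ofFn_sigma l
  refine ⟨w, a, ?_, fun i => hl.2 _ (List.mem_ofFn.2 ⟨i, rfl⟩), rfl⟩
  have := hl.1
  rw [List.map_ofFn] at this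
  exact (List.ofFn_get w) ▸ this

end ReducedSpan

end

section

open ContinuousLinearMap (adjoint adjoint_inner_left adjoint_inner_right)

/-! ### Graph products of dilations -/

section GraphDilation

variable {V : Type*} {G : SimpleGraph V} {W : MinimalWords G}
  {H K L : V → Type*}
  [∀ v, NormedAddCommGroup (H v)] [∀ v, InnerProductSpace ℂ (H v)] [∀ v, CompleteSpace (H v)]
  [∀ v, NormedAddCommGroup (K v)] [∀ v, InnerProductSpace ℂ (K v)] [∀ v, CompleteSpace (K v)]
  [∀ v, NormedAddCommGroup (L v)] [∀ v, InnerProductSpace ℂ (L v)] [∀ v, CompleteSpace (L v)]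
  {ξ : ∀ v, H v} {η : ∀ v, K v} {χ : ∀ v, L v}
  (hξ : ∀ v, ‖ξ v‖ = 1) (hχ : ∀ v, ‖χ v‖ = 1)
  {α : V → Type*} (ρ : ∀ v, α v → H v →L[ℂ] H v) (ψ : ∀ v, α v → K v →L[ℂ] K v)
  (π : ∀ v, α v → L v →L[ℂ] L v)
  {Q : ∀ v, K v →ₗᵢ[ℂ] L v} (hQ : ∀ v, Q v (η v) = χ v)
  {D : ∀ v, Set (K v →L[ℂ] K v)}

/-- The isometry between graph product spaces dilates reduced products if the isometries between the
vertex spaces are dilations. -/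
theorem inner_graphMap_leftProd (hη : ∀ v, ‖η v‖ = 1)
    (hψ : ∀ v a k k', ⟪Q v k', π v a (Q v k)⟫_ℂ = ⟪k', ψ v a k⟫_ℂ)
    (hD : ∀ v κ, κ ∈ closure {k | ∃ y ∈ D v, y (η v) = k})
    (hψD : ∀ v a, ∀ y ∈ D v, ∀ k, ψ v a (y k) = y (ψ v a k))
    (hT : ∀ v, ∀ y ∈ D v, ∃ T : L v →L[ℂ] L v, (∀ k, T (Q v k) = Q v (y k)) ∧
      (∀ k, adjoint T (Q v k) = Q v (adjoint y k)) ∧ ∀ a z, π v a (T z) = T (π v a z))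
    {l : List (Σ v, α v)} (hl : IsReduced G (l.map Sigma.fst))
    (hc : ∀ p ∈ l, ⟪η p.1, ψ p.1 p.2 (η p.1)⟫_ℂ = 0) (k k' : GraphSpace η W) :
    ⟪graphMap W Q hQ k', leftProd χ W hχ π l (graphMap W Q hQ k)⟫_ℂ =
      ⟪k', leftProd η W hη ψ l k⟫_ℂ := by
  let S := (graphMap W Q hQ).toContinuousLinearMap
  suffices h : adjoint S ∘L leftProd χ W hχ π l ∘L S = leftProd η W hη ψ l by
    rw [← h]
    exact (adjoint_inner_right S _ _).symm
  let E : Submodule ℂ (GraphSpace η W) :=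
    LinearMap.eqLocus (adjoint S ∘L leftProd χ W hχ π l ∘L S).toLinearMap
      (leftProd η W hη ψ l).toLinearMap
  have hE : ∀ k, k ∈ E ↔ adjoint S (leftProd χ W hχ π l (S k)) = leftProd η W hη ψ l k :=
    fun k => Iff.rfl
  have hclosed : IsClosed (E : Set (GraphSpace η W)) :=
    isClosed_eq (adjoint S ∘L leftProd χ W hχ π l ∘L S).continuous
      (leftProd η W hη ψ l).continuous
  refine ContinuousLinearMap.ext fun k => ?_
  -- The set E where both operators agree is closed, contains the vacuum and is invariant under the
  -- right action of D, for which the vacuum is cyclic.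
  refine hclosed.closure_subset (mem_closure_of_rightRep hη hD E ?_ ?_ k)
  · have hSΩ : S (vacuum η W) = vacuum χ W := graphMap_vacuum
    -- The compression of Q_v^* to the complements of the distinguished vectors; S^* acts on each
    -- word by the tensor product of these maps.
    let f : ∀ v, circ (χ v) → circ (η v) := fun v x => circProj (η v) (adjoint (Q v).toContinuousLinearMap x)
    have hf : ∀ v (x : circ (η v)) (y : circ (χ v)),
        ⟪Q v x, (y : L v)⟫_ℂ = ⟪(x : K v), (f v y : K v)⟫_ℂ := by
      intro v x y
      rw [coe_circProj (hη v), inner_sub_right, inner_smul_right, ← inner_conj_symm (x : K v) (η v),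
        inner_circ, map_zero, mul_zero, sub_zero]
      exact (adjoint_inner_right (Q v).toContinuousLinearMap _ _).symm
    have hc' : ∀ p ∈ l, ⟪χ p.1, π p.1 p.2 (χ p.1)⟫_ℂ = 0 := fun p hp => by
      rw [← hQ, hψ, hc p hp]
    rw [hE, hSΩ, leftProd_vacuum hχ π hl hc', leftProd_vacuum hη ψ hl hc]
    refine (map_vec_of_inclWord (P := adjoint S) f (adjoint_graphMap_inclWord f hf) ?_).trans ?_
    · rw [SylWord.word, List.map_map]
      exact hl
    · rw [List.map_map]
      refine congrArg _ (List.map_congr_left fun p hp => ?_)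
      refine congrArg (Sigma.mk p.1) (congrArg (circProj (η p.1)) ?_)
      change adjoint (Q p.1).toContinuousLinearMap
        (circProj (χ p.1) (π p.1 p.2 (χ p.1)) : L p.1) = _
      rw [coe_circProj (hχ p.1), hc' p hp, zero_smul, sub_zero]
      refine ext_inner_left ℂ fun z => ?_
      rw [adjoint_inner_right, ← hψ, hQ]
      rfl
  · intro v y hy k hk
    obtain ⟨T, hT1, hT2, hT3⟩ := hT v y hy
    rw [hE] at hk ⊢
    have h1 : ∀ z, leftProd χ W hχ π l (rightRep χ W hχ v T z) =
        rightRep χ W hχ v T (leftProd χ W hχ π l z) := fun z =>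
      (leftProd_intertwine hχ π hχ π (rightRep χ W hχ v T) (fun w a z => by
        have := leftRep_commute_rightRep hχ (π w a) T (W := W) (by rintro rfl z; exact hT3 a z)
        exact (congrArg (fun A : GraphSpace χ W →L[ℂ] GraphSpace χ W => A z) this).symm) l z).symm
    have h2 : ∀ z, leftProd η W hη ψ l (rightRep η W hη v y z) =
        rightRep η W hη v y (leftProd η W hη ψ l z) := fun z =>
      (leftProd_intertwine hη ψ hη ψ (rightRep η W hη v y) (fun w a z => by
        have := leftRep_commute_rightRep hη (ψ w a) y (W := W)
          (by rintro rfl z; exact hψD _ a y hy z)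
        exact (congrArg (fun A : GraphSpace η W →L[ℂ] GraphSpace η W => A z) this).symm) l z).symm
    -- The right action ρ of y and its lift are related by S ρ(y) = ρ(T) S and S^* ρ(T) = ρ(y) S^*;
    -- the second relation comes from the one for the adjoints.
    have h3 : ∀ z, S (rightRep η W hη v y z) = rightRep χ W hχ v T (S z) := fun z =>
      graphMap_rightRep hη hχ (fun k => (hT1 k).symm) z
    have h4 : ∀ z, adjoint S (rightRep χ W hχ v T z) = rightRep η W hη v y (adjoint S z) := by
      intro z
      refine ext_inner_left ℂ fun k => ?_
      rw [adjoint_inner_right, ← inner_rightRep_left, ← inner_rightRep_left, adjoint_inner_right]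
      exact congrArg (fun u => ⟪u, z⟫_ℂ) (graphMap_rightRep hη hχ (fun k => (hT2 k).symm) k).symm
    rw [h3, h1, h4, hk, h2]

/-- A column of intertwiners that recovers all intertwiners recovers the dilating isometry. -/
theorem adjoint_column_graphMap (hη : ∀ v, ‖η v‖ = 1) {R : ∀ v, H v →ₗᵢ[ℂ] L v}
    (hR : ∀ v, R v (ξ v) = χ v) {F : Type*} [NormedAddCommGroup F] [InnerProductSpace ℂ F]
    [CompleteSpace F] (J : GraphSpace χ W →L[ℂ] F)
    (hJ : ∀ t : GraphSpace ξ W →L[ℂ] GraphSpace χ W, (∀ v a z,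
      t (leftRep ξ W hξ v (ρ v a) z) = leftRep χ W hχ v (π v a) (t z)) →
        ∀ z, adjoint J (J (t z)) = t z)
    (hRρ : ∀ v a z, R v (ρ v a z) = π v a (R v z))
    (hD : ∀ v κ, κ ∈ closure {k | ∃ y ∈ D v, y (η v) = k})
    (hT : ∀ v, ∀ y ∈ D v, ∃ T : L v →L[ℂ] L v, (∀ k, T (Q v k) = Q v (y k)) ∧
      ∀ a z, π v a (T z) = T (π v a z)) (k : GraphSpace η W) :
    adjoint J (J (graphMap W Q hQ k)) = graphMap W Q hQ k := by
  let S := (graphMap W Q hQ).toContinuousLinearMap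
  -- E consists of those k for which S k is the value at the vacuum of some intertwiner, so that
  -- `hJ` applies to S k.
  let E : Submodule ℂ (GraphSpace η W) :=
    { carrier := {k | ∃ t : GraphSpace ξ W →L[ℂ] GraphSpace χ W, (∀ v a z,
        t (leftRep ξ W hξ v (ρ v a) z) = leftRep χ W hχ v (π v a) (t z)) ∧ t (vacuum ξ W) = S k}
      add_mem' := by
        rintro k k' ⟨t, ht, h⟩ ⟨t', ht', h'⟩
        refine ⟨t + t', fun v a z => ?_, ?_⟩
        · rw [add_apply, add_apply, ht, ht', map_add]
        · rw [add_apply, h, h', map_add]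
      zero_mem' := ⟨0, fun v a z => by simp only [zero_apply, map_zero],
        by rw [zero_apply, map_zero]⟩
      smul_mem' := by
        rintro c k ⟨t, ht, h⟩
        refine ⟨c • t, fun v a z => ?_, ?_⟩
        · rw [smul_apply, smul_apply, ht, map_smul]
        · rw [smul_apply, h, map_smul] }
  have h0 : vacuum η W ∈ E := by
    refine ⟨(graphMap W R hR).toContinuousLinearMap, fun v a z => ?_, ?_⟩
    · exact graphMap_leftRep hξ hχ (hRρ v a) z
    · exact graphMap_vacuum.trans graphMap_vacuum.symm
  have hE : ∀ v, ∀ y ∈ D v, ∀ k ∈ E, rightRep η W hη v y k ∈ E := by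
    rintro v y hy k ⟨t, ht, h⟩
    obtain ⟨T, hT1, hT2⟩ := hT v y hy
    -- T commutes with π_v, so its right action commutes with all the left actions and its composite
    -- with t is again an intertwiner.
    refine ⟨rightRep χ W hχ v T ∘L t, fun w a z => ?_, ?_⟩
    · have := leftRep_commute_rightRep hχ (π w a) T (W := W) (by rintro rfl z; exact hT2 a z)
      rw [ContinuousLinearMap.comp_apply, ContinuousLinearMap.comp_apply, ht]
      exact (congrArg (fun A : GraphSpace χ W →L[ℂ] GraphSpace χ W => A (t z)) this).symm
    · rw [ContinuousLinearMap.comp_apply, h]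
      exact (graphMap_rightRep hη hχ (fun k => (hT1 k).symm) k).symm
  have hclosed : IsClosed {k | adjoint J (J (S k)) = S k} :=
    isClosed_eq (adjoint J ∘L J ∘L S).continuous S.continuous
  refine closure_minimal ?_ hclosed (mem_closure_of_rightRep hη hD E h0 hE k)
  rintro k ⟨t, ht, h⟩
  rw [Set.mem_ofPred_eq, ← h, hJ t ht]

end GraphDilation

end

section

open ContinuousLinearMap (adjoint adjoint_inner_left adjoint_inner_right)

/-! ### Lifting the commutant to the dilation space -/

section VertexData

variable {H K : Type*} [NormedAddCommGroup H] [InnerProductSpace ℂ H] [CompleteSpace H]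
  [NormedAddCommGroup K] [InnerProductSpace ℂ K] [CompleteSpace K]
  {M : VonNeumannAlgebra H} {N : VonNeumannAlgebra K} {φ : VN M →ₗ[ℂ] VN N} (hφ : IsUCP φ)

/-- Operators in the commutant lift to the dilation space. -/
theorem exists_dilation_lift {y : K →L[ℂ] K} (hy : y ∈ N.commutant) :
    ∃ T : Dilation hφ →L[ℂ] Dilation hφ, (∀ k, T (dilationIso hφ k) = dilationIso hφ (y k)) ∧
      (∀ k, adjoint T (dilationIso hφ k) = dilationIso hφ (adjoint y k)) ∧
      ∀ a z, dilationRep hφ a (T z) = T (dilationRep hφ a z) := by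
  obtain ⟨T, hT⟩ := exists_dilationCommutant hφ hy
  obtain ⟨T', hT'⟩ := exists_dilationCommutant hφ (star_mem (S := VonNeumannAlgebra K) hy)
  refine ⟨T, fun k => ?_, fun k => ?_, fun a z => ?_⟩
  · rw [dilationIso_apply, dilationIso_apply, hT]
  · refine ext_inner_right ℂ fun z => ?_
    rw [adjoint_inner_left]
    suffices e : innerSL ℂ (dilationIso hφ k) ∘L T = innerSL ℂ (dilationIso hφ (adjoint y k)) from
      congrArg (fun f => f z) e
    refine Dilation.clm_ext hφ fun a l => ?_
    -- With a ⊗ l = π(a) Q l, the relation for T^* reduces to y commuting with φ(a).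
    have hl : ∀ l, Dilation.tmul hφ a l = dilationRep hφ a (dilationIso hφ l) := fun l => by
      rw [dilationIso_apply, dilationRep_tmul, mul_one]
    rw [ContinuousLinearMap.comp_apply, hT, innerSL_apply_apply, innerSL_apply_apply, hl, hl,
      inner_dilationIso_rep, inner_dilationIso_rep, adjoint_inner_left]
    have h := (VonNeumannAlgebra.mem_commutant_iff.1 hy) (φ a : K →L[ℂ] K) (φ a).2
    exact congrArg (fun A : K →L[ℂ] K => ⟪k, A l⟫_ℂ) h
  · suffices e : dilationRep hφ a ∘L T = T ∘L dilationRep hφ a from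
      congrArg (fun f : Dilation hφ →L[ℂ] Dilation hφ => f z) e
    refine Dilation.clm_ext hφ fun b l => ?_
    rw [ContinuousLinearMap.comp_apply, ContinuousLinearMap.comp_apply, hT, dilationRep_tmul,
      dilationRep_tmul, hT]

end VertexData

/-! ### The operator Q^* R on the summands -/

section TensorOfAdjoint

variable {V : Type*} {G : SimpleGraph V} {W : MinimalWords G}
  {H K L : V → Type*}
  [∀ v, NormedAddCommGroup (H v)] [∀ v, InnerProductSpace ℂ (H v)] [∀ v, CompleteSpace (H v)]
  [∀ v, NormedAddCommGroup (K v)] [∀ v, InnerProductSpace ℂ (K v)] [∀ v, CompleteSpace (K v)]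
  [∀ v, NormedAddCommGroup (L v)] [∀ v, InnerProductSpace ℂ (L v)] [∀ v, CompleteSpace (L v)]
  {ξ : ∀ v, H v} {η : ∀ v, K v} {χ : ∀ v, L v}
  {Q : ∀ v, K v →ₗᵢ[ℂ] L v} (hQ : ∀ v, Q v (η v) = χ v)
  {R : ∀ v, H v →ₗᵢ[ℂ] L v} (hR : ∀ v, R v (ξ v) = χ v)

/-- R and Q^* both respect the word decomposition and act there as tensor products; so Q^* R is on
each word the tensor product of the operators Q_v^* R_v. -/
theorem adjoint_graphMap_graphMap_inclWord (T₀ : ∀ v, circ (ξ v) →L[ℂ] circ (η v))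
    (hT₀ : ∀ v (ζ : circ (ξ v)), (T₀ v ζ : K v) = adjoint (Q v).toContinuousLinearMap (R v ζ))
    (hη : ∀ v, ‖η v‖ = 1) (w : W.carrier) (z : WordSpace ξ w.1) :
    adjoint (graphMap W Q hQ).toContinuousLinearMap (graphMap W R hR (inclWord ξ W w z)) =
      inclWord η W w (HilbertTensor.map (fun i => T₀ (w.1.get i)) z) := by
  suffices e : adjoint (graphMap W Q hQ).toContinuousLinearMap ∘L
      (graphMap W R hR).toContinuousLinearMap ∘L (inclWord ξ W w).toContinuousLinearMap =
      (inclWord η W w).toContinuousLinearMap ∘L HilbertTensor.map (fun i => T₀ (w.1.get i)) from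
    congrArg (fun f : WordSpace ξ w.1 →L[ℂ] GraphSpace η W => f z) e
  refine HilbertTensor.clm_ext fun a => ?_
  change adjoint (graphMap W Q hQ).toContinuousLinearMap
    (graphMap W R hR (inclWord ξ W w (tprod a))) = inclWord η W w (HilbertTensor.map _ (tprod a))
  let f : ∀ v, circ (χ v) → circ (η v) := fun v x =>
    circProj (η v) (adjoint (Q v).toContinuousLinearMap x)
  have hf : ∀ v (x : circ (η v)) (y : circ (χ v)),
      ⟪Q v x, (y : L v)⟫_ℂ = ⟪(x : K v), (f v y : K v)⟫_ℂ := by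
    intro v x y
    rw [coe_circProj (hη v), inner_sub_right, inner_smul_right, ← inner_conj_symm (x : K v) (η v),
      inner_circ, map_zero, mul_zero, sub_zero]
    exact (adjoint_inner_right (Q v).toContinuousLinearMap _ _).symm
  rw [graphMap_inclWord, mapWord_tprod, adjoint_graphMap_inclWord f hf, HilbertTensor.map_tprod]
  refine congrArg _ (congrArg _ (funext fun i => ?_))
  rw [← circProj_of_mem (T₀ _ (a i)), hT₀]
  rfl

end TensorOfAdjoint

end

section

open ContinuousLinearMap (adjoint adjoint_inner_left adjoint_inner_right)

/-! ### The compression formula for the given vertex maps -/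

section Main

variable {V : Type*} {G : SimpleGraph V} {W : MinimalWords G} {H K : V → Type*}
  [∀ v, NormedAddCommGroup (H v)] [∀ v, InnerProductSpace ℂ (H v)] [∀ v, CompleteSpace (H v)]
  [∀ v, NormedAddCommGroup (K v)] [∀ v, InnerProductSpace ℂ (K v)] [∀ v, CompleteSpace (K v)]
  {A : ∀ v, StateAlgebra (H v)} {B : ∀ v, StateAlgebra (K v)}
  {φ : ∀ v, VN (A v).alg →ₗ[ℂ] VN (B v).alg} (hφ : ∀ v, IsUCP (φ v))

/-- The distinguished vector of the dilation space. -/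
abbrev dilationVec (v : V) : Dilation (hφ v) := dilationIso (hφ v) (B v).vec

theorem norm_dilationVec (v : V) : ‖dilationVec hφ v‖ = 1 :=
  ((dilationIso (hφ v)).norm_map _).trans (B v).norm_vec

variable (W) in
/-- The isometry from the graph product space to the graph product of the dilation spaces. -/
abbrev graphDilationIso : graphSpace W B →ₗᵢ[ℂ] GraphSpace (dilationVec hφ) W :=
  graphMap W (fun v => dilationIso (hφ v)) fun _ => rfl

/-- The product of the dilated operators. -/
abbrev dilatedProd (l : List (Σ v, VN (A v).alg)) :
    GraphSpace (dilationVec hφ) W →L[ℂ] GraphSpace (dilationVec hφ) W :=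
  leftProd (dilationVec hφ) W (norm_dilationVec hφ) (fun v => dilationRep (hφ v)) l

/-- The reduced operator `φ_{v_1}(a_1) ⋯ φ_{v_n}(a_n)`. -/
theorem exists_coe_eq_leftProd (l : List (Σ v, VN (A v).alg)) : ∃ y : VN (graphAlg W B),
    (y : graphSpace W B →L[ℂ] graphSpace W B) = leftProd (fun v => (B v).vec) W
      (fun v => (B v).norm_vec) (fun v x => (φ v x : K v →L[ℂ] K v)) l := by
  obtain ⟨w, a, rfl⟩ := exists_ofFn_sigma l
  refine ⟨graphProd W B w fun i => φ (w.get i) (a i), ?_⟩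
  rw [coe_graphProd, listProd, leftProd, leftProd, List.map_ofFn, List.map_ofFn]
  rfl

/-- The right actions used are those of N_v', for which η_v is cyclic because it is separating for
N_v; they lift by `exists_dilation_lift`. State preservation keeps φ_v(a) centered. -/
theorem inner_dilatedProd (hst : ∀ v x, vecState (B v).vec (φ v x) = vecState (A v).vec x)
    {l : List (Σ v, VN (A v).alg)} (hl : IsReducedList A G l) (k k' : graphSpace W B) :
    ⟪graphDilationIso W hφ k', dilatedProd hφ l (graphDilationIso W hφ k)⟫_ℂ =
      ⟪k', leftProd (fun v => (B v).vec) W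
        (fun v => (B v).norm_vec) (fun v x => (φ v x : K v →L[ℂ] K v)) l k⟫_ℂ :=
  inner_graphMap_leftProd (norm_dilationVec hφ) (fun v x => (φ v x : K v →L[ℂ] K v))
    (fun v => dilationRep (hφ v)) (fun _ => rfl) (fun v => (B v).norm_vec)
    (D := fun v => {y | y ∈ (B v).alg.commutant})
    (fun v a k k' => inner_dilationIso_rep (hφ v) a k' k)
    (fun v κ => dense_commutant (B v).separating κ)
    (fun v a _ hy k => congrArg (fun T : K v →L[ℂ] K v => T k)
      ((VonNeumannAlgebra.mem_commutant_iff.1 hy) (φ v a : K v →L[ℂ] K v) (φ v a).2))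
    (fun v _ hy => exists_dilation_lift (hφ v) hy) hl.1
    (fun p hp => (hst p.1 p.2).trans (hl.2 p hp)) k k'

end Main

end

section

open ContinuousLinearMap (adjoint adjoint_inner_left adjoint_inner_right)

/-! ### Normal ucp maps from intertwiners -/

section Intertwiners

variable {H K L ι : Type*} [NormedAddCommGroup H] [InnerProductSpace ℂ H] [CompleteSpace H]
  [NormedAddCommGroup K] [InnerProductSpace ℂ K] [CompleteSpace K]
  [NormedAddCommGroup L] [InnerProductSpace ℂ L] [CompleteSpace L]
  (a : ι → H →L[ℂ] H) (b : ι → L →L[ℂ] L)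

/-- The pair `(m, m')` is intertwined by all maps that intertwine the families `b` and `a`. -/
def Relates (m : H →L[ℂ] H) (m' : L →L[ℂ] L) : Prop :=
  ∀ j : L → H, (∀ i e, j (b i e) = a i (j e)) → ∀ e, j (m' e) = m (j e)

/-- The operator `t` intertwines the families `a` and `b`. -/
def Intertwines (t : H →L[ℂ] L) : Prop := ∀ i h, t (a i h) = b i (t h)

/-- The isometry `Q` takes its values in the space generated by the ranges of the intertwiners:
every `J` for which `J^* J` fixes these ranges satisfies `J^* J Q = Q`. -/
def IsGenerated (Q : K →ₗᵢ[ℂ] L) : Prop :=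
  ∀ (𝒮 : Set (L →L[ℂ] H)) (J : L →L[ℂ] lp (fun _ : 𝒮 => H) 2),
    (∀ t : H →L[ℂ] L, Intertwines a b t → ∀ h, adjoint J (J (t h)) = t h) →
      ∀ k, adjoint J (J (Q k)) = Q k

variable {a b}

theorem exists_intertwining_column_of_family
    (hab : ∀ i, ∃ j, adjoint (a i) = a j ∧ adjoint (b i) = b j) :
    ∃ (𝒮 : Set (L →L[ℂ] H)) (J : L →L[ℂ] lp (fun _ : 𝒮 => H) 2),
      (∀ s i e, J (b i e) s = a i (J e s)) ∧
      ∀ t : H →L[ℂ] L, Intertwines a b t → ∀ h, adjoint J (J (t h)) = t h := by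
  obtain ⟨𝒮, J, h1, h2⟩ := exists_intertwining_column (𝒢 := Set.range fun i => (a i, b i)) (by
    rintro _ ⟨i, rfl⟩
    obtain ⟨j, hj1, hj2⟩ := hab i
    exact ⟨j, Prod.ext hj1.symm hj2.symm⟩)
  refine ⟨𝒮, J, fun s i e => h1 s _ ⟨i, rfl⟩ e, fun t ht => h2 t ?_⟩
  rintro _ ⟨i, rfl⟩ h
  exact ht i h

variable {M : VonNeumannAlgebra H} {N : VonNeumannAlgebra K}

/-- The extension of a compression of generators to a normal ucp map. -/
theorem exists_isUCP_isNormal (hab : ∀ i, ∃ j, adjoint (a i) = a j ∧ adjoint (b i) = b j)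
    (hM : ∀ x : VN M, ∀ y : H →L[ℂ] H, (∀ i, a i * y = y * a i) →
      (x : H →L[ℂ] H) * y = y * (x : H →L[ℂ] H))
    {P : Set (H →L[ℂ] H)} (hP : ∀ 𝒮 : Set (L →L[ℂ] H), Determines P M 𝒮)
    {Q : K →ₗᵢ[ℂ] L} (hQ : IsGenerated a b Q)
    (hPQ : ∀ m ∈ P, ∃ m', Relates a b m m' ∧
      ∃ y : VN N, ∀ k k', ⟪Q k', m' (Q k)⟫_ℂ = ⟪k', (y : K →L[ℂ] K) k⟫_ℂ) :
    ∃ Φ : VN M →ₗ[ℂ] VN N, IsUCP Φ ∧ IsNormal Φ ∧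
      (∀ (x : VN M) m', Relates a b (x : H →L[ℂ] H) m' →
        ∀ k k', ⟪k', (Φ x : K →L[ℂ] K) k⟫_ℂ = ⟪Q k', m' (Q k)⟫_ℂ) ∧
      ∀ t : H →L[ℂ] L, Intertwines a b t → ∀ h k, t h = Q k → ∀ x : VN M,
        (Φ x : K →L[ℂ] K) k = adjoint Q.toContinuousLinearMap (t ((x : H →L[ℂ] H) h)) := by
  obtain ⟨𝒮, J, hJ, hJt⟩ := exists_intertwining_column_of_family hab
  have hJQ := hQ 𝒮 J hJt
  -- S is isometric since J^* J Q = Q; the map sought is x ↦ S^* (x ⊗ 1) S.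
  let S : K →L[ℂ] lp (fun _ : 𝒮 => H) 2 := J ∘L Q.toContinuousLinearMap
  have hSQ : ∀ k, S k = J (Q k) := fun _ => rfl
  have hSadj : ∀ z, adjoint S z = adjoint Q.toContinuousLinearMap (adjoint J z) := fun z => by
    rw [ContinuousLinearMap.adjoint_comp]
    rfl
  have hrel : ∀ m m', Relates a b m m' → ∀ k k',
      ⟪S k', lpAmpl 𝒮 m (S k)⟫_ℂ = ⟪Q k', m' (Q k)⟫_ℂ := by
    intro m m' h k k'
    -- Each coordinate of J is an admissible j in `Relates`, whence (m ⊗ 1) J = J m'; then J^* J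
    -- disappears by `hJQ`.
    have e : lpAmpl 𝒮 m (J (Q k)) = J (m' (Q k)) :=
      lp.ext (funext fun s => (h (fun z => J z s) (hJ s) (Q k)).symm)
    rw [hSQ, hSQ, e, ← adjoint_inner_left, hJQ]
  have hS : ∀ x : VN M, adjoint S ∘L lpAmpl 𝒮 (x : H →L[ℂ] H) ∘L S ∈ N.toStarSubalgebra := by
    refine (hP 𝒮).compression_mem S fun m hm => ?_
    obtain ⟨m', h1, y, hy⟩ := hPQ m hm
    exact ⟨y, fun k k' => (hrel m m' h1 k k').trans (hy k k')⟩
  refine ⟨compressionMap hS, isUCP_compressionMap hS fun k => ?_, isNormal_compressionMap hS,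
    fun x m' h k k' => (inner_compressionMap hS x k k').trans (hrel _ m' h k k'), ?_⟩
  · rw [hSadj, hSQ, hJQ]
    refine ext_inner_left ℂ fun k' => ?_
    exact (adjoint_inner_right Q.toContinuousLinearMap _ _).trans (Q.inner_map_map k' k)
  · intro t ht h k htk x
    have e : lpAmpl 𝒮 (x : H →L[ℂ] H) (J (t h)) = J (t ((x : H →L[ℂ] H) h)) := by
      refine lp.ext (funext fun s => ?_)
      -- A coordinate of J ∘ t is an operator on H commuting with the generators, hence with x. So x
      -- passes through J t without any action of x on L being available.
      let y : H →L[ℂ] H := lp.evalCLM ℂ (fun _ : 𝒮 => H) 2 s ∘L J ∘L t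
      have hy := hM x y fun i => ContinuousLinearMap.ext fun z => by
        change a i (J (t z) s) = J (t (a i z)) s
        rw [ht, hJ]
      exact congrArg (fun T : H →L[ℂ] H => T h) hy
    rw [compressionMap_apply, hSQ, ← htk, e, hSadj, hJt t ht]

end Intertwiners

end

section

open ContinuousLinearMap (adjoint adjoint_inner_left adjoint_inner_right)

/-! ### Generators, their dilations and the intertwiners between them -/

section Existence

variable {V : Type*} {G : SimpleGraph V} (W : MinimalWords G) {H K : V → Type*}
  [∀ v, NormedAddCommGroup (H v)] [∀ v, InnerProductSpace ℂ (H v)] [∀ v, CompleteSpace (H v)]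
  [∀ v, NormedAddCommGroup (K v)] [∀ v, InnerProductSpace ℂ (K v)] [∀ v, CompleteSpace (K v)]
  {A : ∀ v, StateAlgebra (H v)} {B : ∀ v, StateAlgebra (K v)}
  {φ : ∀ v, VN (A v).alg →ₗ[ℂ] VN (B v).alg} (hφ : ∀ v, IsUCP (φ v))

variable (A) in
/-- The elements of the vertex algebras, as operators on the graph product space. -/
def graphGen (p : Σ v, VN (A v).alg) : graphSpace W A →L[ℂ] graphSpace W A :=
  graphRep W A p.1 p.2

/-- The elements of the vertex algebras, as operators on the graph product of the dilation
spaces. -/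
def dilatedGen (p : Σ v, VN (A v).alg) :
    GraphSpace (dilationVec hφ) W →L[ℂ] GraphSpace (dilationVec hφ) W :=
  leftRep (dilationVec hφ) W (norm_dilationVec hφ) p.1 (dilationRep (hφ p.1) p.2)

theorem exists_adjoint_gen (p : Σ v, VN (A v).alg) :
    ∃ q, adjoint (graphGen W A p) = graphGen W A q ∧
      adjoint (dilatedGen W hφ p) = dilatedGen W hφ q := by
  refine ⟨⟨p.1, star p.2⟩, ?_, ?_⟩
  · rw [graphGen, graphGen, graphRep, adjoint_leftRep]
    rfl
  · rw [dilatedGen, dilatedGen, adjoint_leftRep, adjoint_dilationRep]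

theorem graphAlg_commute_of_gen (x : VN (graphAlg W A))
    (y : graphSpace W A →L[ℂ] graphSpace W A)
    (hy : ∀ p, graphGen W A p * y = y * graphGen W A p) :
    (x : graphSpace W A →L[ℂ] graphSpace W A) * y = y * x :=
  graphAlg_commute x.2 y (by
    rintro _ ⟨v, a, ha, rfl⟩
    exact hy ⟨v, a, ha⟩)

/-- R followed by the lifted right actions of the N_v' yields enough intertwiners, as the vacuum of
K is cyclic for these actions. -/
theorem isGenerated_graphDilationIso
    {R : ∀ v, H v →ₗᵢ[ℂ] Dilation (hφ v)} (hR : ∀ v, R v (A v).vec = dilationIso (hφ v) (B v).vec)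
    (hRx : ∀ v (x : VN (A v).alg) h, R v ((x : H v →L[ℂ] H v) h) = dilationRep (hφ v) x (R v h)) :
    IsGenerated (graphGen W A) (dilatedGen W hφ) (graphDilationIso W hφ) := by
  intro 𝒮 J hJ
  refine adjoint_column_graphMap (fun v => (A v).norm_vec) (norm_dilationVec hφ)
      (fun v (x : VN (A v).alg) => (x : H v →L[ℂ] H v)) (fun v => dilationRep (hφ v))
      (fun _ => rfl) (fun v => (B v).norm_vec) hR J (fun t ht => hJ t fun p z => ht p.1 p.2 z) hRx
      (D := fun v => {y | y ∈ (B v).alg.commutant})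
      (fun v κ => dense_commutant (B v).separating κ) (fun v y hy => ?_)
  obtain ⟨T, h1, -, h2⟩ := exists_dilation_lift (hφ v) hy
  exact ⟨T, h1, h2⟩

theorem listProd_eq_mul (p : Σ v, VN (A v).alg) (l : List (Σ v, VN (A v).alg)) :
    listProd W A (p :: l) = graphGen W A p * listProd W A l :=
  listProd_cons p l

theorem dilatedProd_nil : dilatedProd (W := W) hφ [] = 1 :=
  leftProd_nil (norm_dilationVec hφ) fun v => dilationRep (hφ v)

theorem dilatedProd_eq_mul (p : Σ v, VN (A v).alg) (l : List (Σ v, VN (A v).alg)) :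
    dilatedProd (W := W) hφ (p :: l) = dilatedGen W hφ p * dilatedProd hφ l :=
  leftProd_cons (norm_dilationVec hφ) (fun v => dilationRep (hφ v)) p l

theorem relates_listProd (l : List (Σ v, VN (A v).alg)) :
    Relates (graphGen W A) (dilatedGen W hφ) (listProd W A l) (dilatedProd hφ l) := by
  intro j hj e
  induction l with
  | nil => rw [dilatedProd_nil, listProd_nil, one_apply_eq_self, one_apply_eq_self]
  | cons p l ih =>
    rw [listProd_eq_mul, dilatedProd_eq_mul, mul_apply_eq_comp, mul_apply_eq_comp, hj, ih]

theorem graphProd_eq_of_inner {w : List V} {a : ∀ i : Fin w.length, VN (A (w.get i)).alg}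
    {y : VN (graphAlg W B)} (h : ∀ k k', ⟪k', (y : graphSpace W B →L[ℂ] graphSpace W B) k⟫_ℂ =
      ⟪k', leftProd (fun v => (B v).vec) W (fun v => (B v).norm_vec)
        (fun v x => (φ v x : K v →L[ℂ] K v)) (List.ofFn fun i => ⟨w.get i, a i⟩) k⟫_ℂ) :
    y = graphProd W B w fun i => φ (w.get i) (a i) := by
  refine Subtype.ext (ContinuousLinearMap.ext fun k => ext_inner_left ℂ fun k' => ?_)
  rw [h, coe_graphProd, listProd, leftProd, leftProd, List.map_ofFn, List.map_ofFn]
  rfl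

end Existence

/-! ### The L²-extensions at the vertices -/

section VertexExtension

variable {H K : Type*} [NormedAddCommGroup H] [InnerProductSpace ℂ H] [CompleteSpace H]
  [NormedAddCommGroup K] [InnerProductSpace ℂ K] [CompleteSpace K]
  {M : VonNeumannAlgebra H} {N : VonNeumannAlgebra K} {φ : VN M →ₗ[ℂ] VN N} (hφ : IsUCP φ)
  {ξ : H} {η : K} {R : H →ₗᵢ[ℂ] Dilation hφ}

/-- The `L²`-extension of a ucp map, in terms of its dilation. -/
def dilationExtension (R : H →ₗᵢ[ℂ] Dilation hφ) : H →L[ℂ] K :=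
  adjoint (dilationIso hφ).toContinuousLinearMap ∘L R.toContinuousLinearMap

/-- Writing Q for `dilationIso`, one has Q^* R x ξ = Q^* π(x) Q η = φ(x) η. -/
theorem isL2Extension_dilationExtension (hR : R ξ = dilationIso hφ η)
    (hRx : ∀ (x : VN M) h, R ((x : H →L[ℂ] H) h) = dilationRep hφ x (R h)) :
    IsL2Extension φ ξ η (dilationExtension hφ R) := by
  intro x
  refine ext_inner_left ℂ fun k => ?_
  refine (adjoint_inner_right (dilationIso hφ).toContinuousLinearMap _ _).trans ?_
  change ⟪dilationIso hφ k, R ((x : H →L[ℂ] H) ξ)⟫_ℂ = _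
  rw [hRx, hR, inner_dilationIso_rep]

theorem dilationExtension_mem_circ (hR : R ξ = dilationIso hφ η) (ζ : circ ξ) : dilationExtension hφ R ζ ∈ circ η := by
  rw [circ, Submodule.mem_orthogonal_singleton_iff_inner_right]
  refine (adjoint_inner_right (dilationIso hφ).toContinuousLinearMap _ _).trans ?_
  change ⟪dilationIso hφ η, R ζ⟫_ℂ = 0
  rw [← hR, R.inner_map_map, inner_circ]

end VertexExtension

end

section

open ContinuousLinearMap (adjoint adjoint_inner_left adjoint_inner_right)

section Isometry

variable {E F : Type*} [NormedAddCommGroup E] [InnerProductSpace ℂ E] [CompleteSpace E]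
  [NormedAddCommGroup F] [InnerProductSpace ℂ F] [CompleteSpace F] (Q : E →ₗᵢ[ℂ] F)

theorem inner_adjoint_isometry (k : E) (z : F) :
    ⟪k, adjoint Q.toContinuousLinearMap z⟫_ℂ = ⟪Q k, z⟫_ℂ :=
  adjoint_inner_right Q.toContinuousLinearMap k z

theorem adjoint_isometry_apply (k : E) : adjoint Q.toContinuousLinearMap (Q k) = k :=
  ext_inner_left ℂ fun l => (inner_adjoint_isometry Q l _).trans (Q.inner_map_map l k)

end Isometry

/-! ### The graph product map, its state and its L²-extension -/

section Existence

variable {V : Type*} {G : SimpleGraph V} (W : MinimalWords G) {H K : V → Type*}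
  [∀ v, NormedAddCommGroup (H v)] [∀ v, InnerProductSpace ℂ (H v)] [∀ v, CompleteSpace (H v)]
  [∀ v, NormedAddCommGroup (K v)] [∀ v, InnerProductSpace ℂ (K v)] [∀ v, CompleteSpace (K v)]
  {A : ∀ v, StateAlgebra (H v)} {B : ∀ v, StateAlgebra (K v)}
  {φ : ∀ v, VN (A v).alg →ₗ[ℂ] VN (B v).alg} (hφ : ∀ v, IsUCP (φ v))
  {R : ∀ v, H v →ₗᵢ[ℂ] Dilation (hφ v)} (hR : ∀ v, R v (A v).vec = dilationIso (hφ v) (B v).vec)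

/-- The isometry between graph product spaces given by the isometries `R_v`. -/
def graphIntertwiner : graphSpace W A →ₗᵢ[ℂ] GraphSpace (dilationVec hφ) W := graphMap W R hR

theorem graphIntertwiner_vacuum :
    graphIntertwiner W hφ hR (graphVacuum W A) = graphDilationIso W hφ (graphVacuum W B) :=
  graphMap_vacuum.trans graphMap_vacuum.symm

theorem intertwines_graphIntertwiner
    (hRx : ∀ v (x : VN (A v).alg) h, R v ((x : H v →L[ℂ] H v) h) = dilationRep (hφ v) x (R v h)) :
    Intertwines (graphGen W A) (dilatedGen W hφ)
      (graphIntertwiner W hφ hR).toContinuousLinearMap :=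
  fun p z => graphMap_leftRep (fun v => (A v).norm_vec) (norm_dilationVec hφ) (hRx p.1 p.2) z

/-- The graph product of ucp maps. -/
theorem exists_graphProduct_map
    (hst : ∀ v x, vecState (B v).vec (φ v x) = vecState (A v).vec x)
    (hRx : ∀ v (x : VN (A v).alg) h, R v ((x : H v →L[ℂ] H v) h) = dilationRep (hφ v) x (R v h)) :
    ∃ Φ : VN (graphAlg W A) →ₗ[ℂ] VN (graphAlg W B), IsUCP Φ ∧ IsNormal Φ ∧
      (∀ (w : List V) (a : ∀ i : Fin w.length, VN (A (w.get i)).alg),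
        IsReduced G w → (∀ i, (A (w.get i)).Centered (a i)) →
          Φ (graphProd W A w a) = graphProd W B w fun i => φ (w.get i) (a i)) ∧
      ∀ x : VN (graphAlg W A),
        (Φ x : graphSpace W B →L[ℂ] graphSpace W B) (graphVacuum W B) =
          adjoint (graphDilationIso W hφ).toContinuousLinearMap
            (graphIntertwiner W hφ hR ((x : graphSpace W A →L[ℂ] graphSpace W A)
              (graphVacuum W A))) := by
  obtain ⟨Φ, h1, h2, h3, h4⟩ := exists_isUCP_isNormal (N := graphAlg W B)
    (exists_adjoint_gen W hφ) (graphAlg_commute_of_gen W)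
    (fun _ => determines_listProd _) (isGenerated_graphDilationIso W hφ hR hRx) (by
      rintro _ ⟨l, hl, rfl⟩
      obtain ⟨y, hy⟩ := exists_coe_eq_leftProd (W := W) (φ := φ) l
      refine ⟨_, relates_listProd W hφ l, y, fun k k' => ?_⟩
      rw [hy]
      exact inner_dilatedProd hφ hst hl k k')
  refine ⟨Φ, h1, h2, fun w a hw ha => graphProd_eq_of_inner W fun k k' => ?_, fun x => ?_⟩
  · refine (h3 _ _ ?_ k k').trans (inner_dilatedProd hφ hst (isReducedList_ofFn hw ha) k k')
    rw [coe_graphProd]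
    exact relates_listProd W hφ _
  -- Apply the formula for intertwiners to R, which sends the vacuum of H to the image under Q of
  -- the vacuum of K.
  · exact h4 _ (intertwines_graphIntertwiner W hφ hR hRx) _ _ (graphIntertwiner_vacuum W hφ hR) x

/-- Q and R send the vacua to the same vector, so ⟪Ω, Q^* R x Ω⟫ = ⟪R Ω, R x Ω⟫, and R is isometric.
-/
theorem vecState_graphProduct_map {Φ : VN (graphAlg W A) →ₗ[ℂ] VN (graphAlg W B)}
    (hΦ : ∀ x : VN (graphAlg W A),
      (Φ x : graphSpace W B →L[ℂ] graphSpace W B) (graphVacuum W B) =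
        adjoint (graphDilationIso W hφ).toContinuousLinearMap
          (graphIntertwiner W hφ hR ((x : graphSpace W A →L[ℂ] graphSpace W A)
            (graphVacuum W A)))) (x : VN (graphAlg W A)) :
    vecState (graphVacuum W B) (Φ x) = vecState (graphVacuum W A) x := by
  rw [vecState, hΦ, inner_adjoint_isometry, ← graphIntertwiner_vacuum W hφ hR,
    LinearIsometry.inner_map_map, vecState]

/-- The adjoint of the dilating isometry, after the intertwiner. -/
def graphExtension : graphSpace W A →L[ℂ] graphSpace W B :=
  adjoint (graphDilationIso W hφ).toContinuousLinearMap ∘L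
    (graphIntertwiner W hφ hR).toContinuousLinearMap

theorem graphExtension_apply (z : graphSpace W A) : graphExtension W hφ hR z =
    adjoint (graphDilationIso W hφ).toContinuousLinearMap (graphIntertwiner W hφ hR z) := rfl

theorem graphExtension_vacuum :
    graphExtension W hφ hR (graphVacuum W A) = graphVacuum W B := by
  rw [graphExtension_apply, graphIntertwiner_vacuum, adjoint_isometry_apply]

/-- The restriction of the `L²`-extension to the complements of the distinguished vectors. -/
def circExtension (v : V) : circ (A v).vec →L[ℂ] circ (B v).vec :=
  ((dilationExtension (hφ v) (R v)).comp (Submodule.subtypeL _)).codRestrict _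
    fun ζ => dilationExtension_mem_circ (hφ v) (hR v) ζ

theorem graphExtension_inclWord (w : W.carrier) (z : WordSpace (fun v => (A v).vec) w.1) :
    graphExtension W hφ hR (inclWord (fun v => (A v).vec) W w z) =
      inclWord (fun v => (B v).vec) W w
        (HilbertTensor.map (fun i => circExtension hφ hR (w.1.get i)) z) :=
  adjoint_graphMap_graphMap_inclWord (fun _ => rfl) hR (circExtension hφ hR) (fun _ _ => rfl)
    (fun v => (B v).norm_vec) w z

/-- Normal maps are determined by their values on reduced operators. -/
theorem IsNormal.eq_of_graphProd {Φ Ψ : VN (graphAlg W A) →ₗ[ℂ] VN (graphAlg W B)}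
    (hΦ : IsNormal Φ) (hΨ : IsNormal Ψ)
    (h : ∀ (w : List V) (a : ∀ i : Fin w.length, VN (A (w.get i)).alg), IsReduced G w →
      (∀ i, (A (w.get i)).Centered (a i)) → Ψ (graphProd W A w a) = Φ (graphProd W A w a)) :
    Ψ = Φ := by
  refine (determines_listProd ℕ).linearMap_eq hΦ hΨ ?_
  rintro _ ⟨l, hl, rfl⟩
  obtain ⟨w, a, hw, ha, rfl⟩ := exists_graphProd hl
  exact ⟨_, coe_graphProd w a, h w a hw ha⟩

end Existence

end

end GraphProd

end

theorem proposition2p30 {V : Type*} {G : SimpleGraph V} (W : GraphProd.MinimalWords G)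
    {H K : V → Type*}
    [∀ v, NormedAddCommGroup (H v)] [∀ v, InnerProductSpace ℂ (H v)] [∀ v, CompleteSpace (H v)]
    [∀ v, NormedAddCommGroup (K v)] [∀ v, InnerProductSpace ℂ (K v)] [∀ v, CompleteSpace (K v)]
    (A : ∀ v, GraphProd.StateAlgebra (H v)) (B : ∀ v, GraphProd.StateAlgebra (K v))
    (φ : ∀ v, GraphProd.VN (A v).alg →ₗ[ℂ] GraphProd.VN (B v).alg)
    (hφ_ucp : ∀ v, GraphProd.IsUCP (φ v))
    (hφ_normal : ∀ v, GraphProd.IsNormal (φ v))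
    (hφ_state : ∀ v (x : GraphProd.VN (A v).alg),
      GraphProd.vecState (B v).vec (φ v x) = GraphProd.vecState (A v).vec x) :
    ∃ Φ : GraphProd.VN (GraphProd.graphAlg W A) →ₗ[ℂ] GraphProd.VN (GraphProd.graphAlg W B),
      -- `Φ` is a normal ucp map with the required values on reduced operators
      (GraphProd.IsUCP Φ ∧ GraphProd.IsNormal Φ ∧
        ∀ (w : List V) (a : ∀ i : Fin w.length, GraphProd.VN (A (w.get i)).alg),
          GraphProd.IsReduced G w → (∀ i, (A (w.get i)).Centered (a i)) →
            Φ (GraphProd.graphProd W A w a) =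
              GraphProd.graphProd W B w fun i => φ (w.get i) (a i)) ∧
      -- it is the only one
      (∀ Ψ : GraphProd.VN (GraphProd.graphAlg W A) →ₗ[ℂ] GraphProd.VN (GraphProd.graphAlg W B),
        (GraphProd.IsUCP Ψ ∧ GraphProd.IsNormal Ψ ∧
          ∀ (w : List V) (a : ∀ i : Fin w.length, GraphProd.VN (A (w.get i)).alg),
            GraphProd.IsReduced G w → (∀ i, (A (w.get i)).Centered (a i)) →
              Ψ (GraphProd.graphProd W A w a) =
                GraphProd.graphProd W B w fun i => φ (w.get i) (a i)) → Ψ = Φ) ∧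
      -- it intertwines the graph product states
      (∀ x, GraphProd.vecState (GraphProd.graphVacuum W B) (Φ x) =
        GraphProd.vecState (GraphProd.graphVacuum W A) x) ∧
      -- its `L²`-extension is the direct sum of the tensor products of those of the `φ v`
      ∃ (T : ∀ v, H v →L[ℂ] K v)
        (T₀ : ∀ v, GraphProd.circ (A v).vec →L[ℂ] GraphProd.circ (B v).vec)
        (TΦ : GraphProd.graphSpace W A →L[ℂ] GraphProd.graphSpace W B),
        (∀ v, GraphProd.IsL2Extension (φ v) (A v).vec (B v).vec (T v)) ∧
        (∀ v (ζ : GraphProd.circ (A v).vec), (T₀ v ζ : K v) = T v ζ) ∧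
        GraphProd.IsL2Extension Φ (GraphProd.graphVacuum W A) (GraphProd.graphVacuum W B) TΦ ∧
        TΦ (GraphProd.graphVacuum W A) = GraphProd.graphVacuum W B ∧
        ∀ (w : W.carrier) (z : GraphProd.WordSpace (fun v => (A v).vec) w.1),
          TΦ (GraphProd.inclWord (fun v => (A v).vec) W w z) =
            GraphProd.inclWord (fun v => (B v).vec) W w
              (GraphProd.HilbertTensor.map (fun i => T₀ (w.1.get i)) z) := by
  -- Cyclicity of ξ_v and preservation of the state give the isometries R_v; the map and its
  -- L²-extension are built from these and the vertex dilations.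
  choose R hR hRx using fun v =>
    GraphProd.exists_dilation_intertwiner (hφ_ucp v) (A v).cyclic (hφ_state v)
  obtain ⟨Φ, h1, h2, h3, h4⟩ := GraphProd.exists_graphProduct_map W hφ_ucp hR hφ_state hRx
  exact ⟨Φ, ⟨h1, h2, h3⟩,
    fun Ψ hΨ => h2.eq_of_graphProd W hΨ.2.1 fun w a hw ha =>
      (hΨ.2.2 w a hw ha).trans (h3 w a hw ha).symm,
    GraphProd.vecState_graphProduct_map W hφ_ucp hR h4,
    fun v => GraphProd.dilationExtension (hφ_ucp v) (R v), GraphProd.circExtension hφ_ucp hR,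
    GraphProd.graphExtension W hφ_ucp hR,
    fun v => GraphProd.isL2Extension_dilationExtension (hφ_ucp v) (hR v) (hRx v),
    fun v ζ => rfl, fun x => (h4 x).symm, GraphProd.graphExtension_vacuum W hφ_ucp hR,
    GraphProd.graphExtension_inclWord W hφ_ucp hR⟩
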